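/- Setting. Let $d\in\mathbb N$ and let $B=\sum_{j<k}B_{jk}\,dx_j\wedge dx_k$ be a closed 2-form on $\mathbb R^d$ with smooth components that are bounded together with all their derivatives. Let $A_k(x)=\sum_j\int_0^1 s\,x_jB_{jk}(sx)\,ds$ and $\varphi(x,y)=\int_{[y,x]}A$, the circulation of $A$ along the segment from $y$ to $x$. Let $s_0(1)$ be the Fréchet space of smooth functions on $\mathbb R^{2d}$ that are bounded together with all their derivatives. For $\phi\in s_0(1)$, $\mathfrak{op}^A(\phi)$ is the operator on $\mathscr S(\mathbb R^d)$ with kernel $(k^A\phi)(x,y)=(2\pi)^{-d}\int e^{i\xi\cdot(x-y)}e^{i\varphi(x,y)}\phi\big(\tfrac{x+y}2,\xi\big)\,d\xi$, i.e. $\mathfrak{op}^A(\phi)f(x)=(2\pi)^{-d}\int\!\big(\int e^{i\xi\cdot(x-y)}e^{i\varphi(x,y)}\phi(\tfrac{x+y}2,\xi)f(y)\,dy\big)d\xi$. The magnetic Moyal product $\psi\star^B\phi$ is the symbol with $\mathfrak{op}^A(\psi\star^B\phi)=\mathfrak{op}^A(\psi)\,\mathfrak{op}^A(\phi)$ on $\mathscr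 S(\mathbb R^d)$. For $\Phi\in\mathscr S'(\mathbb R^{4d})$, let $K^A\Phi\in\mathscr S'(\mathbb R^{4d})$ be given, through extension by transposition from Schwartz functions, by $$(K^A\Phi)(x_L,x_R,y_L,y_R)=\frac1{(2\pi)^{2d}}\int d\xi_L\,d\xi_R\; e^{i[\xi_L\cdot(x_L-y_L)-\xi_R\cdot(x_R-y_R)]}\,e^{i[\varphi(x_L,y_L)-\varphi(x_R,y_R)]}\,\Phi\Big(\frac{x_L+y_L}2,\xi_L,\frac{x_R+y_R}2,\xi_R\Big).$$ The super operator $\mathfrak{Op}^A(\Phi)$ sends an operator $T$ with kernel $t\in\mathscr S(\mathbb R^{2d})$ to the operator with distributional kernel $u\in\mathscr S'(\mathbb R^{2d})$, $\langle u,F\rangle=\langle K^A\Phi,F\otimes t\rangle$ for $F\in\mathscr S(\mathbb R^{2d})$, i.e. $\langle(\mathfrak{Op}^A(\Phi)T)f,g\rangle=\langle K^A\Phi,(g\otimes f)\otimes t\rangle$ for $f,g\in\mathscr S(\mathbb R^d)$ (bilinear brackets). Let $\mathcal B_1(L^2(\mathbb R^d))$ be the space of trace-class operators with the trace norm; it contains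 the operators with Schwartz kernel as a dense subspace. Theorem. Let $(\phi_n)_{n\in\mathbb N_0}$ be a sequence in $s_0(1)$ such that the partial sums of $\sum_{n=0}^\infty\overline{\phi_n}\star^B\phi_n$ form a bounded sequence in $s_0(1)$ and converge pointwise to $1$ on $\mathbb R^{2d}$. Then the partial sums of $\sum_{n=0}^\infty\phi_n\otimes\overline{\phi_n}$, where $(\phi_n\otimes\overline{\phi_n})(X_L,X_R)=\phi_n(X_L)\overline{\phi_n(X_R)}$, converge in the weak* topology of $\mathscr S'(\mathbb R^{4d})$ to a tempered distribution $\Phi$, and $\mathfrak{Op}^A(\Phi)$ extends to a bounded linear map on $\mathcal B_1(L^2(\mathbb R^d))$ that is completely positive (for every $k\in\mathbb N$, $\mathfrak{Op}^A(\Phi)\otimes\mathrm{Id}$ maps positive elements of $\mathcal B_1(L^2(\mathbb R^d))\otimes\mathcal B(\mathbb C^k)$ to positive operators) and trace preserving. -/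

import Mathlib

open MeasureTheory Filter Topology
open scoped SchwartzMap InnerProductSpace ComplexConjugate ComplexOrder ContDiff

noncomputable section

/-! ## Regular magnetic fields, transversal gauge, circulation -/

/-- Configuration space `ℝ^d` with its Euclidean norm. -/
abbrev ConfSpace (d : ℕ) : Type := EuclideanSpace ℝ (Fin d)

/-- Phase space `ℝ^{2d}`, with points `X = (x, ξ)`. -/
abbrev PhaseSpace (d : ℕ) : Type := ConfSpace d × ConfSpace d

/-- The Hilbert space `L²(ℝ^d)`. -/
abbrev L2Space (d : ℕ) : Type := Lp ℂ 2 (volume : Measure (ConfSpace d))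

/-- A regular magnetic field on `ℝ^d`: a closed 2-form `B = ∑_{j<k} B_{jk} dx_j ∧ dx_k` whose
components are smooth and bounded together with all their derivatives. -/
structure MagneticField (d : ℕ) where
  /-- the components `B_{jk}` -/
  comp : Fin d → Fin d → ConfSpace d → ℝ
  antisymm : ∀ j k x, comp j k x = -comp k j x
  smooth : ∀ j k, ContDiff ℝ ∞ (comp j k)
  bounded : ∀ j k, ∀ n : ℕ, ∃ C : ℝ, ∀ x, ‖iteratedFDeriv ℝ n (comp j k) x‖ ≤ C
  closed : ∀ i j k x,
    fderiv ℝ (comp j k) x (EuclideanSpace.single i 1)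
      + fderiv ℝ (comp k i) x (EuclideanSpace.single j 1)
      + fderiv ℝ (comp i j) x (EuclideanSpace.single k 1) = 0

/-- The transversal gauge `A_k(x) = ∑_j ∫_0^1 s x_j B_{jk}(s x) ds`. -/
def MagneticField.potential {d : ℕ} (B : MagneticField d) (k : Fin d) (x : ConfSpace d) : ℝ :=
  ∑ j, ∫ s in (0 : ℝ)..1, s * x j * B.comp j k (s • x)

/-- The circulation `φ(x, y) = ∫_{[y,x]} A` of the potential along the segment from `y` to `x`. -/
def MagneticField.circulation {d : ℕ} (B : MagneticField d) (x y : ConfSpace d) : ℝ :=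
  ∫ t in (0 : ℝ)..1, ∑ k, B.potential k (y + t • (x - y)) * (x k - y k)

/-! ## The symbol class `s₀(1)` -/

/-- The Hörmander class `s₀(1)`: smooth functions on `ℝ^{2d}` all of whose derivatives are
bounded. -/
def IsHormander {d : ℕ} (φ : PhaseSpace d → ℂ) : Prop :=
  ContDiff ℝ ∞ φ ∧ ∀ k : ℕ, ∃ C : ℝ, ∀ X, ‖iteratedFDeriv ℝ k φ X‖ ≤ C

/-- A sequence of symbols which is a bounded sequence in the Fréchet space `s₀(1)`: all its members
are smooth, and every derivative is bounded on `ℝ^{2d}`, uniformly in the index. -/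
def IsBoundedInHormander {d : ℕ} (ψ : ℕ → PhaseSpace d → ℂ) : Prop :=
  (∀ N, ContDiff ℝ ∞ (ψ N)) ∧
    ∀ k : ℕ, ∃ C : ℝ, ∀ N X, ‖iteratedFDeriv ℝ k (ψ N) X‖ ≤ C

/-! ## Magnetic Weyl quantization and the magnetic Moyal product on `s₀(1)` -/

/-- The magnetic Weyl quantization `op^A(φ)`, that is, the operator with kernel
`(2π)^{-d} ∫ e^{iξ·(x-y)} e^{iφ(x,y)} φ((x+y)/2, ξ) dξ`, written for a symbol in `s₀(1)` and a
Schwartz function `f`: for these the integral over `y` converges absolutely and decays rapidly in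
`ξ`, so that the iterated integral (first `y`, then `ξ`) converges absolutely for every `x`, and
the result is again a Schwartz function of `x`. -/
def magWeylOp {d : ℕ} (B : MagneticField d) (φ : PhaseSpace d → ℂ) (f : ConfSpace d → ℂ)
    (x : ConfSpace d) : ℂ :=
  (((2 * Real.pi) ^ d : ℝ) : ℂ)⁻¹ *
    ∫ ξ : ConfSpace d, ∫ y : ConfSpace d,
      Complex.exp (Complex.I * ((⟪ξ, x - y⟫_ℝ + B.circulation x y : ℝ) : ℂ))
        * φ ((1 / 2 : ℝ) • (x + y), ξ) * f y

/-- `χ` is the magnetic Moyal product `ψ ⋆^B φ` of two symbols in `s₀(1)`: the symbol of the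
composition, `op^A(ψ ⋆^B φ) = op^A(ψ) op^A(φ)` on Schwartz functions. Since `op^A` is injective,
there is at most one such symbol `χ` in `s₀(1)`. -/
def IsMoyalProduct {d : ℕ} (B : MagneticField d) (ψ φ χ : PhaseSpace d → ℂ) : Prop :=
  ∀ f : 𝓢(ConfSpace d, ℂ), magWeylOp B χ f = magWeylOp B ψ (magWeylOp B φ f)

/-! ## Tensor products of Schwartz functions -/

theorem norm_iteratedFDeriv_comp_le_of_norm_le_one {E G : Type*} [NormedAddCommGroup E]
    [NormedSpace ℝ E] [NormedAddCommGroup G] [NormedSpace ℝ G] (f : 𝓢(E, ℂ)) (L : G →L[ℝ] E)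
    (hL : ‖L‖ ≤ 1) (i : ℕ) (p : G) :
    ‖iteratedFDeriv ℝ i (fun q => f (L q)) p‖ ≤ ‖iteratedFDeriv ℝ i f (L p)‖ := by
  have h := L.iteratedFDeriv_comp_right (f := f) (f.smooth i) p (i := i) le_rfl
  change ‖iteratedFDeriv ℝ i (f ∘ L) p‖ ≤ _
  rw [h]
  refine (ContinuousMultilinearMap.norm_compContinuousLinearMap_le _ _).trans ?_
  refine mul_le_of_le_one_right (norm_nonneg _) ?_
  exact Finset.prod_le_one (fun _ _ => norm_nonneg _) (fun _ _ => hL)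

/-- The tensor product `(f ⊗ g)(x, y) = f(x) g(y)` of two Schwartz functions. -/
def schwartzTensor {E F : Type*} [NormedAddCommGroup E] [NormedSpace ℝ E]
    [NormedAddCommGroup F] [NormedSpace ℝ F] (f : 𝓢(E, ℂ)) (g : 𝓢(F, ℂ)) : 𝓢(E × F, ℂ) where
  toFun p := f p.1 * g p.2
  smooth' := ((f.smooth ⊤).comp contDiff_fst).mul ((g.smooth ⊤).comp contDiff_snd)
  decay' k n := by
    choose Cf hf using f.decay'
    choose Cg hg using g.decay'
    refine ⟨∑ i ∈ Finset.range (n + 1), (n.choose i : ℝ) *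
      (Cf k i * Cg 0 (n - i) + Cf 0 i * Cg k (n - i)), fun p => ?_⟩
    have hmul := norm_iteratedFDeriv_mul_le (𝕜 := ℝ) (A := ℂ) (N := ∞)
      ((f.smooth ⊤).comp (contDiff_fst (𝕜 := ℝ) (E := E) (F := F)))
      ((g.smooth ⊤).comp (contDiff_snd (𝕜 := ℝ) (E := E) (F := F))) p (n := n)
      (by exact_mod_cast le_top)
    refine (mul_le_mul_of_nonneg_left hmul (by positivity)).trans ?_
    rw [Finset.mul_sum]
    refine Finset.sum_le_sum fun i _ => ?_
    have h1 := norm_iteratedFDeriv_comp_le_of_norm_le_one f (ContinuousLinearMap.fst ℝ E F)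
      (ContinuousLinearMap.norm_fst_le ℝ E F) i p
    have h2 := norm_iteratedFDeriv_comp_le_of_norm_le_one g (ContinuousLinearMap.snd ℝ E F)
      (ContinuousLinearMap.norm_snd_le ℝ E F) (n - i) p
    have hp : ‖p‖ ^ k ≤ ‖p.1‖ ^ k + ‖p.2‖ ^ k := by
      rw [Prod.norm_def]
      rcases max_cases ‖p.1‖ ‖p.2‖ with h | h <;> rw [h.1] <;>
        linarith [pow_nonneg (norm_nonneg p.1) k, pow_nonneg (norm_nonneg p.2) k]
    have a1 := hf k i p.1
    have a2 := hf 0 i p.1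
    have b1 := hg k (n - i) p.2
    have b2 := hg 0 (n - i) p.2
    simp only [pow_zero, one_mul] at a2 b2
    set u := ‖iteratedFDeriv ℝ i f p.1‖
    set w := ‖iteratedFDeriv ℝ (n - i) g p.2‖
    have hu : 0 ≤ u := norm_nonneg _
    have hw : 0 ≤ w := norm_nonneg _
    calc ‖p‖ ^ k * ((n.choose i : ℝ) * ‖iteratedFDeriv ℝ i (⇑f ∘ Prod.fst) p‖ *
          ‖iteratedFDeriv ℝ (n - i) (⇑g ∘ Prod.snd) p‖)
        ≤ (‖p.1‖ ^ k + ‖p.2‖ ^ k) * ((n.choose i : ℝ) * u * w) := by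
          gcongr
          · exact h1
          · exact h2
      _ = (n.choose i : ℝ) * ((‖p.1‖ ^ k * u) * w + u * (‖p.2‖ ^ k * w)) := by ring
      _ ≤ _ := by
          have c1 : 0 ≤ ‖p.1‖ ^ k * u := by positivity
          refine mul_le_mul_of_nonneg_left (add_le_add ?_ ?_) (by positivity)
          · exact mul_le_mul a1 b2 hw (c1.trans a1)
          · exact mul_le_mul a2 b1 (by positivity) (hu.trans a2)

/-! ## Magnetic super Weyl quantization -/

/-- The formal transpose of the magnetic super Weyl transform
`(K^A Φ)(x_L, x_R, y_L, y_R) = (2π)^{-2d} ∫∫ e^{i[ξ_L·(x_L-y_L) - ξ_R·(x_R-y_R)]}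
  e^{i[φ(x_L,y_L) - φ(x_R,y_R)]} Φ((x_L+y_L)/2, ξ_L, (x_R+y_R)/2, ξ_R) dξ_L dξ_R`,
so that `∫ (K^A Φ) H = ∫ Φ · superWeylTranspose H`. It results from the substitution `x = z + v/2`,
`y = z - v/2` (of Jacobian one) in the left and in the right variables. A kernel has its variables
in the order `((x_L, x_R), (y_L, y_R))`, a super symbol in the order `((z_L, ζ_L), (z_R, ζ_R))`. -/
def superWeylTranspose {d : ℕ} (B : MagneticField d)
    (H : (ConfSpace d × ConfSpace d) × (ConfSpace d × ConfSpace d) → ℂ)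
    (Z : PhaseSpace d × PhaseSpace d) : ℂ :=
  (((2 * Real.pi) ^ (2 * d) : ℝ) : ℂ)⁻¹ *
    ∫ v : ConfSpace d × ConfSpace d,
      Complex.exp (Complex.I * ((⟪Z.1.2, v.1⟫_ℝ - ⟪Z.2.2, v.2⟫_ℝ
          + B.circulation (Z.1.1 + (1 / 2 : ℝ) • v.1) (Z.1.1 - (1 / 2 : ℝ) • v.1)
          - B.circulation (Z.2.1 + (1 / 2 : ℝ) • v.2) (Z.2.1 - (1 / 2 : ℝ) • v.2) : ℝ) : ℂ))
        * H ((Z.1.1 + (1 / 2 : ℝ) • v.1, Z.2.1 + (1 / 2 : ℝ) • v.2),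
             (Z.1.1 - (1 / 2 : ℝ) • v.1, Z.2.1 - (1 / 2 : ℝ) • v.2))

/-- `K = K^A Φ` for tempered distributions: for every test function `H`, the transposed transform
of `H` is a Schwartz function `G`, and `⟨K, H⟩ = ⟨Φ, G⟩`. -/
def IsSuperWeylTransform {d : ℕ} (B : MagneticField d)
    (Φ : 𝓢'(PhaseSpace d × PhaseSpace d, ℂ))
    (K : 𝓢'((ConfSpace d × ConfSpace d) × (ConfSpace d × ConfSpace d), ℂ)) : Prop :=
  ∀ H : 𝓢((ConfSpace d × ConfSpace d) × (ConfSpace d × ConfSpace d), ℂ),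
    ∃ G : 𝓢(PhaseSpace d × PhaseSpace d, ℂ), ⇑G = superWeylTranspose B H ∧ K H = Φ G

/-- `T` is the smoothing operator with integral kernel `t`, i.e. `T = int(t)`. -/
def IsSmoothingWithKernel {d : ℕ} (T : L2Space d →L[ℂ] L2Space d)
    (t : 𝓢(ConfSpace d × ConfSpace d, ℂ)) : Prop :=
  ∀ f : L2Space d, T f =ᵐ[volume] fun x => ∫ y, t (x, y) * f y

/-- The partial sums of `∑ φ_n ⊗ conj φ_n` converge to `Φ` in the weak* topology of
`𝓢'(ℝ^{4d})`. -/
def HasWeakStarTensorSum {d : ℕ} (φ : ℕ → PhaseSpace d → ℂ)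
    (Φ : 𝓢'(PhaseSpace d × PhaseSpace d, ℂ)) : Prop :=
  ∀ G : 𝓢(PhaseSpace d × PhaseSpace d, ℂ),
    Tendsto (fun N : ℕ => ∫ Z : PhaseSpace d × PhaseSpace d,
      (∑ n ∈ Finset.range N, φ n Z.1 * conj (φ n Z.2)) * G Z) atTop (𝓝 (Φ G))

/-! ## Trace-class operators -/

section TraceClass

variable {H : Type*} [NormedAddCommGroup H] [InnerProductSpace ℂ H]

/-- `T = ∑_n |x_n⟩⟨y_n|` with `∑_n ‖x_n‖ ‖y_n‖ < ∞`. -/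
def IsNuclearRep (T : H →L[ℂ] H) (x y : ℕ → H) : Prop :=
  Summable (fun n => ‖x n‖ * ‖y n‖) ∧ ∀ f, HasSum (fun n => ⟪y n, f⟫_ℂ • x n) (T f)

theorem IsNuclearRep.exists_add {S T : H →L[ℂ] H} {x y x' y' : ℕ → H} (hS : IsNuclearRep S x y)
    (hT : IsNuclearRep T x' y') : ∃ u v, IsNuclearRep (S + T) u v := by
  refine ⟨Sum.elim x x' ∘ Equiv.natSumNatEquivNat.symm,
    Sum.elim y y' ∘ Equiv.natSumNatEquivNat.symm, ?_, fun f => ?_⟩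
  · refine (Equiv.summable_iff Equiv.natSumNatEquivNat.symm
      (f := fun a => ‖Sum.elim x x' a‖ * ‖Sum.elim y y' a‖)).mpr ?_
    exact (HasSum.sum (f := fun a => ‖Sum.elim x x' a‖ * ‖Sum.elim y y' a‖)
      hS.1.hasSum hT.1.hasSum).summable
  · refine (Equiv.hasSum_iff Equiv.natSumNatEquivNat.symm
      (f := fun a => ⟪Sum.elim y y' a, f⟫_ℂ • Sum.elim x x' a)).mpr ?_
    exact HasSum.sum (f := fun a => ⟪Sum.elim y y' a, f⟫_ℂ • Sum.elim x x' a) (hS.2 f) (hT.2 f)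

/-- The trace-class operators `𝓑₁(H)`: the nuclear operators on the Hilbert space `H`. -/
def traceClass (H : Type*) [NormedAddCommGroup H] [InnerProductSpace ℂ H] :
    Submodule ℂ (H →L[ℂ] H) where
  carrier := {T | ∃ x y, IsNuclearRep T x y}
  zero_mem' := ⟨0, 0, by simp, fun f => by simp⟩
  add_mem' := by
    rintro S T ⟨x, y, hS⟩ ⟨x', y', hT⟩
    exact hS.exists_add hT
  smul_mem' := by
    rintro c T ⟨x, y, h1, h2⟩
    refine ⟨fun n => c • x n, y, ?_, fun f => ?_⟩
    · simpa [norm_smul, mul_assoc] using h1.mul_left ‖c‖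
    · change HasSum (fun n => ⟪y n, f⟫_ℂ • c • x n) (c • T f)
      simpa only [smul_comm c] using (h2 f).const_smul c

/-- The trace norm: the infimum of `∑_n ‖x_n‖ ‖y_n‖` over all nuclear representations. -/
def traceNorm (T : H →L[ℂ] H) : ℝ :=
  sInf {c | ∃ x y, IsNuclearRep T x y ∧ c = ∑' n, ‖x n‖ * ‖y n‖}

/-- `T` has trace `τ`: `∑_i ⟨e_i, T e_i⟩ = τ` (unconditionally) for every Hilbert basis `e`. -/
def HasTrace {H : Type*} [NormedAddCommGroup H] [InnerProductSpace ℂ H] (T : H →L[ℂ] H) (τ : ℂ) :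
    Prop :=
  ∀ (s : Set H) (e : HilbertBasis s ℂ H), HasSum (fun i => ⟪e i, T (e i)⟫_ℂ) τ

/-- Boundedness with respect to the trace norm. -/
def IsTraceNormBounded (S : traceClass H →ₗ[ℂ] traceClass H) : Prop :=
  ∃ C : ℝ, ∀ T : traceClass H, traceNorm (S T : H →L[ℂ] H) ≤ C * traceNorm (T : H →L[ℂ] H)

/-- A `k × k` matrix of operators on `H` is positive as an operator on `H ⊗ ℂ^k = H^k`. -/
def IsPositiveBlock {k : ℕ} (T : Fin k → Fin k → H →L[ℂ] H) : Prop :=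
  ∀ v : Fin k → H, 0 ≤ ∑ i, ∑ j, ⟪v i, T i j (v j)⟫_ℂ

/-- Complete positivity: for every `k`, the map `S ⊗ id` on `𝓑₁(H) ⊗ 𝓑(ℂ^k)`, i.e. `S` applied to
each entry of a `k × k` matrix of trace-class operators, preserves positivity. -/
def IsCompletelyPositive (S : traceClass H →ₗ[ℂ] traceClass H) : Prop :=
  ∀ (k : ℕ) (T : Fin k → Fin k → traceClass H),
    IsPositiveBlock (fun i j => (T i j : H →L[ℂ] H)) →
      IsPositiveBlock (fun i j => (S (T i j) : H →L[ℂ] H))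

/-- Trace preservation: `T` and `S T` have the same trace. -/
def IsTracePreserving (S : traceClass H →ₗ[ℂ] traceClass H) : Prop :=
  ∀ T : traceClass H, ∃ τ : ℂ, HasTrace (T : H →L[ℂ] H) τ ∧ HasTrace (S T : H →L[ℂ] H) τ

end TraceClass

/-- The linear map `S` on trace-class operators is given by the magnetic super Weyl quantization
`Op^A(Φ) = int ∘ Int(K^A Φ) ∘ int⁻¹`: every `t ∈ 𝓢(ℝ^{2d})` is the kernel of a trace-class
operator `T`, and `S T` has the distributional kernel `Int(K^A Φ) t`, that is,
`⟨(S T) f, g⟩ = ⟨Int(K^A Φ) t, g ⊗ f⟩ = ⟨K^A Φ, (g ⊗ f) ⊗ t⟩` for all Schwartz functions `f, g`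
(bilinear brackets). The smoothing operators are dense in the trace class, so a bounded `S` with
this property is the only bounded extension of `Op^A(Φ)`. -/
def IsMagSuperOp {d : ℕ} (B : MagneticField d) (Φ : 𝓢'(PhaseSpace d × PhaseSpace d, ℂ))
    (S : traceClass (L2Space d) →ₗ[ℂ] traceClass (L2Space d)) : Prop :=
  ∃ K : 𝓢'((ConfSpace d × ConfSpace d) × (ConfSpace d × ConfSpace d), ℂ),
    IsSuperWeylTransform B Φ K ∧
    ∀ t : 𝓢(ConfSpace d × ConfSpace d, ℂ), ∃ T : traceClass (L2Space d),
      IsSmoothingWithKernel (T : L2Space d →L[ℂ] L2Space d) t ∧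
      ∀ g f : 𝓢(ConfSpace d, ℂ),
        ∫ x, g x * ((S T : L2Space d →L[ℂ] L2Space d) (f.toLp 2)) x
          = K (schwartzTensor (schwartzTensor g f) t)

end

/-!
The operators `A n = op^A(φ n)` are the Kraus operators of the map. The Moyal product `χ n` of
`conj (φ n)` and `φ n` is the symbol of `(A n)† A n`. Weakly, `⟨op^A(χ) f, f⟩` is the integral of `χ`
against a Schwartz function, the magnetic Wigner transform of `conj f ⊗ f`, so bounded pointwise
convergence of `∑ χ n` to `1` gives `∑ ‖A n f‖² = ‖f‖²` by dominated convergence: first for Schwartz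
functions (`hasSum_norm_sq_magWeyl`), then, the `A n` being contractions, on `L²`.

For any sequence of operators on a Hilbert space with `∑ ‖A n f‖² = ‖f‖²`, the map
`T ↦ ∑ A n T (A n)†` converges on rank one operators, hence on nuclear operators, does not increase
the trace norm, is completely positive and preserves the trace (`krausMap`).

It remains to identify this map with the super operator of `∑ φ n ⊗ conj (φ n)`. The transposed
super Weyl transform `superWigner` is an oscillatory transform of Schwartz functions with a
continuous right inverse, so the weak* convergence of the series amounts to the convergence of
`∑ n, ∫ (φ n ⊗ conj (φ n)) · superWigner H` for Schwartz functions `H` of the four kernel variables.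
On a tensor product `H = (g₁ ⊗ g₂) ⊗ (g₃ ⊗ g₄)` the `n`-th term is
`(∫ g₁ A n g₃) · conj (∫ conj g₂ A n (conj g₄))`, and the sum of the absolute values is at most the
product of the four `L²` norms, by Cauchy–Schwarz. A general `H` is a superposition, with integrable
coefficients, of time-frequency shifts of one tensor product of windows; these shifts are themselves
tensor products of functions with the same `L²` norms. The functionals commute with such
superpositions (`CommutesWithSuperposition`), which gives absolute convergence with a bound by
Schwartz seminorms of `H` (`exists_hasSum_superPairing`).

The same device shows that `A n T (A n)†` has the kernel prescribed by `φ n ⊗ conj (φ n)`, if `T` has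
a Schwartz kernel `t`: both sides, tested on `g` and `f`, commute with superpositions in `t`, and they
agree when `t` is a tensor product (`IsSmoothingWithKernel.inner_kraus`). That an operator with a
Schwartz kernel is nuclear follows by writing it as a product of two Hilbert–Schmidt operators
(`exists_isSmoothingWithKernel`).

That `op^A(φ)` maps Schwartz functions to Schwartz functions is obtained from the rapid decay of the
inner integral in the momentum, and from the fact that derivatives and coordinate multiples of the
oscillatory integrals are again finite sums of integrals of the same type (`WeylData`).
-/

noncomputable section

/-! ### Nuclear representations and the trace -/

section Kraus

variable {H : Type*} [NormedAddCommGroup H] [InnerProductSpace ℂ H]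

theorem sum_mul_le_of_sum_sq_le {ι : Type*} (s : Finset ι) (f g : ι → ℝ) {a b : ℝ}
    (ha : 0 ≤ a) (hb : 0 ≤ b) (hf : ∑ i ∈ s, f i ^ 2 ≤ a ^ 2) (hg : ∑ i ∈ s, g i ^ 2 ≤ b ^ 2) :
    ∑ i ∈ s, f i * g i ≤ a * b :=
  (Real.sum_mul_le_sqrt_mul_sqrt s f g).trans
    (mul_le_mul (Real.sqrt_le_iff.2 ⟨ha, hf⟩) (Real.sqrt_le_iff.2 ⟨hb, hg⟩)
      (Real.sqrt_nonneg _) ha)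

/-- A nuclear representation indexed by a countable type can be indexed by `ℕ`. -/
theorem exists_isNuclearRep_of_countable {ι : Type*} [Countable ι] {T : H →L[ℂ] H} {x y : ι → H}
    (hs : Summable fun i => ‖x i‖ * ‖y i‖) (hT : ∀ f, HasSum (fun i => ⟪y i, f⟫_ℂ • x i) (T f)) :
    ∃ u v, IsNuclearRep T u v ∧ ∑' n, ‖u n‖ * ‖v n‖ = ∑' i, ‖x i‖ * ‖y i‖ := by
  obtain ⟨e, he⟩ := exists_injective_nat ι
  have h1 : (fun n => ‖Function.extend e x 0 n‖ * ‖Function.extend e y 0 n‖)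
      = Function.extend e (fun i => ‖x i‖ * ‖y i‖) 0 := by
    funext n
    by_cases hn : ∃ i, e i = n
    · obtain ⟨i, rfl⟩ := hn
      simp [he.extend_apply]
    · simp [Function.extend_apply' _ _ _ hn]
  have h2 := (hasSum_extend_zero he).2 hs.hasSum
  refine ⟨Function.extend e x 0, Function.extend e y 0, ⟨?_, fun f => ?_⟩, ?_⟩
  · rw [h1]; exact h2.summable
  · have h3 : (fun n => ⟪Function.extend e y 0 n, f⟫_ℂ • Function.extend e x 0 n)
        = Function.extend e (fun i => ⟪y i, f⟫_ℂ • x i) 0 := by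
      funext n
      by_cases hn : ∃ i, e i = n
      · obtain ⟨i, rfl⟩ := hn
        simp [he.extend_apply]
      · simp [Function.extend_apply' _ _ _ hn]
    rw [h3]
    exact (hasSum_extend_zero he).2 (hT f)
  · rw [h1]; exact h2.tsum_eq

/-- The trace of a nuclear operator can be read off from any nuclear representation. -/
theorem IsNuclearRep.hasTrace {T : H →L[ℂ] H} {x y : ℕ → H} (h : IsNuclearRep T x y) :
    HasTrace T (∑' n, ⟪y n, x n⟫_ℂ) := by
  intro s e
  have hb : ∀ (z : H) (F : Finset s), ∑ i ∈ F, ‖⟪e i, z⟫_ℂ‖ ^ 2 ≤ ‖z‖ ^ 2 :=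
    fun z F => e.orthonormal.sum_inner_products_le z
  have hfin : ∀ (n : ℕ) (F : Finset s),
      ∑ i ∈ F, ‖⟪y n, e i⟫_ℂ * ⟪e i, x n⟫_ℂ‖ ≤ ‖x n‖ * ‖y n‖ := by
    intro n F
    have := sum_mul_le_of_sum_sq_le F (fun i => ‖⟪e i, x n⟫_ℂ‖) (fun i => ‖⟪e i, y n⟫_ℂ‖)
      (norm_nonneg _) (norm_nonneg _) (hb (x n) F) (hb (y n) F)
    refine le_trans (le_of_eq ?_) this
    refine Finset.sum_congr rfl fun i _ => ?_
    rw [norm_mul, norm_inner_symm, mul_comm]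
  have hsum : Summable fun p : ℕ × s => ⟪y p.1, e p.2⟫_ℂ * ⟪e p.2, x p.1⟫_ℂ := by
    refine Summable.of_norm ?_
    rw [summable_prod_of_nonneg (fun _ => norm_nonneg _)]
    have h1 : ∀ n, Summable fun i : s => ‖⟪y n, e i⟫_ℂ * ⟪e i, x n⟫_ℂ‖ := fun n =>
      summable_of_sum_le (fun _ => norm_nonneg _) (hfin n)
    refine ⟨h1, Summable.of_nonneg_of_le (fun n => tsum_nonneg fun _ => norm_nonneg _)
      (fun n => (h1 n).tsum_le_of_sum_le (hfin n)) h.1⟩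
  have h2 : HasSum (fun p : ℕ × s => ⟪y p.1, e p.2⟫_ℂ * ⟪e p.2, x p.1⟫_ℂ)
      (∑' n, ⟪y n, x n⟫_ℂ) := by
    have h3 := hsum.hasSum
    have h4 := h3.prod_fiberwise (fun n => e.hasSum_inner_mul_inner (y n) (x n))
    rw [h4.tsum_eq]
    exact h3
  have h5 : HasSum (fun p : s × ℕ => ⟪y p.2, e p.1⟫_ℂ * ⟪e p.1, x p.2⟫_ℂ)
      (∑' n, ⟪y n, x n⟫_ℂ) :=
    (Equiv.hasSum_iff (Equiv.prodComm s ℕ)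
      (f := fun p : ℕ × s => ⟪y p.1, e p.2⟫_ℂ * ⟪e p.2, x p.1⟫_ℂ)).2 h2
  refine h5.prod_fiberwise (fun i => ?_)
  have := (h.2 (e i)).mapL (innerSL ℂ (e i))
  simpa [inner_smul_right] using this

/-! ### The completely positive map of a Kraus family -/

variable {A : ℕ → H →L[ℂ] H}

theorem sum_norm_mul_norm_le (hA : ∀ f, HasSum (fun n => ‖A n f‖ ^ 2) (‖f‖ ^ 2)) (x y : H)
    (F : Finset ℕ) : ∑ n ∈ F, ‖A n x‖ * ‖A n y‖ ≤ ‖x‖ * ‖y‖ :=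
  sum_mul_le_of_sum_sq_le F _ _ (norm_nonneg _) (norm_nonneg _)
    (sum_le_hasSum F (fun _ _ => by positivity) (hA x))
    (sum_le_hasSum F (fun _ _ => by positivity) (hA y))

theorem hasSum_inner_of_hasSum_norm_sq (hA : ∀ f, HasSum (fun n => ‖A n f‖ ^ 2) (‖f‖ ^ 2))
    (x y : H) : HasSum (fun n => ⟪A n x, A n y⟫_ℂ) ⟪x, y⟫_ℂ := by
  have hc : ∀ f, HasSum (fun n => ((‖A n f‖ : ℂ) ^ 2)) ((‖f‖ : ℂ) ^ 2) := by
    intro f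
    exact_mod_cast (Complex.hasSum_ofReal.2 (hA f))
  have h := ((((hc (x + y)).sub (hc (x - y))).add
    (((hc (x - Complex.I • y)).sub (hc (x + Complex.I • y))).mul_right Complex.I))).div_const 4
  have e : ∀ u v : H, ⟪u, v⟫_ℂ = ((‖u + v‖ : ℂ) ^ 2 - (‖u - v‖ : ℂ) ^ 2 +
      ((‖u - Complex.I • v‖ : ℂ) ^ 2 - (‖u + Complex.I • v‖ : ℂ) ^ 2) * Complex.I) / 4 :=
    fun u v => inner_eq_sum_norm_sq_div_four u v
  rw [e x y]
  refine h.congr_fun ?_ |>.trans_eq rfl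
  intro n
  rw [e (A n x) (A n y)]
  simp

theorem IsNuclearRep.summable_prod (hA : ∀ f, HasSum (fun n => ‖A n f‖ ^ 2) (‖f‖ ^ 2))
    {T : H →L[ℂ] H} {x y : ℕ → H} (h : IsNuclearRep T x y) :
    (Summable fun p : ℕ × ℕ => ‖A p.2 (x p.1)‖ * ‖A p.2 (y p.1)‖) ∧
      ∑' p : ℕ × ℕ, ‖A p.2 (x p.1)‖ * ‖A p.2 (y p.1)‖ ≤ ∑' n, ‖x n‖ * ‖y n‖ := by
  have h1 : ∀ j, Summable fun n => ‖A n (x j)‖ * ‖A n (y j)‖ := fun j =>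
    summable_of_sum_le (fun _ => by positivity) (sum_norm_mul_norm_le hA (x j) (y j))
  have h2 : ∀ j, ∑' n, ‖A n (x j)‖ * ‖A n (y j)‖ ≤ ‖x j‖ * ‖y j‖ := fun j =>
    (h1 j).tsum_le_of_sum_le (sum_norm_mul_norm_le hA (x j) (y j))
  have h3 : Summable fun j => ∑' n, ‖A n (x j)‖ * ‖A n (y j)‖ :=
    Summable.of_nonneg_of_le (fun j => tsum_nonneg fun _ => by positivity) h2 h.1
  have h4 : Summable fun p : ℕ × ℕ => ‖A p.2 (x p.1)‖ * ‖A p.2 (y p.1)‖ :=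
    (summable_prod_of_nonneg (fun _ => by positivity)).2 ⟨h1, h3⟩
  refine ⟨h4, ?_⟩
  rw [h4.tsum_prod' h1]
  exact h3.tsum_le_tsum h2 h.1

variable [CompleteSpace H]

/-- The series `∑ₙ Aₙ T Aₙ*` converges absolutely in operator norm for nuclear `T`. -/
theorem IsNuclearRep.summable_conj (hA : ∀ f, HasSum (fun n => ‖A n f‖ ^ 2) (‖f‖ ^ 2))
    {T : H →L[ℂ] H} {x y : ℕ → H} (h : IsNuclearRep T x y) :
    Summable fun n => A n ∘L T ∘L ContinuousLinearMap.adjoint (A n) := by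
  have h1 := (IsNuclearRep.summable_prod hA h).1
  have h2 : Summable fun p : ℕ × ℕ => ‖A p.1 (x p.2)‖ * ‖A p.1 (y p.2)‖ :=
    (Equiv.summable_iff (Equiv.prodComm ℕ ℕ)
      (f := fun p : ℕ × ℕ => ‖A p.2 (x p.1)‖ * ‖A p.2 (y p.1)‖)).2 h1
  refine Summable.of_norm_bounded h2.prod (fun n => ?_)
  have h3 : Summable fun j => ‖A n (x j)‖ * ‖A n (y j)‖ := h2.prod_factor n
  refine ContinuousLinearMap.opNorm_le_bound _ (tsum_nonneg fun _ => by positivity) fun f => ?_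
  have h4 := (h.2 (ContinuousLinearMap.adjoint (A n) f)).mapL (A n)
  have h5 : ∀ j, ‖A n (⟪y j, ContinuousLinearMap.adjoint (A n) f⟫_ℂ • x j)‖
      ≤ ‖A n (x j)‖ * ‖A n (y j)‖ * ‖f‖ := by
    intro j
    rw [map_smul, norm_smul, ContinuousLinearMap.adjoint_inner_right]
    calc _ ≤ (‖A n (y j)‖ * ‖f‖) * ‖A n (x j)‖ := by
          gcongr; exact norm_inner_le_norm _ _
      _ = _ := by ring
  rw [← tsum_mul_right]
  exact h4.norm_le_of_bounded (h3.mul_right ‖f‖).hasSum h5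

/-- A nuclear representation of `∑ₙ Aₙ T Aₙ*` obtained from one of `T`; it does not increase the
sum that defines the trace norm, and it has the same trace. -/
theorem IsNuclearRep.exists_kraus (hA : ∀ f, HasSum (fun n => ‖A n f‖ ^ 2) (‖f‖ ^ 2))
    {T : H →L[ℂ] H} {x y : ℕ → H} (h : IsNuclearRep T x y) :
    ∃ u v, IsNuclearRep (∑' n, A n ∘L T ∘L ContinuousLinearMap.adjoint (A n)) u v ∧
      ∑' n, ‖u n‖ * ‖v n‖ ≤ ∑' n, ‖x n‖ * ‖y n‖ ∧
      ∑' n, ⟪v n, u n⟫_ℂ = ∑' n, ⟪y n, x n⟫_ℂ := by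
  obtain ⟨h1, h1'⟩ := IsNuclearRep.summable_prod hA h
  have h2 := IsNuclearRep.summable_conj hA h
  set e := Nat.pairEquiv.symm
  refine ⟨fun k => A (e k).2 (x (e k).1), fun k => A (e k).2 (y (e k).1), ⟨?_, fun f => ?_⟩, ?_, ?_⟩
  · exact (Equiv.summable_iff e
      (f := fun p : ℕ × ℕ => ‖A p.2 (x p.1)‖ * ‖A p.2 (y p.1)‖)).2 h1
  · refine (Equiv.hasSum_iff e (f := fun p : ℕ × ℕ => ⟪A p.2 (y p.1), f⟫_ℂ • A p.2 (x p.1))).2 ?_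
    have hs : Summable fun p : ℕ × ℕ => ⟪A p.2 (y p.1), f⟫_ℂ • A p.2 (x p.1) := by
      refine Summable.of_norm_bounded (h1.mul_right ‖f‖) fun p => ?_
      rw [norm_smul]
      calc _ ≤ (‖A p.2 (y p.1)‖ * ‖f‖) * ‖A p.2 (x p.1)‖ := by
            gcongr; exact norm_inner_le_norm _ _
        _ = _ := by ring
    have hs' := (Equiv.hasSum_iff (Equiv.prodComm ℕ ℕ)
      (f := fun p : ℕ × ℕ => ⟪A p.2 (y p.1), f⟫_ℂ • A p.2 (x p.1))).2 hs.hasSum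
    have h3 := hs'.prod_fiberwise (g := fun n => A n (T (ContinuousLinearMap.adjoint (A n) f)))
      (fun n => by
        have := (h.2 (ContinuousLinearMap.adjoint (A n) f)).mapL (A n)
        simpa [ContinuousLinearMap.adjoint_inner_right] using this)
    have h4 := h2.hasSum.mapL (ContinuousLinearMap.apply ℂ H f)
    have h5 := h3.unique h4
    rw [show (∑' n, A n ∘L T ∘L ContinuousLinearMap.adjoint (A n)) f = _ from h5.symm]
    exact hs.hasSum
  · rw [Equiv.tsum_eq e (fun p : ℕ × ℕ => ‖A p.2 (x p.1)‖ * ‖A p.2 (y p.1)‖)]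
    exact h1'
  · rw [Equiv.tsum_eq e (fun p : ℕ × ℕ => ⟪A p.2 (y p.1), A p.2 (x p.1)⟫_ℂ)]
    have hs : Summable fun p : ℕ × ℕ => ⟪A p.2 (y p.1), A p.2 (x p.1)⟫_ℂ := by
      refine Summable.of_norm_bounded h1 fun p => ?_
      rw [mul_comm]
      exact norm_inner_le_norm _ _
    exact (hs.hasSum.prod_fiberwise
      (fun j => hasSum_inner_of_hasSum_norm_sq hA (y j) (x j))).tsum_eq.symm

/-- The map `T ↦ ∑ₙ Aₙ T Aₙ*` on trace-class operators. -/
def krausMap (A : ℕ → H →L[ℂ] H) (hA : ∀ f, HasSum (fun n => ‖A n f‖ ^ 2) (‖f‖ ^ 2)) :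
    traceClass H →ₗ[ℂ] traceClass H where
  toFun T := ⟨∑' n, A n ∘L (T : H →L[ℂ] H) ∘L ContinuousLinearMap.adjoint (A n), by
    obtain ⟨x, y, h⟩ := T.2
    obtain ⟨u, v, h', -⟩ := IsNuclearRep.exists_kraus hA h
    exact ⟨u, v, h'⟩⟩
  map_add' T T' := by
    obtain ⟨x, y, h⟩ := T.2
    obtain ⟨x', y', h'⟩ := T'.2
    ext1
    change ∑' n, _ = (∑' n, _) + ∑' n, _
    rw [← (IsNuclearRep.summable_conj hA h).tsum_add (IsNuclearRep.summable_conj hA h')]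
    refine tsum_congr fun n => ?_
    ext f
    simp
  map_smul' c T := by
    obtain ⟨x, y, h⟩ := T.2
    ext1
    change ∑' n, _ = c • ∑' n, _
    rw [← (IsNuclearRep.summable_conj hA h).tsum_const_smul c]
    refine tsum_congr fun n => ?_
    ext f
    simp

variable (hA : ∀ f, HasSum (fun n => ‖A n f‖ ^ 2) (‖f‖ ^ 2))

theorem hasSum_krausMap_apply (T : traceClass H) (f : H) :
    HasSum (fun n => A n ((T : H →L[ℂ] H) (ContinuousLinearMap.adjoint (A n) f)))
      ((krausMap A hA T : H →L[ℂ] H) f) := by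
  obtain ⟨x, y, h⟩ := T.2
  exact (IsNuclearRep.summable_conj hA h).hasSum.mapL (ContinuousLinearMap.apply ℂ H f)

theorem isTraceNormBounded_krausMap : IsTraceNormBounded (krausMap A hA) := by
  refine ⟨1, fun T => ?_⟩
  obtain ⟨x, y, h⟩ := T.2
  rw [one_mul, traceNorm, traceNorm]
  have hne : {c : ℝ | ∃ x y, IsNuclearRep (T : H →L[ℂ] H) x y ∧
      c = ∑' n, ‖x n‖ * ‖y n‖}.Nonempty := ⟨_, x, y, h, rfl⟩
  refine le_csInf hne ?_
  rintro c ⟨x, y, h, rfl⟩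
  obtain ⟨u, v, h', hle, -⟩ := IsNuclearRep.exists_kraus hA h
  have hbd : BddBelow {c : ℝ | ∃ x y, IsNuclearRep (krausMap A hA T : H →L[ℂ] H) x y ∧
      c = ∑' n, ‖x n‖ * ‖y n‖} := by
    refine ⟨0, ?_⟩
    rintro c ⟨x, y, -, rfl⟩
    exact tsum_nonneg fun _ => by positivity
  exact (csInf_le hbd ⟨u, v, h', rfl⟩).trans hle

theorem isTracePreserving_krausMap : IsTracePreserving (krausMap A hA) := by
  intro T
  obtain ⟨x, y, h⟩ := T.2
  obtain ⟨u, v, h', -, htr⟩ := IsNuclearRep.exists_kraus hA h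
  refine ⟨_, h.hasTrace, ?_⟩
  rw [← htr]
  exact h'.hasTrace

theorem isCompletelyPositive_krausMap : IsCompletelyPositive (krausMap A hA) := by
  intro k T hT v
  have h1 : HasSum (fun n => ∑ i, ∑ j, ⟪v i, A n ((T i j : H →L[ℂ] H)
      (ContinuousLinearMap.adjoint (A n) (v j)))⟫_ℂ)
      (∑ i, ∑ j, ⟪v i, (krausMap A hA (T i j) : H →L[ℂ] H) (v j)⟫_ℂ) := by
    refine hasSum_sum fun i _ => hasSum_sum fun j _ => ?_
    exact (hasSum_krausMap_apply hA (T i j) (v j)).mapL (innerSL ℂ (v i))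
  refine h1.nonneg fun n => ?_
  have := hT (fun i => ContinuousLinearMap.adjoint (A n) (v i))
  simpa only [ContinuousLinearMap.adjoint_inner_left] using this

end Kraus

/-! ### Products of Hilbert–Schmidt operators are nuclear -/

section HilbertSchmidt

theorem L2_norm_sq_eq_integral {α : Type*} [MeasurableSpace α] {μ : Measure α}
    (f : Lp ℂ 2 μ) : ‖f‖ ^ 2 = ∫ x, ‖f x‖ ^ 2 ∂μ := by
  have h1 : ⟪f, f⟫_ℂ = ((‖f‖ ^ 2 : ℝ) : ℂ) := by
    rw [inner_self_eq_norm_sq_to_K]; norm_cast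
  have h2 : ∀ x, ⟪f x, f x⟫_ℂ = ((‖f x‖ ^ 2 : ℝ) : ℂ) := fun x => by
    rw [inner_self_eq_norm_sq_to_K]; norm_cast
  rw [L2.inner_def] at h1
  simp_rw [h2] at h1
  rw [integral_complex_ofReal] at h1
  exact_mod_cast h1.symm

theorem L2_integrable_norm_sq {α : Type*} [MeasurableSpace α] {μ : Measure α}
    (f : Lp ℂ 2 μ) : Integrable (fun x => ‖f x‖ ^ 2) μ :=
  (memLp_two_iff_integrable_sq_norm (Lp.aestronglyMeasurable f)).1 (Lp.memLp f)

theorem HilbertBasis.countable_of_secondCountable {H : Type*} [NormedAddCommGroup H]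
    [InnerProductSpace ℂ H] [SecondCountableTopology H] {w : Set H} (b : HilbertBasis w ℂ H)
    (hb : ⇑b = ((↑) : w → H)) : Countable w := by
  have hd : DiscreteTopology w := by
    refine DiscreteTopology.of_forall_le_dist (r := 1) one_pos fun i j hij => ?_
    have h1 : ‖(i : H) - j‖ ^ 2 = 2 := by
      have hi := b.orthonormal.1 i
      have hj := b.orthonormal.1 j
      have hij' := b.orthonormal.2 hij
      rw [hb] at hi hj hij'
      rw [norm_sub_sq (𝕜 := ℂ), hi, hj, hij']
      norm_num
    change 1 ≤ dist i j
    rw [Subtype.dist_eq, dist_eq_norm]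
    nlinarith [norm_nonneg ((i : H) - j)]
  exact TopologicalSpace.separableSpace_iff_countable.1 inferInstance

variable {α H : Type*} [MeasurableSpace α] {μ : Measure α}
  [NormedAddCommGroup H] [InnerProductSpace ℂ H]

/-- A square integrable family of vectors `κ x ∈ H`, in the weak sense: `x ↦ ⟨κ x, f⟩` is
measurable for every `f`, and `‖κ x‖` is dominated by a square integrable function `M`. -/
structure IsSquareIntegrableFamily (μ : Measure α) (κ : α → H) (M : α → ℝ) : Prop where
  meas : ∀ f, AEStronglyMeasurable (fun x => ⟪κ x, f⟫_ℂ) μ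
  memLp : MemLp M 2 μ
  norm_le : ∀ x, ‖κ x‖ ≤ M x

theorem IsSquareIntegrableFamily.memLp_inner {κ : α → H} {M : α → ℝ}
    (h : IsSquareIntegrableFamily μ κ M) (f : H) : MemLp (fun x => ⟪κ x, f⟫_ℂ) 2 μ := by
  refine (h.memLp.const_mul ‖f‖).mono (h.meas f) (ae_of_all _ fun x => ?_)
  rw [norm_mul, norm_norm, mul_comm]
  refine (norm_inner_le_norm _ _).trans ?_
  gcongr
  exact (h.norm_le x).trans (le_abs_self _)

/-- The Hilbert–Schmidt operator `f ↦ (x ↦ ⟨κ x, f⟩)` of a square integrable family. -/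
def IsSquareIntegrableFamily.op {κ : α → H} {M : α → ℝ} (h : IsSquareIntegrableFamily μ κ M) :
    H →L[ℂ] Lp ℂ 2 μ :=
  LinearMap.mkContinuous
    { toFun := fun f => (h.memLp_inner f).toLp
      map_add' := fun f g => by
        rw [← MemLp.toLp_add]
        exact MemLp.toLp_congr _ _ (ae_of_all _ fun x => inner_add_right _ _ _)
      map_smul' := fun c f => by
        rw [RingHom.id_apply, ← MemLp.toLp_const_smul]
        exact MemLp.toLp_congr _ _ (ae_of_all _ fun x => inner_smul_right _ _ _) }
    ‖h.memLp.toLp M‖ fun f => by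
      rw [mul_comm]
      refine Lp.norm_le_mul_norm_of_ae_le_mul ?_
      filter_upwards [(h.memLp_inner f).coeFn_toLp, h.memLp.coeFn_toLp] with x h1 h2
      rw [LinearMap.coe_mk, AddHom.coe_mk, h1, h2, mul_comm]
      refine (norm_inner_le_norm _ _).trans ?_
      gcongr
      exact (h.norm_le x).trans (le_abs_self _)

theorem IsSquareIntegrableFamily.coeFn_op {κ : α → H} {M : α → ℝ}
    (h : IsSquareIntegrableFamily μ κ M) (f : H) : h.op f =ᵐ[μ] fun x => ⟪κ x, f⟫_ℂ :=
  (h.memLp_inner f).coeFn_toLp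

theorem IsSquareIntegrableFamily.sum_norm_op_sq_le {κ : α → H} {M : α → ℝ}
    (h : IsSquareIntegrableFamily μ κ M) {ι : Type*} {e : ι → H} (he : Orthonormal ℂ e)
    (F : Finset ι) : ∑ i ∈ F, ‖h.op (e i)‖ ^ 2 ≤ √(∫ x, M x ^ 2 ∂μ) ^ 2 := by
  rw [Real.sq_sqrt (integral_nonneg fun x => by positivity)]
  simp_rw [L2_norm_sq_eq_integral]
  rw [← integral_finsetSum _ fun i _ => L2_integrable_norm_sq _]
  refine integral_mono_ae (integrable_finsetSum _ fun i _ => L2_integrable_norm_sq _)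
    ((memLp_two_iff_integrable_sq h.memLp.1).1 h.memLp) ?_
  have h1 : ∀ᵐ x ∂μ, ∀ i ∈ F, h.op (e i) x = ⟪κ x, e i⟫_ℂ :=
    (Finset.eventually_all F).2 fun i _ => h.coeFn_op (e i)
  filter_upwards [h1] with x hx
  calc ∑ i ∈ F, ‖h.op (e i) x‖ ^ 2 = ∑ i ∈ F, ‖⟪e i, κ x⟫_ℂ‖ ^ 2 :=
        Finset.sum_congr rfl fun i hi => by rw [hx i hi, norm_inner_symm]
    _ ≤ ‖κ x‖ ^ 2 := he.sum_inner_products_le _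
    _ ≤ M x ^ 2 := by gcongr; exact h.norm_le x

/-- If `t x y = ⟨κ x, κ' y⟩` with square integrable families `κ`, `κ'`, then `t` is the kernel of
a nuclear operator. -/
theorem IsSquareIntegrableFamily.exists_nuclear [CompleteSpace H] [SecondCountableTopology H]
    {κ κ' : α → H} {M M' : α → ℝ} (h : IsSquareIntegrableFamily μ κ M)
    (h' : IsSquareIntegrableFamily μ κ' M') :
    ∃ T : traceClass (Lp ℂ 2 μ), ∀ f : Lp ℂ 2 μ,
      (T : Lp ℂ 2 μ →L[ℂ] Lp ℂ 2 μ) f =ᵐ[μ] fun x => ∫ y, ⟪κ x, κ' y⟫_ℂ * f y ∂μ := by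
  obtain ⟨w, b, hb⟩ := exists_hilbertBasis ℂ H
  have hw := b.countable_of_secondCountable hb
  let T : Lp ℂ 2 μ →L[ℂ] Lp ℂ 2 μ := h.op ∘L ContinuousLinearMap.adjoint h'.op
  have hs : Summable fun i => ‖h.op (b i)‖ * ‖h'.op (b i)‖ := by
    refine summable_of_sum_le (fun _ => by positivity) fun F =>
      sum_mul_le_of_sum_sq_le F _ _ (Real.sqrt_nonneg _) (Real.sqrt_nonneg _)
        (h.sum_norm_op_sq_le b.orthonormal F) (h'.sum_norm_op_sq_le b.orthonormal F)
  have hrep : ∀ f, HasSum (fun i => ⟪h'.op (b i), f⟫_ℂ • h.op (b i)) (T f) := by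
    intro f
    have := (b.hasSum_repr (ContinuousLinearMap.adjoint h'.op f)).mapL h.op
    simp only [b.repr_apply_apply, map_smul] at this
    refine this.congr_fun fun i => ?_
    rw [ContinuousLinearMap.adjoint_inner_right]
  obtain ⟨u, v, huv, -⟩ := exists_isNuclearRep_of_countable hs hrep
  refine ⟨⟨T, u, v, huv⟩, fun f => ?_⟩
  refine (h.coeFn_op _).trans (ae_of_all _ fun x => ?_)
  change ⟪κ x, ContinuousLinearMap.adjoint h'.op f⟫_ℂ = _
  rw [ContinuousLinearMap.adjoint_inner_right, L2.inner_def]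
  refine integral_congr_ae ?_
  filter_upwards [h'.coeFn_op (κ x)] with y hy
  rw [hy, RCLike.inner_apply, inner_conj_symm, mul_comm]

end HilbertSchmidt

instance secondCountableTopology_L2Space (d : ℕ) : SecondCountableTopology (L2Space d) :=
  haveI : Fact ((2 : ENNReal) ≠ ⊤) := ⟨by norm_num⟩
  inferInstance

/-! ### Smoothness of classes closed under differentiation; parametric integrals -/

section TemperateGrowth

/-- In a class `Cl` of functions that contains the derivatives of its members, the iterated
derivatives have, up to isometry, values given by members of the class. -/
theorem contDiff_and_exists_norm_iteratedFDeriv_eq {E : Type} [NormedAddCommGroup E]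
    [NormedSpace ℝ E]
    (Cl : ∀ (G : Type) [NormedAddCommGroup G] [NormedSpace ℝ G], (E → G) → Prop)
    (hCl : ∀ (G : Type) [NormedAddCommGroup G] [NormedSpace ℝ G] (u : E → G), Cl G u →
      ∃ u' : E → E →L[ℝ] G, Cl (E →L[ℝ] G) u' ∧ ∀ x, HasFDerivAt u (u' x) x) (n : ℕ) :
    ∀ (G : Type) [NormedAddCommGroup G] [NormedSpace ℝ G] (u : E → G), Cl G u →
      ContDiff ℝ n u ∧ ∃ (G' : Type) (_ : NormedAddCommGroup G') (_ : NormedSpace ℝ G')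
        (v : E → G'), Cl G' v ∧ ∀ x, ‖iteratedFDeriv ℝ n u x‖ = ‖v x‖ := by
  induction n with
  | zero =>
    intro G _ _ u hu
    obtain ⟨u', -, h⟩ := hCl G u hu
    have hd : Differentiable ℝ u := fun x => (h x).differentiableAt
    exact ⟨contDiff_zero.2 hd.continuous, G, inferInstance, inferInstance, u, hu, fun x => by simp⟩
  | succ n ih =>
    intro G _ _ u hu
    obtain ⟨u', hu', h⟩ := hCl G u hu
    have hd : Differentiable ℝ u := fun x => (h x).differentiableAt
    have he : fderiv ℝ u = u' := funext fun x => (h x).fderiv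
    obtain ⟨h1, G', i1, i2, v, hv, hn⟩ := ih _ u' hu'
    refine ⟨?_, G', i1, i2, v, hv, fun x => ?_⟩
    · rw [Nat.cast_succ, contDiff_succ_iff_fderiv, he]
      exact ⟨hd, by simp, h1⟩
    · rw [← hn x, ← he, norm_iteratedFDeriv_fderiv]

variable {E G : Type} [NormedAddCommGroup E] [NormedSpace ℝ E] [NormedAddCommGroup G]
  [NormedSpace ℝ G]

theorem Function.HasTemperateGrowth.fderiv_of {f : E → G} (hf : f.HasTemperateGrowth) :
    (fderiv ℝ f).HasTemperateGrowth := by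
  refine ⟨(hf.1.fderiv_right (m := ∞) (by simp)), fun n => ?_⟩
  obtain ⟨k, C, h⟩ := hf.2 (n + 1)
  exact ⟨k, C, fun x => by rw [norm_iteratedFDeriv_fderiv]; exact h x⟩

/-- If a class of functions is closed under differentiation and its members grow polynomially, then
they have temperate growth. -/
theorem hasTemperateGrowth_of_class
    (Cl : ∀ (G : Type) [NormedAddCommGroup G] [NormedSpace ℝ G], (E → G) → Prop)
    (hCl : ∀ (G : Type) [NormedAddCommGroup G] [NormedSpace ℝ G] (u : E → G), Cl G u →
      ∃ u' : E → E →L[ℝ] G, Cl (E →L[ℝ] G) u' ∧ ∀ x, HasFDerivAt u (u' x) x)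
    (hb : ∀ (G : Type) [NormedAddCommGroup G] [NormedSpace ℝ G] (u : E → G), Cl G u →
      ∃ (k : ℕ) (C : ℝ), ∀ x, ‖u x‖ ≤ C * (1 + ‖x‖) ^ k) {u : E → G} (hu : Cl G u) :
    u.HasTemperateGrowth := by
  refine ⟨contDiff_infty.2 fun n =>
    (contDiff_and_exists_norm_iteratedFDeriv_eq Cl hCl n G u hu).1, fun n => ?_⟩
  obtain ⟨-, G', _, _, v, hv, hn⟩ := contDiff_and_exists_norm_iteratedFDeriv_eq Cl hCl n G u hu
  obtain ⟨k, C, h⟩ := hb G' v hv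
  exact ⟨k, C, fun x => by rw [hn]; exact h x⟩

/-- Integration over a compact interval of parameters preserves temperate growth. -/
theorem Function.HasTemperateGrowth.intervalIntegral {F : ℝ × E → G} (hF : F.HasTemperateGrowth) :
    (fun x => ∫ s in (0 : ℝ)..1, F (s, x)).HasTemperateGrowth := by
  refine hasTemperateGrowth_of_class (fun G _ _ u => ∃ F : ℝ × E → G,
    F.HasTemperateGrowth ∧ u = fun x => ∫ s in (0 : ℝ)..1, F (s, x)) ?_ ?_ ⟨F, hF, rfl⟩
  · rintro G _ _ _ ⟨F, hF, rfl⟩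
    have hc : (fun p => (fderiv ℝ F p).comp (ContinuousLinearMap.inr ℝ ℝ E)).HasTemperateGrowth :=
      ((ContinuousLinearMap.compL ℝ E (ℝ × E) G).flip
        (ContinuousLinearMap.inr ℝ ℝ E)).hasTemperateGrowth.comp hF.fderiv_of
    refine ⟨fun x => ∫ s in (0 : ℝ)..1, (fderiv ℝ F (s, x)).comp (ContinuousLinearMap.inr ℝ ℝ E),
      ⟨_, hc, rfl⟩, fun x₀ => ?_⟩
    obtain ⟨k, C, h⟩ := hc.2 0
    simp only [norm_iteratedFDeriv_zero] at h
    have hcont : ∀ x, Continuous fun s : ℝ => F (s, x) := fun x =>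
      hF.1.continuous.comp (by fun_prop)
    have hcont' : Continuous fun s : ℝ =>
        (fderiv ℝ F (s, x₀)).comp (ContinuousLinearMap.inr ℝ ℝ E) :=
      hc.1.continuous.comp (f := fun s : ℝ => (s, x₀)) (by fun_prop)
    refine intervalIntegral.hasFDerivAt_integral_of_dominated_of_fderiv_le
      (F := fun x s => F (s, x))
      (F' := fun x s => (fderiv ℝ F (s, x)).comp (ContinuousLinearMap.inr ℝ ℝ E))
      (bound := fun _ => |C| * (1 + (1 + (‖x₀‖ + 1))) ^ k) (Metric.ball_mem_nhds x₀ one_pos)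
      (Eventually.of_forall fun x => (hcont x).aestronglyMeasurable)
      ((hcont x₀).intervalIntegrable _ _) hcont'.aestronglyMeasurable
      (ae_of_all _ fun s hs x hx => ?_) intervalIntegrable_const (ae_of_all _ fun s _ x _ => ?_)
    · refine (h (s, x)).trans ?_
      refine mul_le_mul (le_abs_self C) ?_ (by positivity) (abs_nonneg _)
      refine pow_le_pow_left₀ (by positivity) ?_ k
      rw [Set.uIoc_of_le zero_le_one] at hs
      have h1 : ‖s‖ ≤ 1 := by rw [Real.norm_eq_abs, abs_of_pos hs.1]; exact hs.2
      have h2 : ‖x‖ ≤ ‖x₀‖ + 1 := by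
        have := norm_le_norm_add_norm_sub' x x₀
        rw [mem_ball_iff_norm] at hx
        linarith
      have h3 : ‖(s, x)‖ ≤ ‖s‖ + ‖x‖ :=
        max_le (by linarith [norm_nonneg x]) (by linarith [norm_nonneg s])
      linarith
    · have h1 : HasFDerivAt F (fderiv ℝ F (s, x)) (s, x) :=
        (hF.1.differentiable (by simp) _).hasFDerivAt
      exact h1.comp x (hasFDerivAt_prodMk_right s x)
  · rintro G _ _ _ ⟨F, hF, rfl⟩
    obtain ⟨k, C, h⟩ := hF.2 0
    simp only [norm_iteratedFDeriv_zero] at h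
    refine ⟨k, |C| * 2 ^ k, fun x => ?_⟩
    have h1 : ∀ s ∈ Set.uIoc (0 : ℝ) 1, ‖F (s, x)‖ ≤ |C| * 2 ^ k * (1 + ‖x‖) ^ k := by
      intro s hs
      refine (h (s, x)).trans ?_
      rw [mul_assoc, ← mul_pow]
      refine mul_le_mul (le_abs_self C) ?_ (by positivity) (abs_nonneg _)
      refine pow_le_pow_left₀ (by positivity) ?_ k
      rw [Set.uIoc_of_le zero_le_one] at hs
      have h1 : ‖s‖ ≤ 1 := by rw [Real.norm_eq_abs, abs_of_pos hs.1]; exact hs.2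
      have h3 : ‖(s, x)‖ ≤ ‖s‖ + ‖x‖ :=
        max_le (by linarith [norm_nonneg x]) (by linarith [norm_nonneg s])
      linarith [norm_nonneg x]
    simpa using intervalIntegral.norm_integral_le_of_norm_le_const h1

theorem hasTemperateGrowth_cexp_I_mul :
    (fun θ : ℝ => Complex.exp (Complex.I * θ)).HasTemperateGrowth := by
  refine hasTemperateGrowth_of_class (fun G _ _ u => ∃ L : ℂ →L[ℝ] G,
    u = fun θ : ℝ => L (Complex.exp (Complex.I * θ))) ?_ ?_ ⟨ContinuousLinearMap.id ℝ ℂ, rfl⟩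
  · rintro G _ _ _ ⟨L, rfl⟩
    refine ⟨fun θ => ContinuousLinearMap.toSpanSingleton ℝ
      (L (Complex.I * Complex.exp (Complex.I * θ))),
      ⟨(ContinuousLinearMap.toSpanSingletonCLE (𝕜 := ℝ) (E := G)).toContinuousLinearMap ∘L L ∘L
        (ContinuousLinearMap.mul ℝ ℂ Complex.I), rfl⟩, fun θ => ?_⟩
    have h1 : HasDerivAt (fun θ : ℝ => Complex.exp (Complex.I * θ))
        (Complex.I * Complex.exp (Complex.I * θ)) θ := by
      have h2 : HasDerivAt (fun θ : ℝ => Complex.I * (θ : ℂ)) (Complex.I * 1) θ :=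
        (HasDerivAt.ofReal_comp (hasDerivAt_id θ)).const_mul _
      have := h2.cexp
      rwa [mul_one, mul_comm] at this
    exact (L.hasFDerivAt.comp_hasDerivAt θ h1).hasFDerivAt
  · rintro G _ _ _ ⟨L, rfl⟩
    refine ⟨0, ‖L‖, fun θ => ?_⟩
    refine (L.le_opNorm _).trans ?_
    rw [mul_comm Complex.I, Complex.norm_exp_ofReal_mul_I]
    simp

theorem Function.HasTemperateGrowth.cexp_I_mul {f : E → ℝ} (hf : f.HasTemperateGrowth) :
    (fun x => Complex.exp (Complex.I * (f x : ℂ))).HasTemperateGrowth :=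
  hasTemperateGrowth_cexp_I_mul.comp hf

end TemperateGrowth

/-! ### The circulation of the magnetic potential -/

namespace MagneticField

variable {d : ℕ} (B : MagneticField d)

theorem hasTemperateGrowth_comp (j k : Fin d) : (B.comp j k).HasTemperateGrowth := by
  refine ⟨B.smooth j k, fun n => ?_⟩
  obtain ⟨C, h⟩ := B.bounded j k n
  exact ⟨0, C, fun x => by simpa using h x⟩

theorem hasTemperateGrowth_coord (j : Fin d) :
    (fun x : ConfSpace d => x j).HasTemperateGrowth :=
  (EuclideanSpace.proj j : ConfSpace d →L[ℝ] ℝ).hasTemperateGrowth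

theorem hasTemperateGrowth_potential (k : Fin d) : (B.potential k).HasTemperateGrowth := by
  have h : ∀ j, (fun p : ℝ × ConfSpace d => p.1 * p.2 j * B.comp j k (p.1 • p.2)).HasTemperateGrowth := by
    intro j
    have h1 : (fun p : ℝ × ConfSpace d => p.1).HasTemperateGrowth :=
      (ContinuousLinearMap.fst ℝ ℝ (ConfSpace d)).hasTemperateGrowth
    have h2 : (fun p : ℝ × ConfSpace d => p.2).HasTemperateGrowth :=
      (ContinuousLinearMap.snd ℝ ℝ (ConfSpace d)).hasTemperateGrowth
    exact (h1.fun_mul ((hasTemperateGrowth_coord j).comp h2)).fun_mul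
      ((B.hasTemperateGrowth_comp j k).comp (h1.fun_smul h2))
  exact Function.HasTemperateGrowth.sum (f := fun j x =>
    ∫ s in (0 : ℝ)..1, s * x j * B.comp j k (s • x)) (s := Finset.univ)
    fun j _ => (h j).intervalIntegral

/-- The circulation `φ(x, y)` is smooth with polynomially bounded derivatives. -/
theorem hasTemperateGrowth_circulation :
    (fun p : ConfSpace d × ConfSpace d => B.circulation p.1 p.2).HasTemperateGrowth := by
  have h1 : (fun p : ℝ × (ConfSpace d × ConfSpace d) => p.1).HasTemperateGrowth :=
    (ContinuousLinearMap.fst ℝ ℝ (ConfSpace d × ConfSpace d)).hasTemperateGrowth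
  have h2 : (fun p : ℝ × (ConfSpace d × ConfSpace d) => p.2.1).HasTemperateGrowth :=
    (ContinuousLinearMap.fst ℝ (ConfSpace d) (ConfSpace d) ∘L
      ContinuousLinearMap.snd ℝ ℝ (ConfSpace d × ConfSpace d)).hasTemperateGrowth
  have h3 : (fun p : ℝ × (ConfSpace d × ConfSpace d) => p.2.2).HasTemperateGrowth :=
    (ContinuousLinearMap.snd ℝ (ConfSpace d) (ConfSpace d) ∘L
      ContinuousLinearMap.snd ℝ ℝ (ConfSpace d × ConfSpace d)).hasTemperateGrowth
  have h4 : (fun p : ℝ × (ConfSpace d × ConfSpace d) =>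
      p.2.2 + p.1 • (p.2.1 - p.2.2)).HasTemperateGrowth :=
    h3.fun_add (h1.fun_smul (h2.fun_sub h3))
  have h5 : ∀ k, (fun p : ℝ × (ConfSpace d × ConfSpace d) => B.potential k
      (p.2.2 + p.1 • (p.2.1 - p.2.2)) * (p.2.1 k - p.2.2 k)).HasTemperateGrowth := fun k =>
    Function.HasTemperateGrowth.fun_mul ((B.hasTemperateGrowth_potential k).comp h4)
      (Function.HasTemperateGrowth.fun_sub ((hasTemperateGrowth_coord k).comp h2)
        ((hasTemperateGrowth_coord k).comp h3))
  have h := Function.HasTemperateGrowth.intervalIntegral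
    (Function.HasTemperateGrowth.sum (s := Finset.univ) fun k _ => h5 k)
  exact h

theorem circulation_antisymm (x y : ConfSpace d) : B.circulation y x = -B.circulation x y := by
  unfold circulation
  rw [← intervalIntegral.integral_neg]
  have := intervalIntegral.integral_comp_sub_left (a := 0) (b := 1)
    (fun t : ℝ => -∑ k, B.potential k (y + t • (x - y)) * (x k - y k)) 1
  rw [sub_self, sub_zero] at this
  rw [← this]
  refine intervalIntegral.integral_congr fun t _ => ?_
  dsimp only
  rw [← Finset.sum_neg_distrib]
  refine Finset.sum_congr rfl fun k _ => ?_
  rw [show y + (1 - t) • (x - y) = x + t • (y - x) by module]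
  ring

theorem circulation_self (x : ConfSpace d) : B.circulation x x = 0 := by
  simp [circulation]

end MagneticField

/-! ### Seminorm estimates and slices of Schwartz functions -/

section Seminorms

open SchwartzMap

theorem SchwartzMap.exists_sup_seminorm_le {E F G G' : Type*} [NormedAddCommGroup E]
    [NormedSpace ℝ E] [NormedAddCommGroup F] [NormedSpace ℝ F] [NormedAddCommGroup G]
    [NormedSpace ℂ G] [NormedAddCommGroup G'] [NormedSpace ℂ G']
    (A : 𝓢(E, G) →L[ℂ] 𝓢(F, G')) (s : Finset (ℕ × ℕ)) :
    ∃ (t : Finset (ℕ × ℕ)) (C : ℝ), 0 ≤ C ∧ ∀ f,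
      s.sup (schwartzSeminormFamily ℂ F G') (A f) ≤
        C * t.sup (schwartzSeminormFamily ℂ E G) f := by
  have hc : ∀ f : 𝓢(E, G), s.sup (schwartzSeminormFamily ℂ F G') (A f) ≤
      (∑ i ∈ s, schwartzSeminormFamily ℂ F G' i) (A f) := fun f =>
    Seminorm.le_def.1 (Seminorm.finset_sup_le_sum _ s) (A f)
  set q : Seminorm ℂ 𝓢(E, G) := (∑ i ∈ s, schwartzSeminormFamily ℂ F G' i).comp A.toLinearMap
    with hq
  have hqc : Continuous q := by
    have h1 : Continuous
        ((∑ i ∈ s, schwartzSeminormFamily ℂ F G' i : Seminorm ℂ 𝓢(F, G')) : 𝓢(F, G') → ℝ) := by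
      have : ((∑ i ∈ s, schwartzSeminormFamily ℂ F G' i : Seminorm ℂ 𝓢(F, G')) : 𝓢(F, G') → ℝ)
          = fun f => ∑ i ∈ s, schwartzSeminormFamily ℂ F G' i f := by
        funext f
        simp
      rw [this]
      exact continuous_finsetSum _ fun i _ =>
        (schwartz_withSeminorms ℂ F G').continuous_seminorm i
    exact h1.comp A.continuous
  obtain ⟨t, C, -, h⟩ := Seminorm.bound_of_continuous (schwartz_withSeminorms ℂ E G) q hqc
  exact ⟨t, C, C.2, fun f => (hc f).trans (h f)⟩

variable {E F G : Type*} [NormedAddCommGroup E] [NormedSpace ℝ E] [NormedAddCommGroup F]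
  [NormedSpace ℝ F] [NormedAddCommGroup G] [NormedSpace ℂ G]

theorem SchwartzMap.one_add_norm_pow_mul_le (f : 𝓢(E, G)) (k n : ℕ) (x : E) :
    (1 + ‖x‖) ^ k * ‖iteratedFDeriv ℝ n f x‖ ≤
      2 ^ k * (Finset.Iic (k, n)).sup (schwartzSeminormFamily ℂ E G) f :=
  one_add_le_sup_seminorm_apply (m := (k, n)) le_rfl le_rfl f x

theorem norm_le_one_add_rpow_of_pow_mul_le {a b C : ℝ} (ha : 0 ≤ a) {k : ℕ}
    (h : (1 + a) ^ k * b ≤ C) : b ≤ C * (1 + a) ^ (-(k : ℝ)) := by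
  rw [Real.rpow_neg (by positivity), Real.rpow_natCast, ← div_eq_mul_inv,
    le_div_iff₀ (by positivity), mul_comm]
  exact h

theorem norm_iteratedFDeriv_comp_affine_le {E' : Type*} [NormedAddCommGroup E']
    [NormedSpace ℝ E'] {G : Type*} [NormedAddCommGroup G] [NormedSpace ℝ G] {f : E → G}
    (hf : ContDiff ℝ ∞ f) (L : E' →L[ℝ] E) (hL : ‖L‖ ≤ 1) (c : E) (n : ℕ) (x : E') :
    ‖iteratedFDeriv ℝ n (fun y => f (c + L y)) x‖ ≤ ‖iteratedFDeriv ℝ n f (c + L x)‖ := by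
  have h1 : ContDiff ℝ ∞ (fun z => f (c + z)) := hf.comp (contDiff_const.add contDiff_id)
  have h2 := L.iteratedFDeriv_comp_right (f := fun z => f (c + z)) h1 x (i := n)
    (by exact_mod_cast le_top)
  change ‖iteratedFDeriv ℝ n ((fun z => f (c + z)) ∘ L) x‖ ≤ _
  rw [h2, iteratedFDeriv_comp_add_left]
  refine (ContinuousMultilinearMap.norm_compContinuousLinearMap_le _ _).trans ?_
  refine mul_le_of_le_one_right (norm_nonneg _) ?_
  exact Finset.prod_le_one (fun _ _ => norm_nonneg _) (fun _ _ => hL)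

omit [NormedSpace ℝ E] [NormedSpace ℝ F] in
theorem antilipschitzWith_prodMk_left (s : E) : AntilipschitzWith 1 (fun x : F => (s, x)) :=
  AntilipschitzWith.of_le_mul_dist fun x y => by simp [Prod.dist_eq]

theorem hasTemperateGrowth_prodMk_left (s : E) :
    (fun x : F => (s, x)).HasTemperateGrowth := by
  have : (fun x : F => (s, x)) = fun x => (s, (0 : F)) + ContinuousLinearMap.inr ℝ E F x := by
    funext x; simp
  rw [this]
  exact (Function.HasTemperateGrowth.const _).fun_add
    (ContinuousLinearMap.inr ℝ E F).hasTemperateGrowth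

/-- The slice `x ↦ f (s, x)` of a Schwartz function on a product. -/
def SchwartzMap.slice (f : 𝓢(E × F, G)) (s : E) : 𝓢(F, G) :=
  compCLMOfAntilipschitz ℂ (hasTemperateGrowth_prodMk_left s) (antilipschitzWith_prodMk_left s) f

@[simp]
theorem SchwartzMap.slice_apply (f : 𝓢(E × F, G)) (s : E) (x : F) : f.slice s x = f (s, x) := rfl

theorem SchwartzMap.norm_iteratedFDeriv_slice_le (f : 𝓢(E × F, G)) (s : E) (n : ℕ) (x : F) :
    ‖iteratedFDeriv ℝ n (f.slice s) x‖ ≤ ‖iteratedFDeriv ℝ n f (s, x)‖ := by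
  have h1 : (f.slice s : F → G) = fun x => f ((s, 0) + ContinuousLinearMap.inr ℝ E F x) := by
    funext x; simp
  have h2 := norm_iteratedFDeriv_comp_affine_le (f.smooth ⊤) (ContinuousLinearMap.inr ℝ E F)
    (ContinuousLinearMap.norm_inr_le_one ℝ E F) (s, 0) n x
  rw [h1]
  simpa using h2

/-- Let `u i` be a family of functions that is closed under the partial derivatives with respect
to a basis: `∂_j (u i) = u (δ j i)`. Then a weighted sup bound on all members of the family, in
terms of a class `Bd` of bounds that is stable under `δ` and under finite sums, gives bounds on all
derivatives. -/
theorem contDiff_and_bound_of_partial_derivs {ι κ W : Type*} [Fintype κ] [NormedAddCommGroup W]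
    [NormedSpace ℝ W] [FiniteDimensional ℝ W] (b : Module.Basis κ ℝ W) (u : ι → W → ℂ)
    (δ : κ → ι → ι) (hd : ∀ i, Differentiable ℝ (u i))
    (hδ : ∀ i j x, fderiv ℝ (u i) x (b j) = u (δ j i) x) (n : ℕ) :
    (∀ i, ContDiff ℝ n (u i)) ∧ ∀ (ρ : W → ℝ) (_ : ∀ x, 0 ≤ ρ x) (Bd : (ι → ℝ) → Prop)
      (_ : ∀ β j, Bd β → Bd fun i => β (δ j i))
      (_ : ∀ (c : κ → ℝ) (β : κ → ι → ℝ), (∀ j, 0 ≤ c j) → (∀ j, Bd (β j)) →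
        Bd fun i => ∑ j, c j * β j i)
      (_ : ∃ β, Bd β ∧ ∀ i x, ρ x * ‖u i x‖ ≤ β i),
      ∃ β, Bd β ∧ ∀ i x, ρ x * ‖iteratedFDeriv ℝ n (u i) x‖ ≤ β i := by
  set D : κ → ℂ →L[ℝ] (W →L[ℝ] ℂ) := fun j =>
    ContinuousLinearMap.smulRightL ℝ W ℂ (LinearMap.toContinuousLinearMap (b.coord j)) with hD
  have hf : ∀ i, fderiv ℝ (u i) = fun x => ∑ j, D j (u (δ j i) x) := by
    intro i
    funext x
    apply ContinuousLinearMap.coe_injective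
    refine b.ext fun k => ?_
    classical
    rw [ContinuousLinearMap.coe_coe, hδ]
    simp only [hD, ContinuousLinearMap.coe_coe, sum_apply]
    rw [Finset.sum_eq_single k (fun j _ hj => by simp [hj.symm])
      (fun h => absurd (Finset.mem_univ k) h)]
    simp
  induction n with
  | zero =>
    refine ⟨fun i => contDiff_zero.2 (hd i).continuous, fun ρ _ Bd _ _ h => ?_⟩
    simpa only [norm_iteratedFDeriv_zero] using h
  | succ n ih =>
    have hDc : ∀ i j, ContDiff ℝ n fun x => D j (u (δ j i) x) := fun i j =>
      (D j).contDiff.comp (ih.1 (δ j i))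
    refine ⟨fun i => ?_, fun ρ hρ Bd h1 h2 h => ?_⟩
    · rw [Nat.cast_succ, contDiff_succ_iff_fderiv, hf]
      exact ⟨hd i, by simp, ContDiff.sum fun j _ => hDc i j⟩
    · obtain ⟨β, hβ, hb⟩ := ih.2 ρ hρ Bd h1 h2 h
      refine ⟨_, h2 (fun j => ‖D j‖) (fun j i => β (δ j i)) (fun j => (D j).opNorm_nonneg)
        (fun j => h1 β j hβ), fun i x => ?_⟩
      rw [← norm_iteratedFDeriv_fderiv, hf,
        iteratedFDeriv_fun_sum_apply fun j _ => (hDc i j).contDiffAt]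
      refine (mul_le_mul_of_nonneg_left (norm_sum_le _ _) (hρ x)).trans ?_
      rw [Finset.mul_sum]
      refine Finset.sum_le_sum fun j _ => ?_
      refine (mul_le_mul_of_nonneg_left ((D j).norm_iteratedFDeriv_comp_left
        (ih.1 (δ j i)).contDiffAt le_rfl) (hρ x)).trans ?_
      calc ρ x * (‖D j‖ * ‖iteratedFDeriv ℝ n (u (δ j i)) x‖)
          = ‖D j‖ * (ρ x * ‖iteratedFDeriv ℝ n (u (δ j i)) x‖) := by ring
        _ ≤ _ := mul_le_mul_of_nonneg_left (hb _ x) (D j).opNorm_nonneg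

end Seminorms

/-! ### The partial Fourier transform on Schwartz functions -/

section PartialFourier

open SchwartzMap FourierTransform

variable {E V : Type} [NormedAddCommGroup E] [NormedSpace ℝ E] [NormedAddCommGroup V]
  [InnerProductSpace ℝ V]

instance ContinuousLinearMap.instSeminormedAddCommGroupProd :
    SeminormedAddCommGroup (E × V →L[ℝ] ℂ) := ContinuousLinearMap.toSeminormedAddCommGroup

instance ContinuousLinearMap.instNormedSpaceProd : NormedSpace ℂ (E × V →L[ℝ] ℂ) :=
  ContinuousLinearMap.toNormedSpace

/-- The Schwartz function whose partial Fourier transform is the derivative, in the direction `q`,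
of that of `f`. -/
def partialFourierDeriv (q : E × V) : 𝓢(E × V, ℂ) →L[ℂ] 𝓢(E × V, ℂ) :=
  LineDeriv.lineDerivOpCLM ℂ 𝓢(E × V, ℂ) ((q.1, 0) : E × V)
    - (2 * Real.pi * Complex.I) • smulLeftCLM ℂ (fun p : E × V => ((⟪p.2, q.2⟫_ℝ : ℝ) : ℂ))

theorem hasTemperateGrowth_inner_snd (w : V) :
    (fun p : E × V => ((⟪p.2, w⟫_ℝ : ℝ) : ℂ)).HasTemperateGrowth :=
  (Complex.ofRealCLM ∘L (innerSL ℝ (E := V)).flip w ∘L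
    ContinuousLinearMap.snd ℝ E V).hasTemperateGrowth

theorem partialFourierDeriv_apply (f : 𝓢(E × V, ℂ)) (p q : E × V) :
    partialFourierDeriv q f p =
      fderiv ℝ f p (q.1, 0) - (2 * Real.pi * Complex.I) * (⟪p.2, q.2⟫_ℝ * f p) := by
  change LineDeriv.lineDerivOp ((q.1, 0) : E × V) f p - (2 * Real.pi * Complex.I) •
    (smulLeftCLM ℂ (fun p : E × V => ((⟪p.2, q.2⟫_ℝ : ℝ) : ℂ)) f) p = _
  rw [smulLeftCLM_apply_apply (hasTemperateGrowth_inner_snd q.2),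
    lineDerivOp_apply_eq_fderiv]
  rfl

theorem SchwartzMap.norm_le_snd (f : 𝓢(E × V, ℂ)) (k m n : ℕ) (e : E) (v : V) :
    ‖(e, v)‖ ^ k * ‖iteratedFDeriv ℝ n f (e, v)‖ ≤ 2 ^ (k + m) *
      (Finset.Iic (k + m, n)).sup (schwartzSeminormFamily ℂ (E × V) ℂ) f *
      (1 + ‖v‖) ^ (-(m : ℝ)) := by
  refine norm_le_one_add_rpow_of_pow_mul_le (norm_nonneg v) ?_
  refine le_trans ?_ (f.one_add_norm_pow_mul_le (k + m) n (e, v))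
  rw [pow_add, mul_comm ((1 + ‖(e, v)‖) ^ k), mul_assoc]
  gcongr
  · exact norm_snd_le (e, v)
  · linarith [norm_nonneg (e, v)]

variable [MeasurableSpace V] [BorelSpace V] [FiniteDimensional ℝ V]

/-- The Fourier transform in the second variable. -/
def partialFourierFun (f : E × V → ℂ) (p : E × V) : ℂ := 𝓕 (fun v => f (p.1, v)) p.2

theorem hasFDerivAt_partialFourierFun (f : 𝓢(E × V, ℂ)) (p : E × V) :
    DifferentiableAt ℝ (partialFourierFun f) p ∧ ∀ q, fderiv ℝ (partialFourierFun f) p q =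
      partialFourierFun (partialFourierDeriv q f) p := by
  set m := (volume : Measure V).integrablePower
  have hi := Measure.integrable_pow_neg_integrablePower (volume : Measure V)
  have hch : ∀ q : E × V, Continuous fun v : V => Real.fourierChar (-⟪v, q.2⟫_ℝ) := fun q =>
    Real.continuous_fourierChar.comp (by fun_prop)
  have hm : ∀ q : E × V, Continuous fun v => Real.fourierChar (-⟪v, q.2⟫_ℝ) • f (q.1, v) :=
    fun q => (hch q).smul (f.continuous.comp (by fun_prop))
  set ψ : E × V → V → (E × V →L[ℝ] ℂ) := fun q v =>
    (fderiv ℝ f (q.1, v)) ∘L (ContinuousLinearMap.inl ℝ E V ∘L ContinuousLinearMap.fst ℝ E V)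
      + (-(2 * Real.pi * Complex.I) * f (q.1, v)) • (Complex.ofRealCLM ∘L (innerSL ℝ v) ∘L
        ContinuousLinearMap.snd ℝ E V) with hψ
  have hψc : ∀ q, Continuous (ψ q) := by
    intro q
    have h1 : Continuous fun v => fderiv ℝ f (q.1, v) :=
      ((f.smooth 1).continuous_fderiv (by simp)).comp (by fun_prop)
    have h2 : Continuous fun v => f (q.1, v) := f.continuous.comp (by fun_prop)
    have h3 : Continuous fun v : V => innerSL ℝ v := (innerSL ℝ (E := V)).continuous
    exact (h1.clm_comp continuous_const).add ((continuous_const.mul h2).smul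
      (continuous_const.clm_comp (h3.clm_comp continuous_const)))
  set F' : E × V → V → (E × V →L[ℝ] ℂ) := fun q v =>
    (Real.fourierChar (-⟪v, q.2⟫_ℝ) : ℂ) • ψ q v with hF'
  have hF'c : Continuous (F' p) := (continuous_subtype_val.comp (hch p)).smul (hψc p)
  set C := 2 ^ (0 + m) * (Finset.Iic (0 + m, 1)).sup (schwartzSeminormFamily ℂ (E × V) ℂ) f +
      2 * Real.pi * (2 ^ (1 + m) *
        (Finset.Iic (1 + m, 0)).sup (schwartzSeminormFamily ℂ (E × V) ℂ) f) with hC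
  have hF'b : ∀ q v, ‖F' q v‖ ≤ C * (1 + ‖v‖) ^ (-(m : ℝ)) := by
    intro q v
    rw [hF', norm_smul, Circle.norm_coe, one_mul]
    have h1 := f.norm_le_snd 0 m 1 q.1 v
    have h2 := f.norm_le_snd 1 m 0 q.1 v
    rw [pow_zero, one_mul, norm_iteratedFDeriv_one] at h1
    rw [pow_one, norm_iteratedFDeriv_zero] at h2
    have h3 : ‖(ContinuousLinearMap.inl ℝ E V ∘L ContinuousLinearMap.fst ℝ E V)‖ ≤ 1 :=
      (ContinuousLinearMap.opNorm_comp_le _ _).trans (mul_le_one₀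
        (ContinuousLinearMap.norm_inl_le_one ℝ E V) (norm_nonneg _)
        (ContinuousLinearMap.norm_fst_le ℝ E V))
    have h4 : ‖Complex.ofRealCLM ∘L (innerSL ℝ v) ∘L ContinuousLinearMap.snd ℝ E V‖ ≤
        ‖(q.1, v)‖ := by
      refine ContinuousLinearMap.opNorm_le_bound _ (norm_nonneg _) fun r => ?_
      simp only [ContinuousLinearMap.comp_apply, Complex.ofRealCLM_apply, Complex.norm_real,
        ContinuousLinearMap.coe_snd', innerSL_apply_apply]
      exact (norm_inner_le_norm _ _).trans
        (mul_le_mul (norm_snd_le (q.1, v)) (norm_snd_le r) (norm_nonneg _) (norm_nonneg _))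
    have h5 : ‖-(2 * Real.pi * Complex.I) * f (q.1, v)‖ = 2 * Real.pi * ‖f (q.1, v)‖ := by
      simp [abs_of_pos Real.pi_pos]
    calc ‖ψ q v‖ ≤ ‖fderiv ℝ f (q.1, v)‖ * 1 + 2 * Real.pi * ‖f (q.1, v)‖ * ‖(q.1, v)‖ := by
          refine (norm_add_le _ _).trans (add_le_add ?_ ?_)
          · exact (ContinuousLinearMap.opNorm_comp_le _ _).trans (by gcongr)
          · rw [norm_smul, h5]; gcongr
      _ = ‖fderiv ℝ f (q.1, v)‖ + 2 * Real.pi * (‖(q.1, v)‖ * ‖f (q.1, v)‖) := by ring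
      _ ≤ _ := by
          rw [hC, add_mul, mul_assoc (2 * Real.pi)]
          gcongr
  have key := hasFDerivAt_integral_of_dominated_of_fderiv_le (μ := (volume : Measure V)) (𝕜 := ℝ)
    (F := fun (q : E × V) v => Real.fourierChar (-⟪v, q.2⟫_ℝ) • f (q.1, v))
    (F' := F') (bound := fun v => C * (1 + ‖v‖) ^ (-(m : ℝ))) (x₀ := p) (s := Set.univ) univ_mem
    (Eventually.of_forall fun q => (hm q).aestronglyMeasurable)
    ?_ hF'c.aestronglyMeasurable
    (ae_of_all _ fun v q _ => hF'b q v) (hi.const_mul _) (ae_of_all _ fun v q _ => ?_)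
  · refine ⟨HasFDerivAt.differentiableAt key, fun q => ?_⟩
    refine (congrArg (fun L => L q) (HasFDerivAt.fderiv key)).trans ?_
    rw [ContinuousLinearMap.integral_apply ((hi.const_mul _).mono' hF'c.aestronglyMeasurable
      (ae_of_all _ (hF'b p)))]
    refine integral_congr_ae (ae_of_all _ fun v => ?_)
    change (Real.fourierChar (-⟪v, p.2⟫_ℝ) : ℂ) • ψ p v q =
      (Real.fourierChar (-⟪v, p.2⟫_ℝ) : ℂ) • partialFourierDeriv q f (p.1, v)
    rw [partialFourierDeriv_apply]
    simp only [hψ, add_apply, smul_apply,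
      ContinuousLinearMap.comp_apply,
      ContinuousLinearMap.coe_snd', ContinuousLinearMap.coe_fst', ContinuousLinearMap.inl_apply,
      Complex.ofRealCLM_apply, innerSL_apply_apply, smul_eq_mul]
    ring
  · refine (hi.const_mul (2 ^ (0 + m) * (Finset.Iic (0 + m, 0)).sup
      (schwartzSeminormFamily ℂ (E × V) ℂ) f)).mono' (hm p).aestronglyMeasurable
      (ae_of_all _ fun v => ?_)
    rw [Circle.norm_smul]
    have := f.norm_le_snd 0 m 0 p.1 v
    rwa [pow_zero, one_mul, norm_iteratedFDeriv_zero] at this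
  · have h1 : HasFDerivAt (fun q : E × V => (Real.fourierChar (-⟪v, q.2⟫_ℝ) : ℂ))
        (((-2 * Real.pi * Complex.I * Real.fourierChar (-⟪v, q.2⟫_ℝ)) •
          (Complex.ofRealCLM ∘L (innerSL ℝ v))) ∘L ContinuousLinearMap.snd ℝ E V) q :=
      (Real.hasFDerivAt_fourierChar_neg_bilinear_right (innerSL ℝ (E := V)) v q.2).comp q
        hasFDerivAt_snd
    have h2 : HasFDerivAt (fun q : E × V => f (q.1, v))
        ((fderiv ℝ f (q.1, v)) ∘L (ContinuousLinearMap.inl ℝ E V ∘L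
          ContinuousLinearMap.fst ℝ E V)) q := by
      have h3 : HasFDerivAt (fun q : E × V => (q.1, v)) (ContinuousLinearMap.inl ℝ E V ∘L
          ContinuousLinearMap.fst ℝ E V) q :=
        HasFDerivAt.comp (g := fun e : E => (e, v)) q (hasFDerivAt_prodMk_left q.1 v) hasFDerivAt_fst
      exact (f.hasFDerivAt (q.1, v)).comp q h3
    refine (h1.smul h2).congr_fderiv ?_
    refine ContinuousLinearMap.ext fun r => ?_
    simp only [hF', hψ, add_apply, smul_apply,
      ContinuousLinearMap.smulRight_apply, ContinuousLinearMap.comp_apply,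
      ContinuousLinearMap.coe_snd', ContinuousLinearMap.coe_fst', ContinuousLinearMap.inl_apply,
      Complex.ofRealCLM_apply, innerSL_apply_apply, smul_eq_mul]
    ring

theorem partialFourierFun_bound (k : ℕ) : ∃ (s : Finset (ℕ × ℕ)) (C : ℝ), 0 ≤ C ∧
    ∀ (f : 𝓢(E × V, ℂ)) (p : E × V), ‖p‖ ^ k * ‖partialFourierFun f p‖ ≤
      C * s.sup (schwartzSeminormFamily ℂ (E × V) ℂ) f := by
  set m := (volume : Measure V).integrablePower
  have hi := Measure.integrable_pow_neg_integrablePower (volume : Measure V)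
  set I := ∫ v : V, (1 + ‖v‖) ^ (-(m : ℝ))
  have hI : 0 ≤ I := integral_nonneg fun v => by positivity
  -- the full family of seminorms that enters the estimate
  set s := Finset.Iic (k + m, k) with hs
  have hsl : ∀ j ≤ k, ∀ (f : 𝓢(E × V, ℂ)) (e : E) (v : V), ∀ i ≤ k,
      ‖e‖ ^ i * ‖iteratedFDeriv ℝ j (f.slice e) v‖ ≤
        2 ^ (i + m) * s.sup (schwartzSeminormFamily ℂ (E × V) ℂ) f * (1 + ‖v‖) ^ (-(m : ℝ)) := by
    intro j hj f e v i hik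
    refine norm_le_one_add_rpow_of_pow_mul_le (norm_nonneg v) ?_
    have h1 := f.one_add_norm_pow_mul_le (i + m) j (e, v)
    have h2 : (Finset.Iic (i + m, j)).sup (schwartzSeminormFamily ℂ (E × V) ℂ) f ≤
        s.sup (schwartzSeminormFamily ℂ (E × V) ℂ) f :=
      Seminorm.le_def.1 (Finset.sup_mono (Finset.Iic_subset_Iic.2
        (Prod.mk_le_mk.2 ⟨by omega, hj⟩))) f
    have he : ‖e‖ ≤ ‖(e, v)‖ := norm_fst_le (e, v)
    have hv : ‖v‖ ≤ ‖(e, v)‖ := norm_snd_le (e, v)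
    calc (1 + ‖v‖) ^ m * (‖e‖ ^ i * ‖iteratedFDeriv ℝ j (f.slice e) v‖)
        ≤ (1 + ‖(e, v)‖) ^ m * ((1 + ‖(e, v)‖) ^ i * ‖iteratedFDeriv ℝ j f (e, v)‖) := by
          gcongr
          · linarith
          · exact f.norm_iteratedFDeriv_slice_le e j v
      _ = (1 + ‖(e, v)‖) ^ (i + m) * ‖iteratedFDeriv ℝ j f (e, v)‖ := by ring
      _ ≤ _ := h1.trans (by gcongr)
  refine ⟨s, 2 ^ (k + m) * I + 2 ^ k * ∑ p ∈ Finset.range (0 + 1) ×ˢ Finset.range (k + 1),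
    2 ^ m * I, by positivity, fun f p => ?_⟩
  set q := s.sup (schwartzSeminormFamily ℂ (E × V) ℂ) f
  have hp : ‖p‖ ^ k ≤ ‖p.1‖ ^ k + ‖p.2‖ ^ k := by
    rw [Prod.norm_def]
    rcases max_cases ‖p.1‖ ‖p.2‖ with h | h <;> rw [h.1] <;>
      linarith [pow_nonneg (norm_nonneg p.1) k, pow_nonneg (norm_nonneg p.2) k]
  have h1 : ‖p.1‖ ^ k * ‖partialFourierFun f p‖ ≤ 2 ^ (k + m) * I * q := by
    have h2 : ‖partialFourierFun f p‖ ≤ ∫ v, ‖f (p.1, v)‖ :=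
      VectorFourier.norm_fourierIntegral_le_integral_norm _ _ _ _ _
    calc _ ≤ ‖p.1‖ ^ k * ∫ v, ‖f (p.1, v)‖ := by gcongr
      _ = ∫ v, ‖p.1‖ ^ k * ‖f (p.1, v)‖ := (integral_const_mul _ _).symm
      _ ≤ ∫ v, 2 ^ (k + m) * q * (1 + ‖v‖) ^ (-(m : ℝ)) := by
        refine integral_mono_of_nonneg (ae_of_all _ fun v => by positivity) (hi.const_mul _)
          (ae_of_all _ fun v => ?_)
        simpa using hsl 0 (Nat.zero_le _) f p.1 v k le_rfl
      _ = _ := by rw [integral_const_mul]; ring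
  have h2 : ‖p.2‖ ^ k * ‖partialFourierFun f p‖ ≤
      2 ^ k * (∑ p ∈ Finset.range (0 + 1) ×ˢ Finset.range (k + 1), 2 ^ m * I) * q := by
    have h3 := Real.pow_mul_norm_iteratedFDeriv_fourier_le (K := ⊤) (N := ⊤)
      ((f.slice p.1).smooth ⊤) (fun a n _ _ => (f.slice p.1).integrable_pow_mul_iteratedFDeriv _ a n)
      (k := 0) (n := k) le_top le_top p.2
    rw [norm_iteratedFDeriv_zero] at h3
    refine h3.trans ?_
    rw [pow_zero, one_mul, Nat.cast_zero, mul_zero, zero_add, mul_assoc, Finset.sum_mul]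
    gcongr with r hr
    rw [Finset.mem_product, Finset.mem_range, Finset.mem_range] at hr
    rw [show r.1 = 0 by omega, mul_assoc, mul_comm I, ← mul_assoc, ← integral_const_mul]
    refine integral_mono_of_nonneg (ae_of_all _ fun v => by positivity) (hi.const_mul _)
      (ae_of_all _ fun v => ?_)
    simpa using hsl r.2 (by omega) f p.1 v 0 (Nat.zero_le _)
  calc _ ≤ (‖p.1‖ ^ k + ‖p.2‖ ^ k) * ‖partialFourierFun f p‖ := by gcongr
    _ ≤ _ := by rw [add_mul, add_mul]; exact add_le_add h1 h2

variable [FiniteDimensional ℝ E]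

theorem partialFourierFun_smooth_bound (n : ℕ) :
    (∀ f : 𝓢(E × V, ℂ), ContDiff ℝ n (partialFourierFun f)) ∧
    ∀ k : ℕ, ∃ (s : Finset (ℕ × ℕ)) (C : ℝ), 0 ≤ C ∧
    ∀ (f : 𝓢(E × V, ℂ)) (p : E × V), ‖p‖ ^ k * ‖iteratedFDeriv ℝ n (partialFourierFun f) p‖ ≤
      C * s.sup (schwartzSeminormFamily ℂ (E × V) ℂ) f := by
  set b := Module.finBasis ℝ (E × V)
  have h := contDiff_and_bound_of_partial_derivs b
    (fun f : 𝓢(E × V, ℂ) => partialFourierFun f) (fun j f => partialFourierDeriv (b j) f)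
    (fun f p => (hasFDerivAt_partialFourierFun f p).1)
    (fun f j p => (hasFDerivAt_partialFourierFun f p).2 (b j)) n
  refine ⟨h.1, fun k => ?_⟩
  let Bd : (𝓢(E × V, ℂ) → ℝ) → Prop := fun β => ∃ (s : Finset (ℕ × ℕ)) (C : ℝ), 0 ≤ C ∧
    ∀ f : 𝓢(E × V, ℂ), β f ≤ C * s.sup (schwartzSeminormFamily ℂ (E × V) ℂ) f
  have h1 : ∀ β j, Bd β → Bd fun f => β (partialFourierDeriv (b j) f) := by
    rintro β j ⟨s, C, hC, h⟩
    obtain ⟨t, C', hC', h'⟩ := SchwartzMap.exists_sup_seminorm_le (partialFourierDeriv (b j)) s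
    refine ⟨t, C * C', by positivity, fun f => (h _).trans ?_⟩
    rw [mul_assoc]
    gcongr
    exact h' f
  have h2 : ∀ (c : Fin (Module.finrank ℝ (E × V)) → ℝ)
      (β : Fin (Module.finrank ℝ (E × V)) → 𝓢(E × V, ℂ) → ℝ), (∀ j, 0 ≤ c j) → (∀ j, Bd (β j)) →
      Bd fun f => ∑ j, c j * β j f := by
    intro c β hc hβ
    choose s C hC h using hβ
    refine ⟨Finset.univ.sup s, ∑ j, c j * C j,
      Finset.sum_nonneg fun j _ => mul_nonneg (hc j) (hC j), fun f => ?_⟩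
    rw [Finset.sum_mul]
    refine Finset.sum_le_sum fun j _ => ?_
    rw [mul_assoc]
    refine mul_le_mul_of_nonneg_left ((h j f).trans ?_) (hc j)
    refine mul_le_mul_of_nonneg_left ?_ (hC j)
    exact Seminorm.le_def.1 (Finset.sup_mono (Finset.le_sup (f := s) (Finset.mem_univ j))) f
  have h3 : ∃ β, Bd β ∧ ∀ (f : 𝓢(E × V, ℂ)) p, ‖p‖ ^ k * ‖partialFourierFun f p‖ ≤ β f := by
    obtain ⟨s, C, hC, h⟩ := partialFourierFun_bound (E := E) (V := V) k
    exact ⟨_, ⟨s, C, hC, fun f => le_rfl⟩, h⟩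
  obtain ⟨β, ⟨s, C, hC, hβ⟩, hb⟩ :=
    h.2 (fun p => ‖p‖ ^ k) (fun p => by positivity) Bd h1 h2 h3
  exact ⟨s, C, hC, fun f p => (hb f p).trans (hβ f)⟩

/-- The Fourier transform in the second variable, as a continuous linear map of `𝓢(E × V)`. -/
def partialFourier : 𝓢(E × V, ℂ) →L[ℂ] 𝓢(E × V, ℂ) :=
  mkCLM (fun f => partialFourierFun f)
    (fun f g p => by
      simp only [partialFourierFun]
      exact congrFun (congrArg DFunLike.coe (FourierTransform.fourier_add (f.slice p.1)
        (g.slice p.1))) p.2)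
    (fun c f p => by
      simp only [partialFourierFun]
      exact congrFun (congrArg DFunLike.coe (FourierTransform.fourier_smul c (f.slice p.1))) p.2)
    (fun f => contDiff_infty.2 fun n => (partialFourierFun_smooth_bound n).1 f)
    (fun n => (partialFourierFun_smooth_bound n.2).2 n.1)

/-- The inverse Fourier transform in the second variable. -/
def partialFourierInv : 𝓢(E × V, ℂ) →L[ℂ] 𝓢(E × V, ℂ) :=
  compCLMOfContinuousLinearEquiv ℂ
    ((ContinuousLinearEquiv.refl ℝ E).prodCongr (ContinuousLinearEquiv.neg ℝ)) ∘L partialFourier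

theorem partialFourierInv_apply (f : 𝓢(E × V, ℂ)) (e : E) (w : V) :
    partialFourierInv f (e, w) = 𝓕⁻ (f.slice e) w := by
  rw [SchwartzMap.fourierInv_coe, Real.fourierInv_eq_fourier_neg]
  rfl

theorem slice_partialFourier (f : 𝓢(E × V, ℂ)) (e : E) :
    (partialFourier f).slice e = 𝓕 (f.slice e) := SchwartzMap.ext fun _ => rfl

theorem partialFourierInv_partialFourier (f : 𝓢(E × V, ℂ)) :
    partialFourierInv (partialFourier f) = f := by
  ext ⟨e, w⟩
  rw [partialFourierInv_apply, slice_partialFourier, FourierTransform.fourierInv_fourier_eq]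
  rfl

end PartialFourier

/-! ### Oscillatory integral transforms of Schwartz functions -/

section OscTransform

open SchwartzMap FourierTransform

variable {P V D Q S : Type} [NormedAddCommGroup P] [NormedSpace ℝ P] [NormedAddCommGroup V]
  [InnerProductSpace ℝ V] [NormedAddCommGroup D] [NormedSpace ℝ D] [NormedAddCommGroup Q]
  [NormedSpace ℝ Q] [NormedAddCommGroup S] [NormedSpace ℝ S]
  [MeasurableSpace V] [BorelSpace V] [FiniteDimensional ℝ V] [FiniteDimensional ℝ P]
  [FiniteDimensional ℝ S]

/-- The transform `(T H)(q) = ∫ e^{2πi⟨v, w⟩} m(p, v) H(a(p, v)) dv`, where `(p, w) = b q`, with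
linear changes of variables `a`, `b` and an amplitude `m` of temperate growth. -/
def oscTransform (a : (P × V) ≃L[ℝ] D) (b : Q ≃L[ℝ] (P × V)) (m : P × V → ℂ) :
    𝓢(D, ℂ) →L[ℂ] 𝓢(Q, ℂ) :=
  compCLMOfContinuousLinearEquiv ℂ b ∘L partialFourierInv ∘L smulLeftCLM ℂ m ∘L
    compCLMOfContinuousLinearEquiv ℂ a

theorem oscTransform_apply (a : (P × V) ≃L[ℝ] D) (b : Q ≃L[ℝ] (P × V)) {m : P × V → ℂ}
    (hm : m.HasTemperateGrowth) (H : 𝓢(D, ℂ)) (q : Q) :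
    oscTransform a b m H q = ∫ v, Complex.exp (Complex.I * ((2 * Real.pi * ⟪v, (b q).2⟫_ℝ : ℝ) : ℂ))
      * (m ((b q).1, v) * H (a ((b q).1, v))) := by
  change partialFourierInv (smulLeftCLM ℂ m (compCLMOfContinuousLinearEquiv ℂ a H))
    ((b q).1, (b q).2) = _
  rw [partialFourierInv_apply, SchwartzMap.fourierInv_coe, Real.fourierInv_eq']
  refine integral_congr_ae (ae_of_all _ fun v => ?_)
  simp only [slice_apply, smulLeftCLM_apply_apply hm, smul_eq_mul]
  rw [mul_comm Complex.I]
  rfl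

/-- A right inverse of `oscTransform a b m`, if `m m' = 1`. -/
def oscTransformInv (a : (P × V) ≃L[ℝ] D) (b : Q ≃L[ℝ] (P × V)) (m' : P × V → ℂ) :
    𝓢(Q, ℂ) →L[ℂ] 𝓢(D, ℂ) :=
  compCLMOfContinuousLinearEquiv ℂ a.symm ∘L smulLeftCLM ℂ m' ∘L partialFourier ∘L
    compCLMOfContinuousLinearEquiv ℂ b.symm

theorem oscTransform_oscTransformInv (a : (P × V) ≃L[ℝ] D) (b : Q ≃L[ℝ] (P × V))
    {m m' : P × V → ℂ} (hm : m.HasTemperateGrowth) (hm' : m'.HasTemperateGrowth)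
    (h : ∀ x, m x * m' x = 1) (G : 𝓢(Q, ℂ)) :
    oscTransform a b m (oscTransformInv a b m' G) = G := by
  have h1 : smulLeftCLM ℂ m (compCLMOfContinuousLinearEquiv ℂ a (oscTransformInv a b m' G)) =
      partialFourier (compCLMOfContinuousLinearEquiv ℂ b.symm G) := by
    ext x
    rw [smulLeftCLM_apply_apply hm]
    change m x • (smulLeftCLM ℂ m' (partialFourier (compCLMOfContinuousLinearEquiv ℂ b.symm G)))
      (a.symm (a x)) = _
    rw [smulLeftCLM_apply_apply hm', a.symm_apply_apply, smul_smul, h, one_smul]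
  change compCLMOfContinuousLinearEquiv ℂ b (partialFourierInv (smulLeftCLM ℂ m
    (compCLMOfContinuousLinearEquiv ℂ a (oscTransformInv a b m' G)))) = G
  rw [h1, partialFourierInv_partialFourier]
  ext q
  change G (b.symm (b q)) = _
  rw [b.symm_apply_apply]

variable [MeasurableSpace S] [BorelSpace S] [MeasurableSpace Q] [BorelSpace Q]
  [FiniteDimensional ℝ Q]

/-- The functional `H ↦ ∫ ψ T H`, for an oscillatory transform `T` and a bounded function `ψ`,
commutes with superpositions `H = ∫ 𝓗(s, ·) ds` of Schwartz functions. -/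
theorem integral_mul_oscTransform_superposition (a : (P × V) ≃L[ℝ] D) (b : Q ≃L[ℝ] (P × V))
    {m : P × V → ℂ} (hm : m.HasTemperateGrowth) (μ : Measure S) [μ.IsAddHaarMeasure]
    (ν : Measure Q) [ν.IsAddHaarMeasure] {ψ : Q → ℂ} (hψ : Continuous ψ) {C : ℝ}
    (hC : ∀ q, ‖ψ q‖ ≤ C) (𝓗 : 𝓢(S × D, ℂ)) (H : 𝓢(D, ℂ)) (hH : ∀ x, H x = ∫ s, 𝓗 (s, x) ∂μ) :
    Integrable (fun s => ∫ q, ψ q * oscTransform a b m (𝓗.slice s) q ∂ν) μ ∧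
      ∫ q, ψ q * oscTransform a b m H q ∂ν =
        ∫ s, ∫ q, ψ q * oscTransform a b m (𝓗.slice s) q ∂ν ∂μ := by
  set a' : ((S × P) × V) ≃L[ℝ] S × D :=
    (ContinuousLinearEquiv.prodAssoc ℝ S P V).trans ((ContinuousLinearEquiv.refl ℝ S).prodCongr a)
  set b' : (S × Q) ≃L[ℝ] ((S × P) × V) :=
    ((ContinuousLinearEquiv.refl ℝ S).prodCongr b).trans
      (ContinuousLinearEquiv.prodAssoc ℝ S P V).symm
  set m' : (S × P) × V → ℂ := fun x => m (x.1.2, x.2)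
  have hm' : m'.HasTemperateGrowth := hm.comp
    (((ContinuousLinearMap.snd ℝ S P).prodMap (ContinuousLinearMap.id ℝ V)).hasTemperateGrowth)
  set 𝓖 := oscTransform a' b' m' 𝓗
  have h𝓖 : ∀ s q, oscTransform a b m (𝓗.slice s) q = 𝓖 (s, q) := by
    intro s q
    rw [oscTransform_apply a b hm, oscTransform_apply a' b' hm']
    rfl
  have hTH : ∀ q, oscTransform a b m H q = ∫ s, 𝓖 (s, q) ∂μ := by
    intro q
    simp_rw [← h𝓖, oscTransform_apply a b hm, hH]
    -- the amplitude times `𝓗`, frozen at `p = (b q).1`, is a Schwartz function of `(s, v)`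
    set 𝓚 := smulLeftCLM ℂ m' (compCLMOfContinuousLinearEquiv ℂ a' 𝓗)
    set e : (P × S × V) ≃L[ℝ] ((S × P) × V) := (ContinuousLinearEquiv.prodAssoc ℝ P S V).symm.trans
      ((ContinuousLinearEquiv.prodComm ℝ P S).prodCongr (ContinuousLinearEquiv.refl ℝ V))
    set k := (compCLMOfContinuousLinearEquiv ℂ e 𝓚).slice (b q).1
    have hk : ∀ s v, k (s, v) = m ((b q).1, v) * 𝓗 (s, a ((b q).1, v)) := fun s v =>
      smulLeftCLM_apply_apply hm' _ _
    have hi : Integrable (fun x : S × V => Complex.exp (Complex.I *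
        ((2 * Real.pi * ⟪x.2, (b q).2⟫_ℝ : ℝ) : ℂ)) * k x) (μ.prod volume) := by
      refine (k.integrable (μ := μ.prod volume)).bdd_mul (c := 1)
        (Continuous.aestronglyMeasurable (by fun_prop)) (ae_of_all _ fun x => ?_)
      rw [mul_comm, Complex.norm_exp_ofReal_mul_I]
    calc ∫ v, Complex.exp (Complex.I * ((2 * Real.pi * ⟪v, (b q).2⟫_ℝ : ℝ) : ℂ))
          * (m ((b q).1, v) * ∫ s, 𝓗 (s, a ((b q).1, v)) ∂μ)
        = ∫ v, ∫ s, Complex.exp (Complex.I * ((2 * Real.pi * ⟪v, (b q).2⟫_ℝ : ℝ) : ℂ)) *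
            k (s, v) ∂μ := by
          refine integral_congr_ae (ae_of_all _ fun v => ?_)
          simp only [hk]
          rw [integral_const_mul, integral_const_mul]
      _ = _ := by
          refine (integral_integral_swap (f := fun v s => Complex.exp (Complex.I *
            ((2 * Real.pi * ⟪v, (b q).2⟫_ℝ : ℝ) : ℂ)) * k (s, v)) hi.swap).trans ?_
          simp only [hk]
          rfl
  have hi : Integrable (fun x : S × Q => ψ x.2 * 𝓖 x) (μ.prod ν) :=
    (𝓖.integrable (μ := μ.prod ν)).bdd_mul (c := C)
      (hψ.comp continuous_snd).aestronglyMeasurable (ae_of_all _ fun x => hC x.2)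
  simp_rw [h𝓖]
  refine ⟨hi.integral_prod_left, ?_⟩
  rw [integral_integral_swap hi]
  refine integral_congr_ae (ae_of_all _ fun q => ?_)
  simp only [hTH]
  rw [integral_const_mul]

end OscTransform

/-! ### Superpositions of tensor products -/

section Superposition

open SchwartzMap FourierTransform

section Tensor

variable {E F : Type} [NormedAddCommGroup E] [NormedSpace ℝ E] [NormedAddCommGroup F]
  [NormedSpace ℝ F]

/-- The tensor product with a fixed Schwartz function, as a continuous linear map. -/
def schwartzTensorCLM (g : 𝓢(E, ℂ)) : 𝓢(F, ℂ) →L[ℂ] 𝓢(E × F, ℂ) :=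
  mkCLM (fun h p => g p.1 * h p.2) (fun h h' p => mul_add _ _ _)
    (fun c h p => by simp [mul_left_comm])
    (fun h => (schwartzTensor g h).smooth ⊤) (by
      rintro ⟨k, n⟩
      choose C hC using g.decay'
      have hC0 : ∀ k i, 0 ≤ C k i := fun k i => le_trans (by positivity) (hC k i 0)
      refine ⟨Finset.Iic (k, n), ∑ i ∈ Finset.range (n + 1), (n.choose i : ℝ) *
        (C k i + C 0 i), Finset.sum_nonneg fun i _ => mul_nonneg (by positivity)
          (add_nonneg (hC0 _ _) (hC0 _ _)), fun h p => ?_⟩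
      set q := (Finset.Iic (k, n)).sup (schwartzSeminormFamily ℂ F ℂ) h
      have hq : 0 ≤ q := apply_nonneg _ _
      have hq' : ∀ l ≤ k, ∀ j ≤ n, ‖p.2‖ ^ l * ‖iteratedFDeriv ℝ j h p.2‖ ≤ q := fun l hl j hj =>
        (le_seminorm ℂ l j h p.2).trans (Seminorm.le_def.1 (Finset.le_sup
          (f := schwartzSeminormFamily ℂ F ℂ) (Finset.mem_Iic.2 (Prod.mk_le_mk.2 ⟨hl, hj⟩))) h)
      have hmul := norm_iteratedFDeriv_mul_le (𝕜 := ℝ) (A := ℂ) (N := ∞)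
        ((g.smooth ⊤).comp (contDiff_fst (𝕜 := ℝ) (E := E) (F := F)))
        ((h.smooth ⊤).comp (contDiff_snd (𝕜 := ℝ) (E := E) (F := F))) p (n := n)
        (by exact_mod_cast le_top)
      refine (mul_le_mul_of_nonneg_left hmul (by positivity)).trans ?_
      rw [Finset.mul_sum, Finset.sum_mul]
      refine Finset.sum_le_sum fun i _ => ?_
      have h1 := norm_iteratedFDeriv_comp_le_of_norm_le_one g (ContinuousLinearMap.fst ℝ E F)
        (ContinuousLinearMap.norm_fst_le ℝ E F) i p
      have h2 := norm_iteratedFDeriv_comp_le_of_norm_le_one h (ContinuousLinearMap.snd ℝ E F)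
        (ContinuousLinearMap.norm_snd_le ℝ E F) (n - i) p
      have hp : ‖p‖ ^ k ≤ ‖p.1‖ ^ k + ‖p.2‖ ^ k := by
        rw [Prod.norm_def]
        rcases max_cases ‖p.1‖ ‖p.2‖ with h | h <;> rw [h.1] <;>
          linarith [pow_nonneg (norm_nonneg p.1) k, pow_nonneg (norm_nonneg p.2) k]
      have a1 := hC k i p.1
      have a2 := hC 0 i p.1
      have b1 := hq' k le_rfl (n - i) (Nat.sub_le _ _)
      have b2 := hq' 0 (Nat.zero_le _) (n - i) (Nat.sub_le _ _)
      simp only [pow_zero, one_mul] at a2 b2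
      set u := ‖iteratedFDeriv ℝ i g p.1‖
      set w := ‖iteratedFDeriv ℝ (n - i) h p.2‖
      have hu : 0 ≤ u := norm_nonneg _
      have hw : 0 ≤ w := norm_nonneg _
      calc ‖p‖ ^ k * ((n.choose i : ℝ) * ‖iteratedFDeriv ℝ i (⇑g ∘ Prod.fst) p‖ *
            ‖iteratedFDeriv ℝ (n - i) (⇑h ∘ Prod.snd) p‖)
          ≤ (‖p.1‖ ^ k + ‖p.2‖ ^ k) * ((n.choose i : ℝ) * u * w) := by
            gcongr
            · exact h1
            · exact h2
        _ = (n.choose i : ℝ) * ((‖p.1‖ ^ k * u) * w + u * (‖p.2‖ ^ k * w)) := by ring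
        _ ≤ (n.choose i : ℝ) * (C k i * q + C 0 i * q) :=
            mul_le_mul_of_nonneg_left (add_le_add (mul_le_mul a1 b2 hw (hC0 _ _))
              (mul_le_mul a2 b1 (by positivity) (hC0 _ _))) (by positivity)
        _ = _ := by ring)

@[simp]
theorem schwartzTensor_apply (g : 𝓢(E, ℂ)) (h : 𝓢(F, ℂ)) (p : E × F) :
    schwartzTensor g h p = g p.1 * h p.2 := rfl

end Tensor

variable {V D : Type} [NormedAddCommGroup V] [InnerProductSpace ℝ V] [NormedAddCommGroup D]
  [NormedSpace ℝ D]

/-- Translation by `s.1` followed by modulation by the frequency `s.2`. -/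
def timeFrequencyShift (g : 𝓢(V, ℂ)) (s : V × V) : 𝓢(V, ℂ) :=
  smulLeftCLM ℂ (fun x => Complex.exp (Complex.I * ((2 * Real.pi * ⟪x, s.2⟫_ℝ : ℝ) : ℂ)))
    (g.compSubConstCLM ℂ s.1)

theorem hasTemperateGrowth_cexp_inner {E : Type} [NormedAddCommGroup E] [NormedSpace ℝ E]
    {f g : E → V} (hf : f.HasTemperateGrowth) (hg : g.HasTemperateGrowth) :
    (fun x => Complex.exp (Complex.I * ((2 * Real.pi * ⟪f x, g x⟫_ℝ : ℝ) : ℂ))).HasTemperateGrowth :=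
  ((Function.HasTemperateGrowth.const (2 * Real.pi)).fun_mul
    (ContinuousLinearMap.bilinear_hasTemperateGrowth (innerSL ℝ) hf hg)).cexp_I_mul

theorem timeFrequencyShift_apply (g : 𝓢(V, ℂ)) (s : V × V) (x : V) :
    timeFrequencyShift g s x =
      Complex.exp (Complex.I * ((2 * Real.pi * ⟪x, s.2⟫_ℝ : ℝ) : ℂ)) * g (x - s.1) :=
  smulLeftCLM_apply_apply (hasTemperateGrowth_cexp_inner
    (ContinuousLinearMap.id ℝ V).hasTemperateGrowth (Function.HasTemperateGrowth.const _)) _ _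

variable [MeasurableSpace V] [BorelSpace V] [FiniteDimensional ℝ V]

instance instIsAddHaarMeasureVolumeProd : (volume : Measure (V × V)).IsAddHaarMeasure :=
  Measure.prod.instIsAddHaarMeasure _ _

/-- The short-time Fourier transform `(z, η) ↦ ∫ e^{-2πi⟨y, η⟩} g(y - z) H(y) dy` with window `g`. -/
def stft (g : 𝓢(V, ℂ)) : 𝓢(V, ℂ) →L[ℂ] 𝓢(V × V, ℂ) :=
  partialFourier ∘L compCLMOfContinuousLinearEquiv ℂ
    (((ContinuousLinearEquiv.prodComm ℝ V V).trans
      ((ContinuousLinearEquiv.refl ℝ V).skewProd (ContinuousLinearEquiv.neg ℝ)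
        (ContinuousLinearMap.id ℝ V))).trans (ContinuousLinearEquiv.prodComm ℝ V V)) ∘L
    schwartzTensorCLM g

/-- The family `(s, x) ↦ c(s) (timeFrequencyShift g s)(x)`, where `c` is the short-time Fourier
transform of `H` with window `g₀`. -/
def tfSuperposition (g₀ g : 𝓢(V, ℂ)) (H : 𝓢(V, ℂ)) : 𝓢((V × V) × V, ℂ) :=
  smulLeftCLM ℂ (fun p : (V × V) × V =>
      Complex.exp (Complex.I * ((2 * Real.pi * ⟪p.2, p.1.2⟫_ℝ : ℝ) : ℂ)))
    (compCLMOfContinuousLinearEquiv ℂ ((ContinuousLinearEquiv.refl ℝ (V × V)).skewProd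
      (ContinuousLinearEquiv.refl ℝ V) (-ContinuousLinearMap.fst ℝ V V))
      (schwartzTensor (stft g₀ H) g))

theorem tfSuperposition_apply (g₀ g H : 𝓢(V, ℂ)) (s : V × V) (x : V) :
    tfSuperposition g₀ g H (s, x) = stft g₀ H s * timeFrequencyShift g s x := by
  rw [timeFrequencyShift_apply]
  refine (smulLeftCLM_apply_apply (hasTemperateGrowth_cexp_inner
    (ContinuousLinearMap.snd ℝ (V × V) V).hasTemperateGrowth
    (ContinuousLinearMap.snd ℝ V V ∘L ContinuousLinearMap.fst ℝ (V × V) V).hasTemperateGrowth)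
    _ _).trans ?_
  change Complex.exp (Complex.I * ((2 * Real.pi * ⟪x, s.2⟫_ℝ : ℝ) : ℂ)) *
    (stft g₀ H s * g (x + -s.1)) = _
  rw [← sub_eq_add_neg]
  ring

/-- Inversion of the short-time Fourier transform, for a window `g₀` with dual window `g`. -/
theorem integral_tfSuperposition {g₀ g : 𝓢(V, ℂ)} (h : ∫ x, g x * g₀ x = 1) (H : 𝓢(V, ℂ)) (x : V) :
    ∫ s, tfSuperposition g₀ g H (s, x) = H x := by
  have hi : Integrable (fun s => tfSuperposition g₀ g H (s, x)) :=
    ((compCLMOfContinuousLinearEquiv ℂ (ContinuousLinearEquiv.prodComm ℝ V (V × V))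
      (tfSuperposition g₀ g H)).slice x).integrable
  rw [Measure.volume_eq_prod] at hi ⊢
  rw [integral_prod _ hi]
  have h1 : ∀ z, ∫ η, tfSuperposition g₀ g H ((z, η), x) = g (x - z) * g₀ (x - z) * H x := by
    intro z
    set G := compCLMOfContinuousLinearEquiv ℂ (((ContinuousLinearEquiv.prodComm ℝ V V).trans
      ((ContinuousLinearEquiv.refl ℝ V).skewProd (ContinuousLinearEquiv.neg ℝ)
        (ContinuousLinearMap.id ℝ V))).trans (ContinuousLinearEquiv.prodComm ℝ V V))
      (schwartzTensorCLM g₀ H) with hG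
    have h2 : ∀ η, stft g₀ H (z, η) = 𝓕 (G.slice z) η := fun η => rfl
    have h3 : 𝓕⁻ (𝓕 (G.slice z)) x = g₀ (x - z) * H x := by
      rw [FourierTransform.fourierInv_fourier_eq]
      change g₀ (-z + x) * H x = _
      rw [neg_add_eq_sub]
    rw [SchwartzMap.fourierInv_coe, Real.fourierInv_eq'] at h3
    rw [mul_assoc, ← h3, ← integral_const_mul]
    refine integral_congr_ae (ae_of_all _ fun η => ?_)
    simp only [tfSuperposition_apply, timeFrequencyShift_apply, h2, smul_eq_mul]
    rw [real_inner_comm, mul_comm Complex.I]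
    ring
  simp_rw [h1]
  rw [integral_mul_const, integral_sub_left_eq_self (fun z => g z * g₀ z) volume x, h, one_mul]

theorem exists_integral_norm_stft_le (g₀ : 𝓢(V, ℂ)) : ∃ (s : Finset (ℕ × ℕ)) (C : ℝ), 0 ≤ C ∧
    ∀ H : 𝓢(V, ℂ), ∫ p, ‖stft g₀ H p‖ ≤ C * s.sup (schwartzSeminormFamily ℂ V ℂ) H := by
  set m := (volume : Measure (V × V)).integrablePower
  obtain ⟨s, C, hC, h⟩ := SchwartzMap.exists_sup_seminorm_le (stft g₀) (Finset.Iic (m, 0))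
  have hi := Measure.integrable_pow_neg_integrablePower (volume : Measure (V × V))
  refine ⟨s, (2 ^ m * C) * ∫ p : V × V, (1 + ‖p‖) ^ (-(m : ℝ)),
    mul_nonneg (by positivity) (integral_nonneg fun p => by positivity), fun H => ?_⟩
  calc _ ≤ ∫ p : V × V, (2 ^ m * C * s.sup (schwartzSeminormFamily ℂ V ℂ) H) *
        (1 + ‖p‖) ^ (-(m : ℝ)) := by
        refine integral_mono_of_nonneg (ae_of_all _ fun p => norm_nonneg _) (hi.const_mul _)
          (ae_of_all _ fun p => ?_)
        refine norm_le_one_add_rpow_of_pow_mul_le (norm_nonneg p) ?_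
        have h1 := (stft g₀ H).one_add_norm_pow_mul_le m 0 p
        rw [norm_iteratedFDeriv_zero] at h1
        refine h1.trans ?_
        rw [mul_assoc]
        gcongr
        exact h H
    _ = _ := by rw [integral_const_mul]; ring

/-- The functional `Λ` commutes with superpositions `H = ∫ 𝓗(s, ·) ds` of Schwartz functions. -/
def CommutesWithSuperposition (V : Type) [NormedAddCommGroup V] [InnerProductSpace ℝ V]
    [MeasurableSpace V] [BorelSpace V] [FiniteDimensional ℝ V] (Λ : 𝓢(D, ℂ) →ₗ[ℂ] ℂ) : Prop :=
  ∀ (𝓗 : 𝓢((V × V) × D, ℂ)) (H : 𝓢(D, ℂ)), (∀ x, H x = ∫ s, 𝓗 (s, x)) →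
    Integrable (fun s => Λ (𝓗.slice s)) ∧ Λ H = ∫ s, Λ (𝓗.slice s)

/-- If functionals `Λ i` commute with superpositions, then a bound on `∑ i, ‖Λ i f‖` for the
time-frequency shifts `f` of a single function is a bound for all Schwartz functions. -/
theorem sum_norm_le_integral_stft {ι : Type*} (F : Finset ι) {g₀ g : 𝓢(V, ℂ)}
    (h : ∫ x, g x * g₀ x = 1) (e : D ≃L[ℝ] V) (Λ : ι → 𝓢(D, ℂ) →ₗ[ℂ] ℂ)
    (hΛ : ∀ i, CommutesWithSuperposition V (Λ i)) {A : ℝ}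
    (hA : ∀ s, ∑ i ∈ F, ‖Λ i (compCLMOfContinuousLinearEquiv ℂ e (timeFrequencyShift g s))‖ ≤ A)
    (H : 𝓢(D, ℂ)) :
    ∑ i ∈ F, ‖Λ i H‖ ≤
      A * ∫ s, ‖stft g₀ (compCLMOfContinuousLinearEquiv ℂ e.symm H) s‖ := by
  set H' := compCLMOfContinuousLinearEquiv ℂ e.symm H
  set 𝓗 : 𝓢((V × V) × D, ℂ) := compCLMOfContinuousLinearEquiv ℂ
    ((ContinuousLinearEquiv.refl ℝ (V × V)).prodCongr e) (tfSuperposition g₀ g H')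
  have hs : ∀ s, 𝓗.slice s = stft g₀ H' s • compCLMOfContinuousLinearEquiv ℂ e
      (timeFrequencyShift g s) := fun s => SchwartzMap.ext fun x =>
    tfSuperposition_apply g₀ g H' s (e x)
  have hH : ∀ x, H x = ∫ s, 𝓗 (s, x) := by
    intro x
    refine Eq.trans ?_ (integral_tfSuperposition h H' (e x)).symm
    change H x = H (e.symm (e x))
    rw [e.symm_apply_apply]
  have key := fun i => hΛ i 𝓗 H hH
  calc ∑ i ∈ F, ‖Λ i H‖ ≤ ∑ i ∈ F, ∫ s, ‖Λ i (𝓗.slice s)‖ := by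
        refine Finset.sum_le_sum fun i _ => ?_
        rw [(key i).2]
        exact norm_integral_le_integral_norm _
    _ = ∫ s, ∑ i ∈ F, ‖Λ i (𝓗.slice s)‖ :=
        (integral_finsetSum _ fun i _ => (key i).1.norm).symm
    _ ≤ ∫ s, A * ‖stft g₀ H' s‖ := by
        refine integral_mono (integrable_finsetSum _ fun i _ => (key i).1.norm)
          ((stft g₀ H').integrable.norm.const_mul _) fun s => ?_
        simp only [hs, map_smul, norm_smul]
        rw [← Finset.mul_sum, mul_comm]
        exact mul_le_mul_of_nonneg_right (hA s) (norm_nonneg _)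
    _ = _ := integral_const_mul _ _

end Superposition

/-! ### Oscillatory integrals with amplitudes that do not decay in the frequency -/

section WeylOperator

open SchwartzMap FourierTransform

theorem norm_iteratedFDeriv_mul_le_of_le {E : Type*} [NormedAddCommGroup E] [NormedSpace ℝ E]
    {g h : E → ℂ} (hg : ContDiff ℝ ∞ g) (hh : ContDiff ℝ ∞ h) {k : ℕ} {y : E} {G H : ℝ}
    (hG : ∀ i ≤ k, ‖iteratedFDeriv ℝ i g y‖ ≤ G) (hH : ∀ i ≤ k, ‖iteratedFDeriv ℝ i h y‖ ≤ H)
    {j : ℕ} (hj : j ≤ k) :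
    ‖iteratedFDeriv ℝ j (fun y => g y * h y) y‖ ≤ 2 ^ k * (G * H) := by
  have hG0 : 0 ≤ G := (norm_nonneg _).trans (hG 0 (Nat.zero_le _))
  have hH0 : 0 ≤ H := (norm_nonneg _).trans (hH 0 (Nat.zero_le _))
  refine (norm_iteratedFDeriv_mul_le hg hh y (n := j) (by exact_mod_cast le_top)).trans ?_
  calc _ ≤ ∑ i ∈ Finset.range (j + 1), (j.choose i : ℝ) * (G * H) := by
        refine Finset.sum_le_sum fun i hi => ?_
        rw [Finset.mem_range] at hi
        rw [mul_assoc]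
        exact mul_le_mul_of_nonneg_left (mul_le_mul (hG i (by omega)) (hH (j - i) (by omega))
          (norm_nonneg _) hG0) (by positivity)
    _ = 2 ^ j * (G * H) := by
        rw [← Finset.sum_mul]
        congr 1
        exact_mod_cast Nat.sum_range_choose j
    _ ≤ _ := by
        refine mul_le_mul_of_nonneg_right (pow_le_pow_right₀ (by norm_num) hj) (by positivity)

/-- The data `E`, `φ`, `f` of the oscillatory integral
`∫∫ e^{iξ·(x-y)} E(x, y) φ((x+y)/2, ξ) f(y) dy dξ`. -/
structure WeylData (d : ℕ) where
  /-- the amplitude -/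
  E : ConfSpace d × ConfSpace d → ℂ
  hE : E.HasTemperateGrowth
  /-- the symbol -/
  φ : PhaseSpace d → ℂ
  hφ : IsHormander φ
  /-- the Schwartz function the operator is applied to -/
  f : 𝓢(ConfSpace d, ℂ)

namespace WeylData

variable {d : ℕ} (T : WeylData d)

/-- The integrand without its oscillating factor. -/
def amp (x ξ y : ConfSpace d) : ℂ := T.E (x, y) * T.φ ((1 / 2 : ℝ) • (x + y), ξ) * T.f y

/-- The integral over `y`. -/
def inner (x ξ : ConfSpace d) : ℂ :=
  ∫ y, Complex.exp (Complex.I * ((⟪ξ, x - y⟫_ℝ : ℝ) : ℂ)) * T.amp x ξ y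

/-- The iterated integral, as a function of `x`. -/
def op (x : ConfSpace d) : ℂ := ∫ ξ, T.inner x ξ

theorem contDiff_amp : ContDiff ℝ ∞ fun p : ConfSpace d × ConfSpace d × ConfSpace d =>
    T.amp p.1 p.2.1 p.2.2 := by
  have h1 := T.hE.1
  have h2 := T.hφ.1
  have h3 := T.f.smooth ⊤
  unfold amp
  exact ((h1.comp (by fun_prop)).mul (h2.comp (by fun_prop))).mul (h3.comp (by fun_prop))

/-- The derivatives in `y` of the integrand decay rapidly in `y`, at the price of a polynomial
growth in `x` whose degree `N` does not depend on the decay. -/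
theorem exists_amp_bound {E : ConfSpace d × ConfSpace d → ℂ} (hE : E.HasTemperateGrowth) (k : ℕ) :
    ∃ N : ℕ, ∀ T : WeylData d, T.E = E → ∀ M : ℕ, ∃ C : ℝ, 0 ≤ C ∧ ∀ x ξ y, ∀ j ≤ k,
      (1 + ‖y‖) ^ M * ‖iteratedFDeriv ℝ j (T.amp x ξ) y‖ ≤ C * (1 + ‖x‖) ^ N := by
  obtain ⟨N, CE, hCE, hb⟩ := hE.norm_iteratedFDeriv_le_uniform k
  refine ⟨N, ?_⟩
  rintro T rfl M
  choose Cφ hCφ using T.hφ.2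
  have hCφ0 : ∀ i, 0 ≤ Cφ i := fun i => (norm_nonneg _).trans (hCφ i 0)
  set Cf := ∑ i ∈ Finset.range (k + 1),
    2 ^ (M + N) * (Finset.Iic (M + N, i)).sup (schwartzSeminormFamily ℂ (ConfSpace d) ℂ) T.f
  have hCf0 : 0 ≤ Cf := Finset.sum_nonneg fun i _ => mul_nonneg (by positivity) (apply_nonneg _ _)
  refine ⟨2 ^ k * (2 ^ k * (CE * ∑ i ∈ Finset.range (k + 1), Cφ i) * Cf), ?_, ?_⟩
  · have := Finset.sum_nonneg (s := Finset.range (k + 1)) fun i _ => hCφ0 i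
    positivity
  intro x ξ y j hj
  have e1 : ∀ i ≤ k, ‖iteratedFDeriv ℝ i (fun y => T.E (x, y)) y‖ ≤
      CE * (1 + ‖x‖) ^ N * (1 + ‖y‖) ^ N := by
    intro i hi
    have h1 := norm_iteratedFDeriv_comp_affine_le T.hE.1
      (ContinuousLinearMap.inr ℝ (ConfSpace d) (ConfSpace d))
      (ContinuousLinearMap.norm_inr_le_one ℝ _ _) (x, 0) i y
    simp only [ContinuousLinearMap.inr_apply, Prod.mk_add_mk, add_zero, zero_add] at h1
    refine h1.trans ((hb i hi (x, y)).trans ?_)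
    rw [mul_assoc, ← mul_pow]
    gcongr
    have : ‖(x, y)‖ ≤ ‖x‖ + ‖y‖ := by
      rw [Prod.norm_def]; exact max_le_add_of_nonneg (norm_nonneg _) (norm_nonneg _)
    nlinarith [norm_nonneg x, norm_nonneg y]
  have e2 : ∀ i ≤ k, ‖iteratedFDeriv ℝ i (fun y => T.φ ((1 / 2 : ℝ) • (x + y), ξ)) y‖ ≤
      ∑ i ∈ Finset.range (k + 1), Cφ i := by
    intro i hi
    have hL : ‖(1 / 2 : ℝ) • ContinuousLinearMap.inl ℝ (ConfSpace d) (ConfSpace d)‖ ≤ 1 := by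
      rw [norm_smul]
      have := ContinuousLinearMap.norm_inl_le_one ℝ (ConfSpace d) (ConfSpace d)
      norm_num
      linarith
    have h1 := norm_iteratedFDeriv_comp_affine_le T.hφ.1 _ hL ((1 / 2 : ℝ) • x, ξ) i y
    have h2 : ∀ z, ((1 / 2 : ℝ) • x, ξ) +
        ((1 / 2 : ℝ) • ContinuousLinearMap.inl ℝ (ConfSpace d) (ConfSpace d)) z =
        ((1 / 2 : ℝ) • (x + z), ξ) := by
      intro z
      simp [smul_add]
    simp only [h2] at h1
    exact h1.trans ((hCφ i _).trans (Finset.single_le_sum (f := Cφ) (fun i _ => hCφ0 i)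
      (Finset.mem_range.2 (by omega))))
  have e3 : ∀ i ≤ k, ‖iteratedFDeriv ℝ i T.f y‖ ≤ Cf * ((1 + ‖y‖) ^ (M + N))⁻¹ := by
    intro i hi
    rw [← div_eq_mul_inv, le_div_iff₀ (by positivity), mul_comm]
    refine (T.f.one_add_norm_pow_mul_le (M + N) i y).trans ?_
    exact Finset.single_le_sum (f := fun i => 2 ^ (M + N) * (Finset.Iic (M + N, i)).sup
      (schwartzSeminormFamily ℂ (ConfSpace d) ℂ) T.f)
      (fun i _ => mul_nonneg (by positivity) (apply_nonneg _ _)) (Finset.mem_range.2 (by omega))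
  have c1 : ContDiff ℝ ∞ fun y => T.E (x, y) := T.hE.1.comp (by fun_prop)
  have c2 : ContDiff ℝ ∞ fun y => T.φ ((1 / 2 : ℝ) • (x + y), ξ) := T.hφ.1.comp (by fun_prop)
  have key := norm_iteratedFDeriv_mul_le_of_le (c1.mul c2) (T.f.smooth ⊤)
    (fun i hi => norm_iteratedFDeriv_mul_le_of_le c1 c2 e1 e2 hi) e3 hj
  calc _ ≤ (1 + ‖y‖) ^ M * (2 ^ k * (2 ^ k * (CE * (1 + ‖x‖) ^ N * (1 + ‖y‖) ^ N *
        ∑ i ∈ Finset.range (k + 1), Cφ i) * (Cf * ((1 + ‖y‖) ^ (M + N))⁻¹))) := by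
        exact mul_le_mul_of_nonneg_left key (by positivity)
    _ = _ := by
      rw [pow_add]
      field_simp

theorem exists_amp_le {E : ConfSpace d × ConfSpace d → ℂ} (hE : E.HasTemperateGrowth) (k : ℕ) :
    ∃ N : ℕ, ∀ T : WeylData d, T.E = E → ∀ M : ℕ, ∃ C : ℝ, 0 ≤ C ∧ ∀ x ξ y, ∀ j ≤ k,
      ‖iteratedFDeriv ℝ j (T.amp x ξ) y‖ ≤ C * (1 + ‖x‖) ^ N * (1 + ‖y‖) ^ (-(M : ℝ)) := by
  obtain ⟨N, h⟩ := exists_amp_bound hE k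
  refine ⟨N, fun T hT M => ?_⟩
  obtain ⟨C, hC, h⟩ := h T hT M
  exact ⟨C, hC, fun x ξ y j hj => norm_le_one_add_rpow_of_pow_mul_le (norm_nonneg _)
    (h x ξ y j hj)⟩

theorem inner_eq_fourier (x ξ : ConfSpace d) :
    T.inner x ξ = Complex.exp (Complex.I * ((⟪ξ, x⟫_ℝ : ℝ) : ℂ)) *
      𝓕 (T.amp x ξ) ((2 * Real.pi)⁻¹ • ξ) := by
  rw [Real.fourier_eq', ← integral_const_mul]
  refine integral_congr_ae (ae_of_all _ fun y => ?_)
  simp only [smul_eq_mul]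
  rw [← mul_assoc, ← Complex.exp_add]
  congr 2
  rw [inner_smul_right, real_inner_comm ξ y, inner_sub_right]
  have : (Real.pi : ℂ) ≠ 0 := by exact_mod_cast Real.pi_ne_zero
  push_cast
  field_simp
  ring

/-- The integral over `y` decays rapidly in `ξ`; its growth in `x` only depends on the
amplitude. -/
theorem exists_inner_bound {E : ConfSpace d × ConfSpace d → ℂ} (hE : E.HasTemperateGrowth)
    (r : ℕ) : ∃ N : ℕ, ∀ T : WeylData d, T.E = E → ∃ C : ℝ, 0 ≤ C ∧ ∀ x ξ,
      ‖T.inner x ξ‖ ≤ C * (1 + ‖x‖) ^ N * (1 + ‖ξ‖) ^ (-(r : ℝ)) := by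
  obtain ⟨N, h⟩ := exists_amp_le hE r
  refine ⟨N, fun T hT => ?_⟩
  set m := (volume : Measure (ConfSpace d)).integrablePower
  have hi := Measure.integrable_pow_neg_integrablePower (volume : Measure (ConfSpace d))
  set I₀ := ∫ y : ConfSpace d, (1 + ‖y‖) ^ (-(m : ℝ))
  have hI₀ : 0 ≤ I₀ := integral_nonneg fun y => by positivity
  obtain ⟨C, hC, hb⟩ := h T hT m
  have hc : ∀ x ξ, ContDiff ℝ ∞ (T.amp x ξ) := fun x ξ =>
    T.contDiff_amp.comp (f := fun y => (x, ξ, y)) (by fun_prop)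
  have hint : ∀ x ξ, ∀ j ≤ r, Integrable fun y => ‖iteratedFDeriv ℝ j (T.amp x ξ) y‖ :=
    fun x ξ j hj => (hi.const_mul _).mono'
      (((hc x ξ).continuous_iteratedFDeriv (by exact_mod_cast le_top)).norm.aestronglyMeasurable)
      (ae_of_all _ fun y => by rw [norm_norm]; exact hb x ξ y j hj)
  have hIb : ∀ x ξ, ∀ j ≤ r, ∫ y, ‖iteratedFDeriv ℝ j (T.amp x ξ) y‖ ≤ C * (1 + ‖x‖) ^ N * I₀ := by
    intro x ξ j hj
    rw [← integral_const_mul]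
    exact integral_mono (hint x ξ j hj) (hi.const_mul _) fun y => hb x ξ y j hj
  have hF : ∀ n ≤ r, ∃ K : ℝ, 0 ≤ K ∧ ∀ x ξ,
      ‖ξ‖ ^ n * ‖T.inner x ξ‖ ≤ K * (C * (1 + ‖x‖) ^ N * I₀) := by
    intro n hn
    refine ⟨(2 * Real.pi) ^ n * ((2 * Real.pi) ^ 0 * (2 * (0 : ℕ) + 2) ^ n *
      ∑ p ∈ Finset.range (0 + 1) ×ˢ Finset.range (n + 1), 1), by positivity, fun x ξ => ?_⟩
    have h3 := Real.pow_mul_norm_iteratedFDeriv_fourier_le (K := 0) (N := (n : ℕ∞))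
      (f := T.amp x ξ) ((hc x ξ).of_le (by exact_mod_cast le_top)) (fun a l ha hl => by
        have ha : a = 0 := by simpa using ha
        have hl : l ≤ n := by exact_mod_cast hl
        subst ha
        simpa using hint x ξ l (hl.trans hn))
      (k := 0) (n := n) (by simp) (by simp) ((2 * Real.pi)⁻¹ • ξ)
    rw [norm_iteratedFDeriv_zero, norm_smul, mul_pow, norm_inv, Real.norm_of_nonneg
      (by positivity : (0 : ℝ) ≤ 2 * Real.pi), inv_pow] at h3
    have h4 : ‖T.inner x ξ‖ = ‖𝓕 (T.amp x ξ) ((2 * Real.pi)⁻¹ • ξ)‖ := by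
      rw [inner_eq_fourier, norm_mul, mul_comm Complex.I, Complex.norm_exp_ofReal_mul_I, one_mul]
    rw [h4]
    have h5 : 0 < (2 * Real.pi) ^ n := by positivity
    calc _ = (2 * Real.pi) ^ n * (((2 * Real.pi) ^ n)⁻¹ * ‖ξ‖ ^ n *
          ‖𝓕 (T.amp x ξ) ((2 * Real.pi)⁻¹ • ξ)‖) := by field_simp
      _ ≤ _ := mul_le_mul_of_nonneg_left h3 h5.le
      _ ≤ _ := by
        rw [mul_assoc ((2 * Real.pi) ^ n), mul_assoc _ (∑ p ∈ _, 1), Finset.sum_mul]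
        refine mul_le_mul_of_nonneg_left (mul_le_mul_of_nonneg_left
          (Finset.sum_le_sum fun p hp => ?_) (by positivity)) h5.le
        rw [Finset.mem_product, Finset.mem_range, Finset.mem_range] at hp
        rw [show p.1 = 0 by omega, one_mul]
        simpa using hIb x ξ p.2 (by omega)
  obtain ⟨K, hK, h0⟩ := hF 0 (Nat.zero_le _)
  obtain ⟨K', hK', hr⟩ := hF r le_rfl
  refine ⟨2 ^ r * (K + K') * (C * I₀), by positivity, fun x ξ => ?_⟩
  refine norm_le_one_add_rpow_of_pow_mul_le (norm_nonneg _) ?_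
  have h1 : (1 + ‖ξ‖) ^ r ≤ 2 ^ r * (1 + ‖ξ‖ ^ r) := by
    refine (add_pow_le zero_le_one (norm_nonneg ξ) r).trans ?_
    rw [one_pow]
    gcongr
    · norm_num
    · omega
  have h0' := h0 x ξ
  rw [pow_zero, one_mul] at h0'
  calc _ ≤ 2 ^ r * (1 + ‖ξ‖ ^ r) * ‖T.inner x ξ‖ := by gcongr
    _ = 2 ^ r * (‖T.inner x ξ‖ + ‖ξ‖ ^ r * ‖T.inner x ξ‖) := by ring
    _ ≤ 2 ^ r * (K * (C * (1 + ‖x‖) ^ N * I₀) + K' * (C * (1 + ‖x‖) ^ N * I₀)) := by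
        exact mul_le_mul_of_nonneg_left (add_le_add h0' (hr x ξ)) (by positivity)
    _ = _ := by ring

end WeylData

end WeylOperator

section WeylOperator

open SchwartzMap FourierTransform

theorem EuclideanSpace.clm_eq_sum_proj {d : ℕ} (L : ConfSpace d →L[ℝ] ℂ) :
    L = ∑ j, (EuclideanSpace.proj j : ConfSpace d →L[ℝ] ℝ).smulRight
      (L (EuclideanSpace.single j 1)) := by
  apply ContinuousLinearMap.coe_injective
  refine (EuclideanSpace.basisFun (Fin d) ℝ).toBasis.ext fun k => ?_
  simp only [OrthonormalBasis.coe_toBasis, EuclideanSpace.basisFun_apply,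
    ContinuousLinearMap.coe_coe, sum_apply, ContinuousLinearMap.smulRight_apply]
  rw [Finset.sum_eq_single k (fun j _ hj => by simp [hj]) (fun h => absurd (Finset.mem_univ k) h)]
  simp

/-- Differentiation under the integral sign, in terms of partial derivatives. -/
theorem differentiableAt_integral_of_partials {d : ℕ} {α : Type*} [MeasurableSpace α]
    {μ : Measure α} {F : ConfSpace d → α → ℂ} {F' : Fin d → ConfSpace d → α → ℂ}
    {x₀ : ConfSpace d} {bound : α → ℝ} (hbound : Integrable bound μ)
    (hF : ∀ x, AEStronglyMeasurable (F x) μ) (hF₀ : Integrable (F x₀) μ)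
    (hF' : ∀ j, AEStronglyMeasurable (F' j x₀) μ)
    (hd : ∀ a x, DifferentiableAt ℝ (fun x => F x a) x)
    (hp : ∀ a x j, fderiv ℝ (fun x => F x a) x (EuclideanSpace.single j 1) = F' j x a)
    (hb : ∀ j a, ∀ x ∈ Metric.ball x₀ 1, ‖F' j x a‖ ≤ bound a) :
    DifferentiableAt ℝ (fun x => ∫ a, F x a ∂μ) x₀ ∧ ∀ j,
      fderiv ℝ (fun x => ∫ a, F x a ∂μ) x₀ (EuclideanSpace.single j 1) = ∫ a, F' j x₀ a ∂μ := by
  set D : ConfSpace d → α → (ConfSpace d →L[ℝ] ℂ) := fun x a =>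
    ∑ j, (EuclideanSpace.proj j : ConfSpace d →L[ℝ] ℝ).smulRight (F' j x a) with hD
  have hDf : ∀ a x, fderiv ℝ (fun x => F x a) x = D x a := by
    intro a x
    rw [EuclideanSpace.clm_eq_sum_proj (fderiv ℝ (fun x => F x a) x)]
    simp only [hp, hD]
  have hDm : AEStronglyMeasurable (D x₀) μ := by
    have : D x₀ = fun a => ∑ j, ContinuousLinearMap.smulRightL ℝ (ConfSpace d) ℂ
        (EuclideanSpace.proj j : ConfSpace d →L[ℝ] ℝ) (F' j x₀ a) := rfl
    rw [this]
    refine Finset.aestronglyMeasurable_fun_sum _ fun j _ => ?_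
    exact (ContinuousLinearMap.continuous _).comp_aestronglyMeasurable (hF' j)
  have hDb : ∀ a, ∀ x ∈ Metric.ball x₀ 1, ‖D x a‖ ≤
      (∑ j : Fin d, ‖(EuclideanSpace.proj j : ConfSpace d →L[ℝ] ℝ)‖) * bound a := by
    intro a x hx
    rw [Finset.sum_mul]
    refine (norm_sum_le _ _).trans (Finset.sum_le_sum fun j _ => ?_)
    rw [ContinuousLinearMap.norm_smulRight_apply]
    exact mul_le_mul_of_nonneg_left (hb j a x hx) (norm_nonneg _)
  have key := hasFDerivAt_integral_of_dominated_of_fderiv_le (μ := μ) (𝕜 := ℝ) (F := F) (F' := D)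
    (x₀ := x₀) (Metric.ball_mem_nhds x₀ one_pos) (Eventually.of_forall hF) hF₀ hDm
    (ae_of_all _ hDb) (hbound.const_mul _)
    (ae_of_all _ fun a x _ => hDf a x ▸ (hd a x).hasFDerivAt)
  refine ⟨key.differentiableAt, fun j => ?_⟩
  rw [key.fderiv, ContinuousLinearMap.integral_apply ((hbound.const_mul _).mono' hDm
    (ae_of_all _ fun a => hDb a x₀ (Metric.mem_ball_self one_pos)))]
  refine integral_congr_ae (ae_of_all _ fun a => ?_)
  simp only [← hDf, hp]

theorem integral_add₃ {α : Type*} [MeasurableSpace α] {μ : Measure α} {f g h : α → ℂ}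
    (hf : Integrable f μ) (hg : Integrable g μ) (hh : Integrable h μ) :
    ∫ a, f a + g a + h a ∂μ = ∫ a, f a ∂μ + ∫ a, g a ∂μ + ∫ a, h a ∂μ := by
  rw [← integral_add hf hg]
  exact integral_add (hf.add hg) hh

theorem IsHormander.fderiv_apply {d : ℕ} {φ : PhaseSpace d → ℂ} (h : IsHormander φ)
    (v : PhaseSpace d) : IsHormander fun X => fderiv ℝ φ X v := by
  have hc : ContDiff ℝ ∞ (fderiv ℝ φ) := h.1.fderiv_right (by simp)
  refine ⟨hc.clm_apply contDiff_const, fun k => ?_⟩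
  obtain ⟨C, hC⟩ := h.2 (k + 1)
  refine ⟨‖v‖ * C, fun X => ?_⟩
  refine (norm_iteratedFDeriv_clm_apply_const hc.contDiffAt (by exact_mod_cast le_top)).trans ?_
  rw [norm_iteratedFDeriv_fderiv]
  exact mul_le_mul_of_nonneg_left (hC X) (norm_nonneg v)

namespace WeylData

variable {d : ℕ} (T : WeylData d)

/-- The derivative of the amplitude along the diagonal. -/
def diffE (j : Fin d) : WeylData d where
  E p := fderiv ℝ T.E p (EuclideanSpace.single j 1, EuclideanSpace.single j 1)
  hE := (ContinuousLinearMap.apply ℝ ℂ ((EuclideanSpace.single j 1, EuclideanSpace.single j 1) :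
    ConfSpace d × ConfSpace d)).hasTemperateGrowth.comp T.hE.fderiv_of
  φ := T.φ
  hφ := T.hφ
  f := T.f

/-- The derivative of the symbol in the position variable. -/
def diffPos (j : Fin d) : WeylData d where
  E := T.E
  hE := T.hE
  φ X := fderiv ℝ T.φ X (EuclideanSpace.single j 1, 0)
  hφ := T.hφ.fderiv_apply _
  f := T.f

/-- The derivative of the symbol in the momentum variable. -/
def diffMom (j : Fin d) : WeylData d where
  E := T.E
  hE := T.hE
  φ X := fderiv ℝ T.φ X (0, EuclideanSpace.single j 1)
  hφ := T.hφ.fderiv_apply _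
  f := T.f

/-- The derivative of the Schwartz function. -/
def diffF (j : Fin d) : WeylData d where
  E := T.E
  hE := T.hE
  φ := T.φ
  hφ := T.hφ
  f := LineDeriv.lineDerivOp (EuclideanSpace.single j (1 : ℝ)) T.f

/-- The product of the Schwartz function with a coordinate. -/
def mulF (j : Fin d) : WeylData d where
  E := T.E
  hE := T.hE
  φ := T.φ
  hφ := T.hφ
  f := smulLeftCLM ℂ (fun y : ConfSpace d => ((y j : ℝ) : ℂ)) T.f

theorem amp_mulF (j : Fin d) (x ξ y : ConfSpace d) :
    (T.mulF j).amp x ξ y = y j * T.amp x ξ y := by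
  have h : (fun y : ConfSpace d => ((y j : ℝ) : ℂ)).HasTemperateGrowth :=
    (Complex.ofRealCLM ∘L (EuclideanSpace.proj j : ConfSpace d →L[ℝ] ℝ)).hasTemperateGrowth
  simp only [amp, mulF, smulLeftCLM_apply_apply h, smul_eq_mul]
  ring

theorem inner_eq_integral_sub (x ξ : ConfSpace d) :
    T.inner x ξ = ∫ v, Complex.exp (Complex.I * ((⟪ξ, v⟫_ℝ : ℝ) : ℂ)) * T.amp x ξ (x - v) := by
  rw [inner, ← integral_sub_left_eq_self _ volume x]
  simp only [sub_sub_cancel]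

theorem continuous_integrand : Continuous fun p : ConfSpace d × ConfSpace d × ConfSpace d =>
    Complex.exp (Complex.I * ((⟪p.2.1, p.1 - p.2.2⟫_ℝ : ℝ) : ℂ)) * T.amp p.1 p.2.1 p.2.2 := by
  have := T.contDiff_amp.continuous
  fun_prop

theorem stronglyMeasurable_inner : StronglyMeasurable fun p : ConfSpace d × ConfSpace d =>
    T.inner p.1 p.2 := by
  have h : StronglyMeasurable fun q : (ConfSpace d × ConfSpace d) × ConfSpace d =>
      Complex.exp (Complex.I * ((⟪q.1.2, q.1.1 - q.2⟫_ℝ : ℝ) : ℂ)) * T.amp q.1.1 q.1.2 q.2 :=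
    (T.continuous_integrand.comp (g := fun p : ConfSpace d × ConfSpace d × ConfSpace d =>
      Complex.exp (Complex.I * ((⟪p.2.1, p.1 - p.2.2⟫_ℝ : ℝ) : ℂ)) * T.amp p.1 p.2.1 p.2.2)
      (f := fun q : (ConfSpace d × ConfSpace d) × ConfSpace d => (q.1.1, q.1.2, q.2))
      (by fun_prop)).stronglyMeasurable
  exact h.integral_prod_right

theorem stronglyMeasurable_inner_right (x : ConfSpace d) : StronglyMeasurable (T.inner x) :=
  (T.stronglyMeasurable_inner.comp_measurable (g := fun ξ => (x, ξ))
    (by fun_prop) : StronglyMeasurable fun ξ => T.inner x ξ)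

theorem norm_cexp_I_mul (t : ℝ) (z : ℂ) : ‖Complex.exp (Complex.I * (t : ℂ)) * z‖ = ‖z‖ := by
  rw [norm_mul, mul_comm Complex.I, Complex.norm_exp_ofReal_mul_I, one_mul]

theorem integrable_integrand (x ξ : ConfSpace d) : Integrable fun y =>
    Complex.exp (Complex.I * ((⟪ξ, x - y⟫_ℝ : ℝ) : ℂ)) * T.amp x ξ y := by
  obtain ⟨N, h⟩ := exists_amp_le T.hE 0
  obtain ⟨C, hC, h⟩ := h T rfl (volume : Measure (ConfSpace d)).integrablePower
  refine ((Measure.integrable_pow_neg_integrablePower (volume : Measure (ConfSpace d))).const_mul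
    (C * (1 + ‖x‖) ^ N)).mono' (T.continuous_integrand.comp (f := fun y => (x, ξ, y))
      (by fun_prop)).aestronglyMeasurable (ae_of_all _ fun y => ?_)
  rw [norm_cexp_I_mul]
  simpa using h x ξ y 0 le_rfl

theorem integrable_inner (x : ConfSpace d) : Integrable (T.inner x) := by
  obtain ⟨N, h⟩ := exists_inner_bound T.hE (volume : Measure (ConfSpace d)).integrablePower
  obtain ⟨C, hC, h⟩ := h T rfl
  exact ((Measure.integrable_pow_neg_integrablePower (volume : Measure (ConfSpace d))).const_mul
    _).mono' (T.stronglyMeasurable_inner_right x).aestronglyMeasurable (ae_of_all _ (h x))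

theorem exists_op_bound {E : ConfSpace d × ConfSpace d → ℂ} (hE : E.HasTemperateGrowth) :
    ∃ N : ℕ, ∀ T : WeylData d, T.E = E → ∃ C : ℝ, 0 ≤ C ∧ ∀ x, ‖T.op x‖ ≤ C * (1 + ‖x‖) ^ N := by
  set m := (volume : Measure (ConfSpace d)).integrablePower
  have hi := Measure.integrable_pow_neg_integrablePower (volume : Measure (ConfSpace d))
  obtain ⟨N, h⟩ := exists_inner_bound hE m
  refine ⟨N, fun T hT => ?_⟩
  obtain ⟨C, hC, h⟩ := h T hT
  refine ⟨C * ∫ ξ : ConfSpace d, (1 + ‖ξ‖) ^ (-(m : ℝ)),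
    mul_nonneg hC (integral_nonneg fun ξ => by positivity), fun x => ?_⟩
  refine (norm_integral_le_integral_norm _).trans ?_
  calc _ ≤ ∫ ξ : ConfSpace d, C * (1 + ‖x‖) ^ N * (1 + ‖ξ‖) ^ (-(m : ℝ)) :=
        integral_mono (T.integrable_inner x).norm (hi.const_mul _) (h x)
    _ = _ := by rw [integral_const_mul]; ring

/-- Differentiating the integrand, in the variables `x` and `v = x - y`. -/
theorem hasFDeriv_amp_sub (ξ v x : ConfSpace d) :
    DifferentiableAt ℝ (fun x => T.amp x ξ (x - v)) x ∧ ∀ j,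
      fderiv ℝ (fun x => T.amp x ξ (x - v)) x (EuclideanSpace.single j 1) =
        (T.diffE j).amp x ξ (x - v) + (T.diffPos j).amp x ξ (x - v) +
          (T.diffF j).amp x ξ (x - v) := by
  have hE : HasFDerivAt (fun x => T.E (x, x - v)) ((fderiv ℝ T.E (x, x - v)) ∘L
      ((ContinuousLinearMap.id ℝ (ConfSpace d)).prod (ContinuousLinearMap.id ℝ (ConfSpace d)))) x :=
    HasFDerivAt.comp x ((T.hE.1.differentiable (by simp)) _).hasFDerivAt
      ((hasFDerivAt_id x).prodMk ((hasFDerivAt_id x).sub_const v))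
  have hφ' : HasFDerivAt (fun x => ((1 / 2 : ℝ) • (x + (x - v)), ξ))
      (ContinuousLinearMap.inl ℝ (ConfSpace d) (ConfSpace d)) x := by
    have h1 : (fun x => ((1 / 2 : ℝ) • (x + (x - v)), ξ)) =
        fun x => ContinuousLinearMap.inl ℝ (ConfSpace d) (ConfSpace d) x +
          (-(1 / 2 : ℝ) • v, ξ) := by
      funext x
      simp only [ContinuousLinearMap.inl_apply, Prod.mk_add_mk, zero_add]
      congr 1
      module
    rw [h1]
    exact (ContinuousLinearMap.hasFDerivAt _).add_const _
  have hφ : HasFDerivAt (fun x => T.φ ((1 / 2 : ℝ) • (x + (x - v)), ξ))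
      ((fderiv ℝ T.φ ((1 / 2 : ℝ) • (x + (x - v)), ξ)) ∘L
        ContinuousLinearMap.inl ℝ (ConfSpace d) (ConfSpace d)) x :=
    HasFDerivAt.comp x ((T.hφ.1.differentiable (by simp)) _).hasFDerivAt hφ'
  have hf : HasFDerivAt (fun x => T.f (x - v)) ((fderiv ℝ T.f (x - v)) ∘L
      (ContinuousLinearMap.id ℝ (ConfSpace d))) x :=
    HasFDerivAt.comp x (T.f.differentiableAt).hasFDerivAt ((hasFDerivAt_id x).sub_const v)
  have key := (hE.mul hφ).mul hf
  refine ⟨key.differentiableAt, fun j => ?_⟩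
  refine (congrArg (fun L => L (EuclideanSpace.single j (1 : ℝ))) key.fderiv).trans ?_
  simp only [amp, diffE, diffPos, diffF, lineDerivOp_apply_eq_fderiv, add_apply, smul_apply,
    ContinuousLinearMap.comp_apply, ContinuousLinearMap.prod_apply, ContinuousLinearMap.id_apply,
    ContinuousLinearMap.inl_apply, smul_eq_mul, Pi.mul_apply]
  ring

theorem exists_amp_sub_bound (x₀ : ConfSpace d) (m : ℕ) : ∃ C : ℝ, 0 ≤ C ∧
    ∀ x ∈ Metric.ball x₀ 1, ∀ ξ v, ‖T.amp x ξ (x - v)‖ ≤ C * (1 + ‖x₀ - v‖) ^ (-(m : ℝ)) := by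
  obtain ⟨N, h⟩ := exists_amp_bound T.hE 0
  obtain ⟨C, hC, h⟩ := h T rfl m
  refine ⟨2 ^ m * (C * (2 + ‖x₀‖) ^ N), by positivity, fun x hx ξ v => ?_⟩
  refine norm_le_one_add_rpow_of_pow_mul_le (norm_nonneg _) ?_
  have h0 := h x ξ (x - v) 0 le_rfl
  rw [norm_iteratedFDeriv_zero] at h0
  rw [Metric.mem_ball, dist_eq_norm] at hx
  have h1 : 1 + ‖x₀ - v‖ ≤ 2 * (1 + ‖x - v‖) := by
    have := norm_sub_le (x - v) (x - x₀)
    rw [show (x - v) - (x - x₀) = x₀ - v by abel] at this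
    linarith [norm_nonneg (x - v)]
  have h2 : 1 + ‖x‖ ≤ 2 + ‖x₀‖ := by
    have := norm_add_le (x - x₀) x₀
    rw [sub_add_cancel] at this
    linarith
  calc _ ≤ (2 * (1 + ‖x - v‖)) ^ m * ‖T.amp x ξ (x - v)‖ := by gcongr
    _ = 2 ^ m * ((1 + ‖x - v‖) ^ m * ‖T.amp x ξ (x - v)‖) := by rw [mul_pow]; ring
    _ ≤ 2 ^ m * (C * (1 + ‖x‖) ^ N) := by gcongr
    _ ≤ _ := by gcongr

theorem differentiableAt_inner (x ξ : ConfSpace d) :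
    DifferentiableAt ℝ (fun x => T.inner x ξ) x ∧ ∀ j,
      fderiv ℝ (fun x => T.inner x ξ) x (EuclideanSpace.single j 1) =
        (T.diffE j).inner x ξ + (T.diffPos j).inner x ξ + (T.diffF j).inner x ξ := by
  set m := (volume : Measure (ConfSpace d)).integrablePower
  have hi : Integrable fun v : ConfSpace d => (1 + ‖x - v‖) ^ (-(m : ℝ)) :=
    (Measure.integrable_pow_neg_integrablePower (volume : Measure (ConfSpace d))).comp_sub_left x
  have hc : ∀ (T : WeylData d) x, Continuous fun v =>
      Complex.exp (Complex.I * ((⟪ξ, v⟫_ℝ : ℝ) : ℂ)) * T.amp x ξ (x - v) := fun T x => by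
    have h := T.contDiff_amp.continuous.comp (f := fun v => (x, ξ, x - v)) (by fun_prop)
    exact (by fun_prop : Continuous fun v : ConfSpace d =>
      Complex.exp (Complex.I * ((⟪ξ, v⟫_ℝ : ℝ) : ℂ))).mul h
  have hint : ∀ T : WeylData d, Integrable fun v =>
      Complex.exp (Complex.I * ((⟪ξ, v⟫_ℝ : ℝ) : ℂ)) * T.amp x ξ (x - v) := fun T => by
    simpa only [sub_sub_cancel] using (T.integrable_integrand x ξ).comp_sub_left x
  choose C1 hC1 hb1 using fun j => (T.diffE j).exists_amp_sub_bound x m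
  choose C2 hC2 hb2 using fun j => (T.diffPos j).exists_amp_sub_bound x m
  choose C3 hC3 hb3 using fun j => (T.diffF j).exists_amp_sub_bound x m
  have key := differentiableAt_integral_of_partials (μ := volume) (x₀ := x)
    (F := fun x v => Complex.exp (Complex.I * ((⟪ξ, v⟫_ℝ : ℝ) : ℂ)) * T.amp x ξ (x - v))
    (F' := fun j x v => Complex.exp (Complex.I * ((⟪ξ, v⟫_ℝ : ℝ) : ℂ)) *
      (T.diffE j).amp x ξ (x - v) + Complex.exp (Complex.I * ((⟪ξ, v⟫_ℝ : ℝ) : ℂ)) *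
      (T.diffPos j).amp x ξ (x - v) + Complex.exp (Complex.I * ((⟪ξ, v⟫_ℝ : ℝ) : ℂ)) *
      (T.diffF j).amp x ξ (x - v))
    (hi.const_mul (∑ j, (C1 j + C2 j + C3 j))) (fun x => (hc T x).aestronglyMeasurable) (hint T)
    (fun j => (((hc _ x).add (hc _ x)).add (hc _ x)).aestronglyMeasurable)
    (fun v x => (T.hasFDeriv_amp_sub ξ v x).1.const_mul _)
    (fun v x j => by
      rw [fderiv_const_mul (T.hasFDeriv_amp_sub ξ v x).1, smul_apply,
        (T.hasFDeriv_amp_sub ξ v x).2 j, smul_eq_mul, mul_add, mul_add])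
    (fun j v y hy => by
      refine (norm_add₃_le).trans ?_
      simp only [norm_cexp_I_mul]
      calc _ ≤ (C1 j + C2 j + C3 j) * (1 + ‖x - v‖) ^ (-(m : ℝ)) := by
            rw [add_mul, add_mul]
            exact add_le_add (add_le_add (hb1 j y hy ξ v) (hb2 j y hy ξ v)) (hb3 j y hy ξ v)
        _ ≤ _ := by
            refine mul_le_mul_of_nonneg_right ?_ (by positivity)
            exact Finset.single_le_sum (f := fun j => C1 j + C2 j + C3 j)
              (fun j _ => add_nonneg (add_nonneg (hC1 j) (hC2 j)) (hC3 j)) (Finset.mem_univ j))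
  have hfun : (fun x => T.inner x ξ) = fun x => ∫ v,
      Complex.exp (Complex.I * ((⟪ξ, v⟫_ℝ : ℝ) : ℂ)) * T.amp x ξ (x - v) :=
    funext fun x => T.inner_eq_integral_sub x ξ
  rw [hfun]
  refine ⟨key.1, fun j => (key.2 j).trans ?_⟩
  rw [integral_add₃ (hint _) (hint _) (hint _)]
  simp only [inner_eq_integral_sub]

theorem exists_inner_bound_ball (x : ConfSpace d) (m : ℕ) : ∃ C : ℝ, 0 ≤ C ∧
    ∀ y ∈ Metric.ball x 1, ∀ ξ, ‖T.inner y ξ‖ ≤ C * (1 + ‖ξ‖) ^ (-(m : ℝ)) := by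
  obtain ⟨N, h⟩ := exists_inner_bound T.hE m
  obtain ⟨C, hC, h⟩ := h T rfl
  refine ⟨C * (2 + ‖x‖) ^ N, by positivity, fun y hy ξ => (h y ξ).trans ?_⟩
  have h2 : 1 + ‖y‖ ≤ 2 + ‖x‖ := by
    rw [Metric.mem_ball, dist_eq_norm] at hy
    have := norm_add_le (y - x) x
    rw [sub_add_cancel] at this
    linarith
  gcongr

theorem differentiableAt_op (x : ConfSpace d) :
    DifferentiableAt ℝ T.op x ∧ ∀ j, fderiv ℝ T.op x (EuclideanSpace.single j 1) =
      (T.diffE j).op x + (T.diffPos j).op x + (T.diffF j).op x := by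
  set m := (volume : Measure (ConfSpace d)).integrablePower
  have hi := Measure.integrable_pow_neg_integrablePower (volume : Measure (ConfSpace d))
  choose C hC hb using fun T : WeylData d => T.exists_inner_bound_ball x m
  have hm : ∀ (T : WeylData d) x, StronglyMeasurable (T.inner x) :=
    stronglyMeasurable_inner_right
  have hF : ∀ j, AEStronglyMeasurable (fun ξ => (T.diffE j).inner x ξ + (T.diffPos j).inner x ξ +
      (T.diffF j).inner x ξ) := fun j => (((hm _ x).add (hm _ x)).add (hm _ x)).aestronglyMeasurable
  have hbb : ∀ j ξ, ∀ y ∈ Metric.ball x 1,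
      ‖(T.diffE j).inner y ξ + (T.diffPos j).inner y ξ + (T.diffF j).inner y ξ‖ ≤
        (∑ j, (C (T.diffE j) + C (T.diffPos j) + C (T.diffF j))) * (1 + ‖ξ‖) ^ (-(m : ℝ)) := by
    intro j ξ y hy
    refine (norm_add₃_le).trans ?_
    calc _ ≤ (C (T.diffE j) + C (T.diffPos j) + C (T.diffF j)) * (1 + ‖ξ‖) ^ (-(m : ℝ)) := by
          rw [add_mul, add_mul]
          exact add_le_add (add_le_add (hb _ y hy ξ) (hb _ y hy ξ)) (hb _ y hy ξ)
      _ ≤ _ := by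
          refine mul_le_mul_of_nonneg_right ?_ (by positivity)
          exact Finset.single_le_sum
            (f := fun j => C (T.diffE j) + C (T.diffPos j) + C (T.diffF j))
            (fun j _ => add_nonneg (add_nonneg (hC _) (hC _)) (hC _)) (Finset.mem_univ j)
  have key := differentiableAt_integral_of_partials (μ := volume) (x₀ := x)
    (F := T.inner) (F' := fun j x ξ => (T.diffE j).inner x ξ + (T.diffPos j).inner x ξ +
      (T.diffF j).inner x ξ)
    (hi.const_mul (∑ j, (C (T.diffE j) + C (T.diffPos j) + C (T.diffF j))))
    (fun x => (hm T x).aestronglyMeasurable) (T.integrable_inner x) hF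
    (fun ξ x => (T.differentiableAt_inner x ξ).1) (fun ξ x j => (T.differentiableAt_inner x ξ).2 j)
    hbb
  exact ⟨key.1, fun j => (key.2 j).trans
    (integral_add₃ (integrable_inner _ x) (integrable_inner _ x) (integrable_inner _ x))⟩

end WeylData

end WeylOperator

section WeylOperator

open SchwartzMap FourierTransform

namespace WeylData

variable {d : ℕ} (T : WeylData d)

theorem hasFDerivAt_cexp_inner (w ξ : ConfSpace d) :
    HasFDerivAt (fun ξ : ConfSpace d => Complex.exp (Complex.I * ((⟪ξ, w⟫_ℝ : ℝ) : ℂ)))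
      (Complex.exp (Complex.I * ((⟪ξ, w⟫_ℝ : ℝ) : ℂ)) • Complex.I •
        (Complex.ofRealCLM ∘L (innerSL ℝ w))) ξ := by
  have h : HasFDerivAt (fun ξ : ConfSpace d => ((⟪ξ, w⟫_ℝ : ℝ) : ℂ))
      (Complex.ofRealCLM ∘L (innerSL ℝ w)) ξ := by
    have := (Complex.ofRealCLM ∘L (innerSL ℝ w)).hasFDerivAt (x := ξ)
    refine this.congr_of_eventuallyEq (Eventually.of_forall fun ξ => ?_)
    simp [real_inner_comm]
  exact (h.const_mul Complex.I).cexp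

/-- Differentiating the integrand in the momentum variable. -/
theorem hasFDeriv_integrand_mom (x y ξ : ConfSpace d) :
    DifferentiableAt ℝ (fun ξ => Complex.exp (Complex.I * ((⟪ξ, x - y⟫_ℝ : ℝ) : ℂ)) *
      T.amp x ξ y) ξ ∧ ∀ j,
    fderiv ℝ (fun ξ => Complex.exp (Complex.I * ((⟪ξ, x - y⟫_ℝ : ℝ) : ℂ)) * T.amp x ξ y) ξ
        (EuclideanSpace.single j 1) =
      Complex.I * x j * (Complex.exp (Complex.I * ((⟪ξ, x - y⟫_ℝ : ℝ) : ℂ)) * T.amp x ξ y) +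
      -Complex.I * (Complex.exp (Complex.I * ((⟪ξ, x - y⟫_ℝ : ℝ) : ℂ)) * (T.mulF j).amp x ξ y) +
      Complex.exp (Complex.I * ((⟪ξ, x - y⟫_ℝ : ℝ) : ℂ)) * (T.diffMom j).amp x ξ y := by
  have hφ' : HasFDerivAt (fun ξ : ConfSpace d => ((1 / 2 : ℝ) • (x + y), ξ))
      (ContinuousLinearMap.inr ℝ (ConfSpace d) (ConfSpace d)) ξ :=
    hasFDerivAt_prodMk_right _ _
  have hφ : HasFDerivAt (fun ξ => T.φ ((1 / 2 : ℝ) • (x + y), ξ))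
      ((fderiv ℝ T.φ ((1 / 2 : ℝ) • (x + y), ξ)) ∘L
        ContinuousLinearMap.inr ℝ (ConfSpace d) (ConfSpace d)) ξ :=
    HasFDerivAt.comp ξ ((T.hφ.1.differentiable (by simp)) _).hasFDerivAt hφ'
  have key := (hasFDerivAt_cexp_inner (x - y) ξ).mul
    ((hφ.const_mul (T.E (x, y))).mul_const (T.f y))
  refine ⟨key.differentiableAt, fun j => ?_⟩
  refine (congrArg (fun L => L (EuclideanSpace.single j (1 : ℝ))) key.fderiv).trans ?_
  rw [amp_mulF]
  simp only [amp, diffMom, add_apply, smul_apply, ContinuousLinearMap.comp_apply,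
    ContinuousLinearMap.inr_apply, smul_eq_mul, innerSL_apply_apply, Complex.ofRealCLM_apply]
  have : ⟪x - y, EuclideanSpace.single j (1 : ℝ)⟫_ℝ = x j - y j := by
    simp [EuclideanSpace.inner_single_right]
  rw [this]
  push_cast
  ring

theorem hasFDeriv_inner_mom (x ξ : ConfSpace d) :
    DifferentiableAt ℝ (T.inner x) ξ ∧ ∀ j, fderiv ℝ (T.inner x) ξ (EuclideanSpace.single j 1) =
      Complex.I * x j * T.inner x ξ + -Complex.I * (T.mulF j).inner x ξ +
        (T.diffMom j).inner x ξ := by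
  set m := (volume : Measure (ConfSpace d)).integrablePower
  have hi := Measure.integrable_pow_neg_integrablePower (volume : Measure (ConfSpace d))
  have hc : ∀ (T : WeylData d) (ξ : ConfSpace d), Continuous fun y =>
      Complex.exp (Complex.I * ((⟪ξ, x - y⟫_ℝ : ℝ) : ℂ)) * T.amp x ξ y := fun T ξ =>
    T.continuous_integrand.comp (f := fun y => (x, ξ, y)) (by fun_prop)
  have hb : ∀ T : WeylData d, ∃ C : ℝ, 0 ≤ C ∧ ∀ ξ y,
      ‖T.amp x ξ y‖ ≤ C * (1 + ‖y‖) ^ (-(m : ℝ)) := by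
    intro T
    obtain ⟨N, h⟩ := exists_amp_le T.hE 0
    obtain ⟨C, hC, h⟩ := h T rfl m
    exact ⟨C * (1 + ‖x‖) ^ N, by positivity, fun ξ y => by simpa using h x ξ y 0 le_rfl⟩
  choose C hC hb using hb
  have hbb : ∀ (j : Fin d) (y : ConfSpace d), ∀ ζ ∈ Metric.ball ξ 1,
      ‖Complex.I * x j * (Complex.exp (Complex.I * ((⟪ζ, x - y⟫_ℝ : ℝ) : ℂ)) * T.amp x ζ y) +
      -Complex.I * (Complex.exp (Complex.I * ((⟪ζ, x - y⟫_ℝ : ℝ) : ℂ)) * (T.mulF j).amp x ζ y) +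
      Complex.exp (Complex.I * ((⟪ζ, x - y⟫_ℝ : ℝ) : ℂ)) * (T.diffMom j).amp x ζ y‖ ≤
        (∑ j, (‖x j‖ * C T + C (T.mulF j) + C (T.diffMom j))) * (1 + ‖y‖) ^ (-(m : ℝ)) := by
    intro j y ζ _
    refine (norm_add₃_le).trans ?_
    rw [norm_mul (Complex.I * x j), norm_mul (-Complex.I)]
    simp only [norm_cexp_I_mul]
    simp only [norm_mul, norm_neg, Complex.norm_I, one_mul, Complex.norm_real]
    calc _ ≤ (‖x j‖ * C T + C (T.mulF j) + C (T.diffMom j)) * (1 + ‖y‖) ^ (-(m : ℝ)) := by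
          rw [add_mul, add_mul, mul_assoc]
          exact add_le_add (add_le_add (mul_le_mul_of_nonneg_left (hb _ ζ y) (norm_nonneg _))
            (hb _ ζ y)) (hb _ ζ y)
      _ ≤ _ := by
          refine mul_le_mul_of_nonneg_right ?_ (by positivity)
          exact Finset.single_le_sum
            (f := fun j => ‖x j‖ * C T + C (T.mulF j) + C (T.diffMom j))
            (fun j _ => add_nonneg (add_nonneg (mul_nonneg (norm_nonneg _) (hC _)) (hC _)) (hC _))
            (Finset.mem_univ j)
  have key := differentiableAt_integral_of_partials (μ := volume) (x₀ := ξ)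
    (F := fun ξ y => Complex.exp (Complex.I * ((⟪ξ, x - y⟫_ℝ : ℝ) : ℂ)) * T.amp x ξ y)
    (F' := fun j ξ y =>
      Complex.I * x j * (Complex.exp (Complex.I * ((⟪ξ, x - y⟫_ℝ : ℝ) : ℂ)) * T.amp x ξ y) +
      -Complex.I * (Complex.exp (Complex.I * ((⟪ξ, x - y⟫_ℝ : ℝ) : ℂ)) * (T.mulF j).amp x ξ y) +
      Complex.exp (Complex.I * ((⟪ξ, x - y⟫_ℝ : ℝ) : ℂ)) * (T.diffMom j).amp x ξ y)
    (hi.const_mul (∑ j, (‖x j‖ * C T + C (T.mulF j) + C (T.diffMom j))))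
    (fun ξ => (hc T ξ).aestronglyMeasurable) (T.integrable_integrand x ξ)
    (fun j => (((continuous_const.mul (hc _ ξ)).add (continuous_const.mul (hc _ ξ))).add
      (hc _ ξ)).aestronglyMeasurable)
    (fun y ξ => (T.hasFDeriv_integrand_mom x y ξ).1)
    (fun y ξ j => (T.hasFDeriv_integrand_mom x y ξ).2 j) hbb
  refine ⟨key.1, fun j => (key.2 j).trans ?_⟩
  rw [integral_add₃ ((integrable_integrand _ x ξ).const_mul _)
    ((integrable_integrand _ x ξ).const_mul _) (integrable_integrand _ x ξ),
    integral_const_mul, integral_const_mul]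
  rfl

theorem integral_fderiv_apply_eq_zero {g : ConfSpace d → ℂ} (hg : Integrable g)
    (hd : Differentiable ℝ g) (v : ConfSpace d) (hg' : Integrable fun x => fderiv ℝ g x v) :
    ∫ x, fderiv ℝ g x v = 0 := by
  have := integral_smul_fderiv_eq_neg_fderiv_smul_of_integrable (μ := (volume : Measure
    (ConfSpace d))) (𝕜 := ℝ) (f := fun _ => (1 : ℝ)) (g := g) (v := v) (by simp)
    (by simpa using hg') (by simpa using hg) (fun x _ => by fun_prop) (fun x _ => hd x)
  simpa using this

/-- Integration by parts in the momentum variable. -/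
theorem coord_mul_op (j : Fin d) (x : ConfSpace d) :
    (x j : ℂ) * T.op x = (T.mulF j).op x + Complex.I * (T.diffMom j).op x := by
  have h1 : Integrable fun ξ => Complex.I * x j * T.inner x ξ := (T.integrable_inner x).const_mul _
  have h2 : Integrable fun ξ => -Complex.I * (T.mulF j).inner x ξ :=
    ((T.mulF j).integrable_inner x).const_mul _
  have h3 := (T.diffMom j).integrable_inner x
  have h := integral_fderiv_apply_eq_zero (T.integrable_inner x)
    (fun ξ => (T.hasFDeriv_inner_mom x ξ).1) (EuclideanSpace.single j 1) (by
      simp only [(T.hasFDeriv_inner_mom x _).2 j]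
      exact (h1.add h2).add h3)
  simp only [(T.hasFDeriv_inner_mom x _).2 j] at h
  rw [integral_add₃ h1 h2 h3, integral_const_mul, integral_const_mul] at h
  change Complex.I * x j * T.op x + -Complex.I * (T.mulF j).op x + (T.diffMom j).op x = 0 at h
  have hI := Complex.I_mul_I
  linear_combination (-Complex.I) * h + ((x j : ℂ) * T.op x - (T.mulF j).op x) * hI

theorem norm_le_sum_norm_coord (x : ConfSpace d) : ‖x‖ ≤ ∑ j, ‖x j‖ := by
  conv_lhs => rw [← (EuclideanSpace.basisFun (Fin d) ℝ).sum_repr x]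
  refine (norm_sum_le _ _).trans (Finset.sum_le_sum fun j _ => ?_)
  rw [norm_smul]
  simp

/-- The oscillatory integral decays rapidly up to a factor of growth `N`; as `N` depends on `E` only,
the factor can be absorbed into the decay. -/
theorem exists_pow_mul_op_bound {E : ConfSpace d × ConfSpace d → ℂ} (hE : E.HasTemperateGrowth) :
    ∃ N : ℕ, ∀ (k : ℕ) (T : WeylData d), T.E = E → ∃ C : ℝ, 0 ≤ C ∧
      ∀ x, ‖x‖ ^ k * ‖T.op x‖ ≤ C * (1 + ‖x‖) ^ N := by
  obtain ⟨N, h⟩ := exists_op_bound hE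
  refine ⟨N, fun k => ?_⟩
  induction k with
  | zero => simpa using h
  | succ k ih =>
    intro T hT
    choose C1 hC1 h1 using fun j => ih (T.mulF j) hT
    choose C2 hC2 h2 using fun j => ih (T.diffMom j) hT
    refine ⟨∑ j, (C1 j + C2 j), Finset.sum_nonneg fun j _ => add_nonneg (hC1 j) (hC2 j),
      fun x => ?_⟩
    calc ‖x‖ ^ (k + 1) * ‖T.op x‖ ≤ ‖x‖ ^ k * (∑ j, ‖x j‖) * ‖T.op x‖ := by
          rw [pow_succ]
          gcongr
          exact norm_le_sum_norm_coord x
      _ = ∑ j, ‖x‖ ^ k * ‖(x j : ℂ) * T.op x‖ := by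
          rw [Finset.mul_sum, Finset.sum_mul]
          refine Finset.sum_congr rfl fun j _ => ?_
          rw [norm_mul, Complex.norm_real, mul_assoc]
      _ ≤ ∑ j, (C1 j + C2 j) * (1 + ‖x‖) ^ N := by
          refine Finset.sum_le_sum fun j _ => ?_
          rw [coord_mul_op]
          calc _ ≤ ‖x‖ ^ k * (‖(T.mulF j).op x‖ + ‖(T.diffMom j).op x‖) := by
                gcongr
                refine (norm_add_le _ _).trans ?_
                rw [norm_mul, Complex.norm_I, one_mul]
            _ ≤ _ := by
                rw [mul_add, add_mul]
                exact add_le_add (h1 j x) (h2 j x)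
      _ = _ := by rw [Finset.sum_mul]

theorem exists_pow_mul_op_le (k : ℕ) : ∃ C : ℝ, ∀ x, ‖x‖ ^ k * ‖T.op x‖ ≤ C := by
  obtain ⟨N, h⟩ := exists_pow_mul_op_bound T.hE
  obtain ⟨C0, hC0, h0⟩ := h k T rfl
  obtain ⟨C1, hC1, h1⟩ := h (k + N) T rfl
  refine ⟨(C0 + C1) * 2 ^ N, fun x => ?_⟩
  rcases le_total ‖x‖ 1 with hx | hx
  · refine (h0 x).trans ?_
    gcongr
    · linarith
    · linarith
  · have hx' : 0 < ‖x‖ ^ N := by positivity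
    refine le_of_mul_le_mul_right ?_ hx'
    calc _ = ‖x‖ ^ (k + N) * ‖T.op x‖ := by rw [pow_add]; ring
      _ ≤ C1 * (1 + ‖x‖) ^ N := h1 x
      _ ≤ C1 * (2 * ‖x‖) ^ N := by gcongr; linarith
      _ ≤ (C0 + C1) * (2 * ‖x‖) ^ N := by gcongr; linarith
      _ = _ := by rw [mul_pow]; ring

/-- A finite sum of oscillatory integrals. -/
def opSum (l : List (WeylData d)) (x : ConfSpace d) : ℂ := (l.map fun T => T.op x).sum

theorem opSum_cons (l : List (WeylData d)) : opSum (T :: l) = fun x => T.op x + opSum l x := by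
  funext x
  simp [opSum]

/-- The terms of the partial derivative of a finite sum of oscillatory integrals. -/
def diffList (j : Fin d) (l : List (WeylData d)) : List (WeylData d) :=
  l.flatMap fun T => [T.diffE j, T.diffPos j, T.diffF j]

theorem differentiable_opSum (l : List (WeylData d)) (x : ConfSpace d) :
    DifferentiableAt ℝ (opSum l) x ∧ ∀ j,
      fderiv ℝ (opSum l) x (EuclideanSpace.single j 1) = opSum (diffList j l) x := by
  induction l with
  | nil =>
    have : opSum ([] : List (WeylData d)) = fun _ => 0 := by funext x; simp [opSum]
    exact ⟨by rw [this]; fun_prop, fun j => by rw [this]; simp [opSum, diffList]⟩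
  | cons T l ih =>
    rw [opSum_cons]
    refine ⟨(T.differentiableAt_op x).1.add ih.1, fun j => ?_⟩
    rw [fderiv_fun_add (T.differentiableAt_op x).1 ih.1, add_apply,
      (T.differentiableAt_op x).2 j, ih.2 j]
    simp [opSum, diffList]
    ring

theorem exists_pow_mul_opSum_le (k : ℕ) (l : List (WeylData d)) :
    ∃ C : ℝ, ∀ x, ‖x‖ ^ k * ‖opSum l x‖ ≤ C := by
  induction l with
  | nil => exact ⟨0, fun x => by simp [opSum]⟩
  | cons T l ih =>
    obtain ⟨C, h⟩ := ih
    obtain ⟨C', h'⟩ := T.exists_pow_mul_op_le k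
    refine ⟨C' + C, fun x => ?_⟩
    rw [opSum_cons]
    refine (mul_le_mul_of_nonneg_left (norm_add_le _ _) (by positivity)).trans ?_
    rw [mul_add]
    exact add_le_add (h' x) (h x)

theorem contDiff_and_decay_op (n : ℕ) : ContDiff ℝ n T.op ∧
    ∀ k : ℕ, ∃ C : ℝ, ∀ x, ‖x‖ ^ k * ‖iteratedFDeriv ℝ n T.op x‖ ≤ C := by
  have h := contDiff_and_bound_of_partial_derivs (EuclideanSpace.basisFun (Fin d) ℝ).toBasis
    opSum diffList (fun l x => (differentiable_opSum l x).1)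
    (fun l j x => by
      rw [OrthonormalBasis.coe_toBasis, EuclideanSpace.basisFun_apply]
      exact (differentiable_opSum l x).2 j) n
  have hT : opSum [T] = T.op := by funext x; simp [opSum]
  refine ⟨hT ▸ h.1 [T], fun k => ?_⟩
  choose β hβ using exists_pow_mul_opSum_le (d := d) k
  obtain ⟨β', -, hβ'⟩ := h.2 (fun x => ‖x‖ ^ k) (fun x => by positivity) (fun _ => True)
    (fun _ _ _ => trivial) (fun _ _ _ _ => trivial) ⟨β, trivial, hβ⟩
  exact ⟨β' [T], fun x => hT ▸ hβ' [T] x⟩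

/-- The oscillatory integral as a Schwartz function. -/
def opSchwartz : 𝓢(ConfSpace d, ℂ) where
  toFun := T.op
  smooth' := contDiff_infty.2 fun n => (T.contDiff_and_decay_op n).1
  decay' k n := (T.contDiff_and_decay_op n).2 k

end WeylData

/-! ### The magnetic Weyl quantization on Schwartz functions -/

section MagWeyl

variable {d : ℕ} (B : MagneticField d)

/-- The phase factor `e^{iφ(x, y)}` of the magnetic Weyl quantization. -/
def MagneticField.phase (p : ConfSpace d × ConfSpace d) : ℂ :=
  Complex.exp (Complex.I * (B.circulation p.1 p.2 : ℂ))

theorem MagneticField.hasTemperateGrowth_phase : B.phase.HasTemperateGrowth :=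
  B.hasTemperateGrowth_circulation.cexp_I_mul

theorem MagneticField.norm_phase (p : ConfSpace d × ConfSpace d) : ‖B.phase p‖ = 1 := by
  rw [phase, mul_comm, Complex.norm_exp_ofReal_mul_I]

/-- The data of the magnetic Weyl quantization of `φ`, applied to `f`. -/
def magWeylData {φ : PhaseSpace d → ℂ} (hφ : IsHormander φ) (f : 𝓢(ConfSpace d, ℂ)) :
    WeylData d where
  E := B.phase
  hE := B.hasTemperateGrowth_phase
  φ := φ
  hφ := hφ
  f := f

/-- The operator `op^A(φ)` on Schwartz functions. -/
def magWeyl {φ : PhaseSpace d → ℂ} (hφ : IsHormander φ) (f : 𝓢(ConfSpace d, ℂ)) :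
    𝓢(ConfSpace d, ℂ) :=
  (((2 * Real.pi) ^ d : ℝ) : ℂ)⁻¹ • (magWeylData B hφ f).opSchwartz

theorem magWeyl_eq {φ : PhaseSpace d → ℂ} (hφ : IsHormander φ) (f : 𝓢(ConfSpace d, ℂ)) :
    ⇑(magWeyl B hφ f) = magWeylOp B φ f := by
  funext x
  change (((2 * Real.pi) ^ d : ℝ) : ℂ)⁻¹ * (∫ ξ, ∫ y, _) = _
  rw [magWeylOp]
  congr 1
  refine integral_congr_ae (ae_of_all _ fun ξ => integral_congr_ae (ae_of_all _ fun y => ?_))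
  simp only [WeylData.amp, magWeylData, MagneticField.phase]
  rw [Complex.ofReal_add, mul_add, Complex.exp_add]
  ring

theorem magWeyl_apply {φ : PhaseSpace d → ℂ} (hφ : IsHormander φ) (f : 𝓢(ConfSpace d, ℂ))
    (x : ConfSpace d) : magWeyl B hφ f x =
      (((2 * Real.pi) ^ d : ℝ) : ℂ)⁻¹ * ∫ ξ, (magWeylData B hφ f).inner x ξ := rfl

/-! ### The weak form of the magnetic Weyl quantization -/

/-- The linear change of variables `(z, v) ↦ (z + v/2, z - v/2)`. -/
def midpointEquiv (d : ℕ) : (ConfSpace d × ConfSpace d) ≃L[ℝ] ConfSpace d × ConfSpace d :=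
  ContinuousLinearEquiv.equivOfInverse
    (ContinuousLinearMap.prod
      (ContinuousLinearMap.fst ℝ (ConfSpace d) (ConfSpace d) +
        (1 / 2 : ℝ) • ContinuousLinearMap.snd ℝ (ConfSpace d) (ConfSpace d))
      (ContinuousLinearMap.fst ℝ (ConfSpace d) (ConfSpace d) -
        (1 / 2 : ℝ) • ContinuousLinearMap.snd ℝ (ConfSpace d) (ConfSpace d)))
    (ContinuousLinearMap.prod
      ((1 / 2 : ℝ) • (ContinuousLinearMap.fst ℝ (ConfSpace d) (ConfSpace d) +
        ContinuousLinearMap.snd ℝ (ConfSpace d) (ConfSpace d)))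
      (ContinuousLinearMap.fst ℝ (ConfSpace d) (ConfSpace d) -
        ContinuousLinearMap.snd ℝ (ConfSpace d) (ConfSpace d)))
    (fun p => Prod.ext
      (by
        change (1 / 2 : ℝ) • ((p.1 + (1 / 2 : ℝ) • p.2) + (p.1 - (1 / 2 : ℝ) • p.2)) = p.1
        module)
      (by
        change (p.1 + (1 / 2 : ℝ) • p.2) - (p.1 - (1 / 2 : ℝ) • p.2) = p.2
        module))
    (fun p => Prod.ext
      (by
        change (1 / 2 : ℝ) • (p.1 + p.2) + (1 / 2 : ℝ) • (p.1 - p.2) = p.1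
        module)
      (by
        change (1 / 2 : ℝ) • (p.1 + p.2) - (1 / 2 : ℝ) • (p.1 - p.2) = p.2
        module))

@[simp]
theorem midpointEquiv_apply (p : ConfSpace d × ConfSpace d) :
    midpointEquiv d p = (p.1 + (1 / 2 : ℝ) • p.2, p.1 - (1 / 2 : ℝ) • p.2) := rfl

theorem measurePreserving_midpointEquiv :
    MeasurePreserving (midpointEquiv d) (volume.prod volume) (volume.prod volume) := by
  have h1 : MeasurePreserving (fun p : ConfSpace d × ConfSpace d => (p.1, p.1 - p.2))
      (volume.prod volume) (volume.prod volume) :=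
    (MeasurePreserving.id volume).skew_product (g := fun x v => x - v) (by fun_prop)
      (ae_of_all _ fun x => (Measure.measurePreserving_sub_left volume x).map_eq)
  have h2 : MeasurePreserving (fun p : ConfSpace d × ConfSpace d => (p.1, p.2 + (1 / 2 : ℝ) • p.1))
      (volume.prod volume) (volume.prod volume) :=
    (MeasurePreserving.id volume).skew_product (g := fun v z => z + (1 / 2 : ℝ) • v) (by fun_prop)
      (ae_of_all _ fun v => (measurePreserving_add_right volume ((1 / 2 : ℝ) • v)).map_eq)
  have h3 := h1.comp (Measure.measurePreserving_swap.comp (h2.comp Measure.measurePreserving_swap))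
  convert h3 using 1
  funext p
  simp only [midpointEquiv_apply, Function.comp_apply, Prod.swap, Prod.mk.injEq, true_and]
  module

/-- The scaling `(z, ζ) ↦ (z, ζ / 2π)` relating momenta to frequencies. -/
def momentumEquiv (d : ℕ) : (ConfSpace d × ConfSpace d) ≃L[ℝ] ConfSpace d × ConfSpace d :=
  (ContinuousLinearEquiv.refl ℝ (ConfSpace d)).prodCongr
    (ContinuousLinearEquiv.smulLeft (Units.mk0 (2 * Real.pi)⁻¹ (by positivity)))

/-- The transform `H ↦ (2π)^{-d} ∫ e^{iζ·v} e^{iφ(z+v/2, z-v/2)} H(z+v/2, z-v/2) dv`. -/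
def wignerTransform (H : 𝓢(ConfSpace d × ConfSpace d, ℂ)) : 𝓢(PhaseSpace d, ℂ) :=
  oscTransform (midpointEquiv d) (momentumEquiv d)
    (fun p => (((2 * Real.pi) ^ d : ℝ) : ℂ)⁻¹ * B.phase (midpointEquiv d p)) H

theorem wignerTransform_apply (H : 𝓢(ConfSpace d × ConfSpace d, ℂ)) (z ζ : ConfSpace d) :
    wignerTransform B H (z, ζ) = (((2 * Real.pi) ^ d : ℝ) : ℂ)⁻¹ * ∫ v,
      Complex.exp (Complex.I * ((⟪ζ, v⟫_ℝ : ℝ) : ℂ)) *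
        (B.phase (midpointEquiv d (z, v)) * H (midpointEquiv d (z, v))) := by
  rw [wignerTransform, oscTransform_apply, ← integral_const_mul]
  · refine integral_congr_ae (ae_of_all _ fun v => ?_)
    change Complex.exp (Complex.I * ((2 * Real.pi * ⟪v, (2 * Real.pi)⁻¹ • ζ⟫_ℝ : ℝ) : ℂ)) *
      (((((2 * Real.pi) ^ d : ℝ) : ℂ)⁻¹ * B.phase (midpointEquiv d (z, v))) *
        H (midpointEquiv d (z, v))) = _
    rw [inner_smul_right, mul_inv_cancel_left₀ (by positivity), real_inner_comm]
    ring
  · exact (Function.HasTemperateGrowth.const _).fun_mul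
      (B.hasTemperateGrowth_phase.comp (midpointEquiv d).hasTemperateGrowth)

/-- The magnetic Weyl quantization in weak form: `∫ g op^A(φ) f` is the pairing of the symbol `φ`
with the Wigner transform of `g ⊗ f`. -/
theorem integral_mul_magWeyl {φ : PhaseSpace d → ℂ} (hφ : IsHormander φ)
    (g f : 𝓢(ConfSpace d, ℂ)) :
    ∫ x, g x * magWeyl B hφ f x = ∫ p, φ p * wignerTransform B (schwartzTensor g f) p := by
  set T := magWeylData B hφ f
  set c : ℂ := (((2 * Real.pi) ^ d : ℝ) : ℂ)⁻¹
  -- integrability of `g(x)` times the inner integral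
  have h1 : Integrable (fun p : ConfSpace d × ConfSpace d => g p.1 * T.inner p.1 p.2)
      (volume.prod volume) := by
    set r := (volume : Measure (ConfSpace d)).integrablePower
    obtain ⟨N, h⟩ := WeylData.exists_inner_bound T.hE r
    obtain ⟨C, hC, h⟩ := h T rfl
    set s := 2 ^ (N + r) * (Finset.Iic (N + r, 0)).sup (schwartzSeminormFamily ℂ (ConfSpace d) ℂ) g
    have hi := Measure.integrable_pow_neg_integrablePower (volume : Measure (ConfSpace d))
    refine ((hi.mul_prod hi).const_mul (s * C)).mono'
      ((g.continuous.comp continuous_fst).aestronglyMeasurable.mul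
        T.stronglyMeasurable_inner.aestronglyMeasurable) (ae_of_all _ fun p => ?_)
    have hg := g.one_add_norm_pow_mul_le (N + r) 0 p.1
    rw [norm_iteratedFDeriv_zero, pow_add, mul_comm ((1 + ‖p.1‖) ^ N), mul_assoc] at hg
    have hg' := norm_le_one_add_rpow_of_pow_mul_le (norm_nonneg p.1) hg
    rw [norm_mul]
    calc _ ≤ ‖g p.1‖ * (C * (1 + ‖p.1‖) ^ N * (1 + ‖p.2‖) ^ (-(r : ℝ))) := by
          gcongr
          exact h p.1 p.2
      _ = ((1 + ‖p.1‖) ^ N * ‖g p.1‖) * (C * (1 + ‖p.2‖) ^ (-(r : ℝ))) := by ring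
      _ ≤ (s * (1 + ‖p.1‖) ^ (-(r : ℝ))) * (C * (1 + ‖p.2‖) ^ (-(r : ℝ))) := by gcongr
      _ = _ := by ring
  -- the integrand for a fixed momentum
  set K : ConfSpace d → ConfSpace d × ConfSpace d → ℂ := fun ξ p =>
    Complex.exp (Complex.I * ((⟪ξ, p.1 - p.2⟫_ℝ : ℝ) : ℂ)) *
      (B.phase p * φ ((1 / 2 : ℝ) • (p.1 + p.2), ξ) * schwartzTensor g f p) with hK
  obtain ⟨Cφ, hCφ⟩ := hφ.2 0
  have h2 : ∀ ξ, Integrable (K ξ) (volume.prod volume) := by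
    intro ξ
    have hph := B.hasTemperateGrowth_phase.1.continuous
    have hφc := hφ.1.continuous
    refine (((schwartzTensor g f).integrable (μ := (volume : Measure (ConfSpace d × ConfSpace d)))).norm.const_mul Cφ).mono'
      (Continuous.aestronglyMeasurable (by fun_prop)) (ae_of_all _ fun p => ?_)
    rw [hK, WeylData.norm_cexp_I_mul, norm_mul, norm_mul, B.norm_phase, one_mul]
    gcongr
    simpa using hCφ ((1 / 2 : ℝ) • (p.1 + p.2), ξ)
  have h3 : ∀ ξ, ∫ x, g x * T.inner x ξ = ∫ p, K ξ p ∂(volume.prod volume) := by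
    intro ξ
    rw [integral_prod _ (h2 ξ)]
    refine integral_congr_ae (ae_of_all _ fun x => ?_)
    simp only [WeylData.inner]
    rw [← integral_const_mul]
    refine integral_congr_ae (ae_of_all _ fun y => ?_)
    simp only [hK, WeylData.amp, schwartzTensor_apply]
    change g x * (_ * (B.phase (x, y) * φ _ * f y)) = _
    ring
  have h4 : ∀ ξ, c * ∫ p, K ξ p ∂(volume.prod volume) =
      ∫ z, φ (z, ξ) * wignerTransform B (schwartzTensor g f) (z, ξ) := by
    intro ξ
    have hmp := measurePreserving_midpointEquiv (d := d)
    have hme : MeasurableEmbedding (midpointEquiv d) :=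
      (midpointEquiv d).toHomeomorph.measurableEmbedding
    have hi : Integrable (fun p => K ξ (midpointEquiv d p)) (volume.prod volume) :=
      (hmp.integrable_comp_emb hme).2 (h2 ξ)
    rw [← hmp.integral_comp hme, integral_prod _ hi, ← integral_const_mul]
    refine integral_congr_ae (ae_of_all _ fun z => ?_)
    simp only [wignerTransform_apply]
    rw [mul_left_comm (φ (z, ξ))]
    congr 1
    rw [← integral_const_mul]
    refine integral_congr_ae (ae_of_all _ fun v => ?_)
    simp only [hK, midpointEquiv_apply]
    have e1 : z + (1 / 2 : ℝ) • v - (z - (1 / 2 : ℝ) • v) = v := by module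
    have e2 : (1 / 2 : ℝ) • (z + (1 / 2 : ℝ) • v + (z - (1 / 2 : ℝ) • v)) = z := by module
    rw [e1, e2]
    ring
  have h5 : Integrable (fun p => φ p * wignerTransform B (schwartzTensor g f) p)
      (volume.prod volume) :=
    ((wignerTransform B (schwartzTensor g f)).integrable (μ := (volume : Measure (ConfSpace d × ConfSpace d)))).bdd_mul (c := Cφ)
      hφ.1.continuous.aestronglyMeasurable (ae_of_all _ fun p => by simpa using hCφ p)
  calc ∫ x, g x * magWeyl B hφ f x = c * ∫ x, ∫ ξ, g x * T.inner x ξ := by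
        rw [← integral_const_mul]
        refine integral_congr_ae (ae_of_all _ fun x => ?_)
        simp only [magWeyl_apply]
        rw [integral_const_mul]
        ring
    _ = ∫ ξ, c * ∫ p, K ξ p ∂(volume.prod volume) := by
        rw [integral_integral_swap h1, ← integral_const_mul]
        simp only [h3]
    _ = ∫ ξ, ∫ z, φ (z, ξ) * wignerTransform B (schwartzTensor g f) (z, ξ) := by simp only [h4]
    _ = _ := (integral_prod_symm _ h5).symm

end MagWeyl

end WeylOperator

/-! ### Families of operators with `∑ ‖A n f‖ ^ 2 = ‖f‖ ^ 2` -/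

section Density

variable {H : Type*} [NormedAddCommGroup H] [InnerProductSpace ℂ H]

/-- The relation `∑ n, ‖A n f‖ ^ 2 = ‖f‖ ^ 2` extends from a dense set to the whole space. -/
theorem hasSum_norm_sq_of_dense {A : ℕ → H →L[ℂ] H} {D : Set H} (hD : Dense D)
    (h : ∀ f ∈ D, HasSum (fun n => ‖A n f‖ ^ 2) (‖f‖ ^ 2)) (f : H) :
    HasSum (fun n => ‖A n f‖ ^ 2) (‖f‖ ^ 2) := by
  have hle : ∀ (s : Finset ℕ) (f : H), ∑ n ∈ s, ‖A n f‖ ^ 2 ≤ ‖f‖ ^ 2 := fun s =>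
    hD.induction (fun f hf => sum_le_hasSum s (fun n _ => by positivity) (h f hf))
      (isClosed_le (by fun_prop) (by fun_prop))
  have hdiff : ∀ (s : Finset ℕ) (g : H),
      |∑ n ∈ s, ‖A n f‖ ^ 2 - ∑ n ∈ s, ‖A n g‖ ^ 2| ≤ ‖f - g‖ * (‖f‖ + ‖g‖) := by
    intro s g
    rw [← Finset.sum_sub_distrib]
    calc _ ≤ ∑ n ∈ s, (‖A n (f - g)‖ * ‖A n f‖ + ‖A n (f - g)‖ * ‖A n g‖) := by
          refine (Finset.abs_sum_le_sum_abs _ _).trans (Finset.sum_le_sum fun n _ => ?_)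
          rw [sq_sub_sq, abs_mul, abs_of_nonneg (by positivity), map_sub, ← mul_add, mul_comm]
          exact mul_le_mul_of_nonneg_right (abs_norm_sub_norm_le _ _) (by positivity)
      _ ≤ _ := by
          rw [Finset.sum_add_distrib, mul_add]
          exact add_le_add
            (sum_mul_le_of_sum_sq_le s _ _ (norm_nonneg _) (norm_nonneg _) (hle s _) (hle s _))
            (sum_mul_le_of_sum_sq_le s _ _ (norm_nonneg _) (norm_nonneg _) (hle s _) (hle s _))
  refine Metric.tendsto_nhds.2 fun ε hε => ?_
  have hopen : IsOpen {g : H | ‖f - g‖ * (‖f‖ + ‖g‖) < ε / 4} :=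
    isOpen_lt (by fun_prop) (by fun_prop)
  obtain ⟨g, hg, hgD⟩ := hD.inter_open_nonempty _ hopen ⟨f, by simpa using by positivity⟩
  have hg' : ‖f - g‖ * (‖f‖ + ‖g‖) < ε / 4 := hg
  filter_upwards [Metric.tendsto_nhds.1 (h g hgD) (ε / 2) (by positivity)] with s hs
  rw [Real.dist_eq] at hs ⊢
  have h1 := hdiff s g
  have h2 : |‖g‖ ^ 2 - ‖f‖ ^ 2| ≤ ‖f - g‖ * (‖f‖ + ‖g‖) := by
    rw [sq_sub_sq, abs_mul, abs_of_nonneg (by positivity), mul_comm, add_comm, norm_sub_rev]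
    exact mul_le_mul_of_nonneg_right (abs_norm_sub_norm_le _ _) (by positivity)
  rw [abs_lt] at hs ⊢
  rw [abs_le] at h1 h2
  constructor <;> linarith [h1.1, h1.2, h2.1, h2.2, hs.1, hs.2]

end Density

/-! ### The Kraus operators `op^A(φ_n)` -/

section KrausOperators

open SchwartzMap FourierTransform

/-- The complex conjugate of a Schwartz function. -/
def SchwartzMap.conj {E : Type*} [NormedAddCommGroup E] [NormedSpace ℝ E] (f : 𝓢(E, ℂ)) :
    𝓢(E, ℂ) := f.postcompCLM (Complex.conjCLE : ℂ →L[ℝ] ℂ)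

@[simp]
theorem SchwartzMap.conj_apply {E : Type*} [NormedAddCommGroup E] [NormedSpace ℝ E]
    (f : 𝓢(E, ℂ)) (x : E) : f.conj x = (starRingEnd ℂ) (f x) := rfl

@[simp]
theorem SchwartzMap.conj_conj {E : Type*} [NormedAddCommGroup E] [NormedSpace ℝ E]
    (f : 𝓢(E, ℂ)) : f.conj.conj = f := by
  ext x
  simp

variable {d : ℕ} (B : MagneticField d)

theorem MagneticField.conj_phase (p : ConfSpace d × ConfSpace d) :
    conj (B.phase p) = B.phase p.swap := by
  rw [phase, phase, ← Complex.exp_conj, map_mul, Complex.conj_I, Complex.conj_ofReal,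
    Prod.fst_swap, Prod.snd_swap, B.circulation_antisymm]
  push_cast
  ring_nf

theorem MagneticField.phase_self (x : ConfSpace d) : B.phase (x, x) = 1 := by
  simp [phase, B.circulation_self]

/-- Conjugation exchanges the two variables of the kernel: substitute `-v` for `v`. -/
theorem conj_wignerTransform (f g : 𝓢(ConfSpace d, ℂ)) (p : PhaseSpace d) :
    conj (wignerTransform B (schwartzTensor f.conj g) p) =
      wignerTransform B (schwartzTensor g.conj f) p := by
  obtain ⟨z, ζ⟩ := p
  rw [wignerTransform_apply, wignerTransform_apply, map_mul, ← integral_conj, map_inv₀,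
    Complex.conj_ofReal]
  congr 1
  rw [← integral_neg_eq_self]
  refine integral_congr_ae (ae_of_all _ fun v => ?_)
  simp only [map_mul, MagneticField.conj_phase, midpointEquiv_apply, schwartzTensor_apply,
    SchwartzMap.conj_apply, Complex.conj_conj, smul_neg, sub_neg_eq_add, Prod.swap_prod_mk,
    ← sub_eq_add_neg, ← Complex.exp_conj, Complex.conj_I, Complex.conj_ofReal, inner_neg_right]
  push_cast
  rw [neg_mul_neg]
  ring

/-- The formal adjoint of `op^A(φ)` is the quantization of the conjugate symbol. -/
theorem integral_conj_mul_magWeyl {φ : PhaseSpace d → ℂ} (hφ : IsHormander φ)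
    (hφ' : IsHormander fun X => conj (φ X)) (g f : 𝓢(ConfSpace d, ℂ)) :
    ∫ x, conj (g x) * magWeyl B hφ f x = conj (∫ x, conj (f x) * magWeyl B hφ' g x) := by
  have h1 := integral_mul_magWeyl B hφ g.conj f
  have h2 := integral_mul_magWeyl B hφ' f.conj g
  simp only [SchwartzMap.conj_apply] at h1 h2
  rw [h1, h2, ← integral_conj]
  refine integral_congr_ae (ae_of_all _ fun p => ?_)
  simp only [map_mul, Complex.conj_conj]
  rw [conj_wignerTransform]

/-- Integrating over momenta restricts the kernel to the diagonal. -/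
theorem integral_wignerTransform (H : 𝓢(ConfSpace d × ConfSpace d, ℂ)) :
    ∫ p, wignerTransform B H p = ∫ x, H (x, x) := by
  have hm : (fun p => (((2 * Real.pi) ^ d : ℝ) : ℂ)⁻¹ *
      B.phase (midpointEquiv d p)).HasTemperateGrowth :=
    (Function.HasTemperateGrowth.const _).fun_mul
      (B.hasTemperateGrowth_phase.comp (midpointEquiv d).hasTemperateGrowth)
  set G := smulLeftCLM ℂ (fun p => (((2 * Real.pi) ^ d : ℝ) : ℂ)⁻¹ *
    B.phase (midpointEquiv d p)) (compCLMOfContinuousLinearEquiv ℂ (midpointEquiv d) H) with hG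
  have hi : Integrable (wignerTransform B H)
      ((volume : Measure (ConfSpace d)).prod (volume : Measure (ConfSpace d))) :=
    (wignerTransform B H).integrable (μ := (volume : Measure (ConfSpace d × ConfSpace d)))
  refine (integral_prod _ hi).trans (integral_congr_ae (ae_of_all _ fun z => ?_))
  have h1 : ∀ ζ, wignerTransform B H (z, ζ) = 𝓕⁻ (G.slice z) ((2 * Real.pi)⁻¹ • ζ) := fun ζ =>
    partialFourierInv_apply G z _
  have h2 : ∫ w, 𝓕⁻ (G.slice z) w = G.slice z 0 := by
    have h3 : 𝓕 (𝓕⁻ (G.slice z)) 0 = G.slice z 0 := by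
      rw [FourierTransform.fourier_fourierInv_eq]
    rw [SchwartzMap.fourier_coe, Real.fourier_eq'] at h3
    simpa using h3
  simp only [h1]
  rw [Measure.integral_comp_inv_smul_of_nonneg volume (fun w => 𝓕⁻ (G.slice z) w)
    (by positivity : (0 : ℝ) ≤ 2 * Real.pi), h2, finrank_euclideanSpace_fin]
  change ((2 * Real.pi) ^ d : ℝ) • (G (z, 0)) = _
  rw [hG, smulLeftCLM_apply_apply hm]
  change ((2 * Real.pi) ^ d : ℝ) • ((((2 * Real.pi) ^ d : ℝ) : ℂ)⁻¹ *
    B.phase (midpointEquiv d (z, 0))) • H (midpointEquiv d (z, 0)) = _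
  have h0 : (((2 * Real.pi) ^ d : ℝ) : ℂ) ≠ 0 := by
    exact_mod_cast (by positivity : ((2 * Real.pi) ^ d : ℝ) ≠ 0)
  simp only [midpointEquiv_apply, smul_zero, add_zero, sub_zero, B.phase_self, mul_one]
  rw [Complex.real_smul, smul_eq_mul, mul_inv_cancel_left₀ h0]

/-- The operator `op^A(φ)` as a linear map on Schwartz functions. -/
def magWeylLinear {φ : PhaseSpace d → ℂ} (hφ : IsHormander φ) :
    𝓢(ConfSpace d, ℂ) →ₗ[ℂ] 𝓢(ConfSpace d, ℂ) where
  toFun := magWeyl B hφ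
  map_add' f g := by
    ext x
    have h : ∀ ξ, (magWeylData B hφ (f + g)).inner x ξ =
        (magWeylData B hφ f).inner x ξ + (magWeylData B hφ g).inner x ξ := by
      intro ξ
      rw [WeylData.inner, WeylData.inner, WeylData.inner,
        ← integral_add (WeylData.integrable_integrand _ x ξ) (WeylData.integrable_integrand _ x ξ)]
      refine integral_congr_ae (ae_of_all _ fun y => ?_)
      simp only [WeylData.amp, magWeylData, add_apply]
      ring
    rw [add_apply, magWeyl_apply, magWeyl_apply, magWeyl_apply]
    simp only [h]
    rw [integral_add (WeylData.integrable_inner _ x) (WeylData.integrable_inner _ x), mul_add]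
  map_smul' c f := by
    ext x
    have h : ∀ ξ, (magWeylData B hφ (c • f)).inner x ξ = c * (magWeylData B hφ f).inner x ξ := by
      intro ξ
      rw [WeylData.inner, WeylData.inner, ← integral_const_mul]
      refine integral_congr_ae (ae_of_all _ fun y => ?_)
      simp only [WeylData.amp, magWeylData, smul_apply, smul_eq_mul]
      ring
    rw [RingHom.id_apply, smul_apply, magWeyl_apply, magWeyl_apply]
    simp only [h]
    rw [integral_const_mul, smul_eq_mul]
    ring

theorem IsHormander.conj {φ : PhaseSpace d → ℂ} (h : IsHormander φ) :
    IsHormander fun X => (starRingEnd ℂ) (φ X) := by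
  refine ⟨Complex.conjCLE.contDiff.comp h.1, fun k => ?_⟩
  obtain ⟨C, hC⟩ := h.2 k
  refine ⟨C, fun X => ?_⟩
  have := Complex.conjLIE.norm_iteratedFDeriv_comp_left φ X k
  change ‖iteratedFDeriv ℝ k (Complex.conjLIE ∘ φ) X‖ ≤ C
  rw [this]
  exact hC X

theorem IsBoundedInHormander.isHormander_term {χ : ℕ → PhaseSpace d → ℂ}
    (h : IsBoundedInHormander (fun N X => ∑ n ∈ Finset.range N, χ n X)) (n : ℕ) :
    IsHormander (χ n) := by
  have h0 : χ n = (fun X => ∑ i ∈ Finset.range (n + 1), χ i X) -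
      fun X => ∑ i ∈ Finset.range n, χ i X := by
    funext X
    simp [Finset.sum_range_succ]
  refine ⟨h0 ▸ (h.1 (n + 1)).sub (h.1 n), fun k => ?_⟩
  obtain ⟨C, hC⟩ := h.2 k
  refine ⟨C + C, fun X => ?_⟩
  have h1 := iteratedFDeriv_sub (i := k) ((h.1 (n + 1)).of_le (by exact_mod_cast le_top))
    ((h.1 n).of_le (by exact_mod_cast le_top))
  rw [h0]
  refine (congrArg norm (congrFun h1 X)).trans_le ?_
  exact (norm_sub_le _ _).trans (add_le_add (hC _ X) (hC _ X))

theorem norm_toLp_sq_eq (f : 𝓢(ConfSpace d, ℂ)) :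
    ((‖f.toLp 2‖ ^ 2 : ℝ) : ℂ) = ∫ x, conj (f x) * f x := by
  have h := inner_toL2_toL2_eq f f
  rw [inner_self_eq_norm_sq_to_K] at h
  rw [Complex.ofReal_pow]
  refine h.trans (integral_congr_ae (ae_of_all _ fun x => ?_))
  exact (RCLike.inner_apply _ _).trans (mul_comm _ _)

/-- `‖op^A(φ) f‖²` is the conjugate of `∫ χ W(conj f ⊗ f)`, for the Moyal product `χ` of `conj φ`
and `φ`. -/
theorem norm_sq_magWeyl {φ χ : PhaseSpace d → ℂ} (hφ : IsHormander φ) (hχ : IsHormander χ)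
    (h : IsMoyalProduct B (fun X => conj (φ X)) φ χ) (f : 𝓢(ConfSpace d, ℂ)) :
    ((‖(magWeyl B hφ f).toLp 2‖ ^ 2 : ℝ) : ℂ) =
      conj (∫ p, χ p * wignerTransform B (schwartzTensor f.conj f) p) := by
  rw [norm_toLp_sq_eq, integral_conj_mul_magWeyl B hφ hφ.conj, ← integral_mul_magWeyl B hχ]
  congr 1
  refine integral_congr_ae (ae_of_all _ fun x => ?_)
  simp only [magWeyl_eq, SchwartzMap.conj_apply]
  rw [h f]

end KrausOperators

section KrausExtension

open SchwartzMap

variable {d : ℕ} (B : MagneticField d) {φ : ℕ → PhaseSpace d → ℂ} (hφ : ∀ n, IsHormander (φ n))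
  {χ : ℕ → PhaseSpace d → ℂ}
  (hχ : ∀ n, IsMoyalProduct B (fun X => conj (φ n X)) (φ n) (χ n))
  (hbdd : IsBoundedInHormander (fun N X => ∑ n ∈ Finset.range N, χ n X))
  (hlim : ∀ X, Tendsto (fun N => ∑ n ∈ Finset.range N, χ n X) atTop (𝓝 1))

include hχ hbdd hlim in
/-- On Schwartz functions the operators `op^A(φ_n)` satisfy `∑ ‖op^A(φ_n) f‖² = ‖f‖²`: the partial
sums are the pairings of the partial sums of `∑ conj φ_n ⋆ φ_n` with a fixed Schwartz function, to
which dominated convergence applies. -/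
theorem hasSum_norm_sq_magWeyl (f : 𝓢(ConfSpace d, ℂ)) :
    HasSum (fun n => ‖(magWeyl B (hφ n) f).toLp 2 (volume : Measure (ConfSpace d))‖ ^ 2)
      (‖f.toLp 2 (volume : Measure (ConfSpace d))‖ ^ 2) := by
  rw [hasSum_iff_tendsto_nat_of_nonneg (fun _ => by positivity)]
  have hχH := fun n => hbdd.isHormander_term n
  set W := wignerTransform B (schwartzTensor f.conj f) with hW
  obtain ⟨C, hC⟩ := hbdd.2 0
  have hC' : ∀ N X, ‖∑ n ∈ Finset.range N, χ n X‖ ≤ C := fun N X => by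
    simpa [norm_iteratedFDeriv_zero] using hC N X
  have hcont : ∀ n, Continuous (χ n) := fun n => (hχH n).1.continuous
  have hWi : Integrable W (volume : Measure (PhaseSpace d)) :=
    W.integrable (μ := (volume : Measure (ConfSpace d × ConfSpace d)))
  have hint : ∀ n, Integrable (fun p => χ n p * W p) (volume : Measure (PhaseSpace d)) := by
    intro n
    obtain ⟨c, hc⟩ := (hχH n).2 0
    exact hWi.bdd_mul (hcont n).aestronglyMeasurable
      (ae_of_all _ fun X => by simpa [norm_iteratedFDeriv_zero] using hc X)
  have hlimW : Tendsto (fun N => ∫ p, (∑ n ∈ Finset.range N, χ n p) * W p) atTop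
      (𝓝 (∫ p, 1 * W p)) := by
    refine tendsto_integral_of_dominated_convergence (fun p => C * ‖W p‖) (fun N => ?_)
      (hWi.norm.const_mul C) (fun N => ae_of_all _ fun p => ?_) (ae_of_all _ fun p => ?_)
    · exact ((continuous_finsetSum _ fun n _ => hcont n).mul W.continuous).aestronglyMeasurable
    · rw [norm_mul]
      exact mul_le_mul_of_nonneg_right (hC' N p) (norm_nonneg _)
    · exact (hlim p).mul_const _
  have h1 : ∀ N, ∑ n ∈ Finset.range N,
      ‖(magWeyl B (hφ n) f).toLp 2 (volume : Measure (ConfSpace d))‖ ^ 2 =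
      (conj (∫ p, (∑ n ∈ Finset.range N, χ n p) * W p) : ℂ).re := by
    intro N
    have h2 : ((∑ n ∈ Finset.range N,
        ‖(magWeyl B (hφ n) f).toLp 2 (volume : Measure (ConfSpace d))‖ ^ 2 : ℝ) : ℂ) =
        conj (∫ p, (∑ n ∈ Finset.range N, χ n p) * W p) := by
      simp only [Finset.sum_mul]
      rw [integral_finsetSum _ fun n _ => hint n, map_sum, Complex.ofReal_sum]
      exact Finset.sum_congr rfl fun n _ => norm_sq_magWeyl B (hφ n) (hχH n) (hχ n) f
    rw [← h2, Complex.ofReal_re]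
  have h3 : (conj (∫ p, 1 * W p) : ℂ).re =
      ‖f.toLp 2 (volume : Measure (ConfSpace d))‖ ^ 2 := by
    simp only [one_mul]
    rw [hW, integral_wignerTransform, ← Complex.ofReal_re (‖f.toLp 2 volume‖ ^ 2), norm_toLp_sq_eq,
      Complex.conj_re]
    rfl
  simp only [h1]
  rw [← h3]
  exact (Complex.continuous_re.tendsto _).comp ((Complex.continuous_conj.tendsto _).comp hlimW)

theorem denseRange_toLp :
    DenseRange (toLpCLM ℂ ℂ 2 (volume : Measure (ConfSpace d))).toLinearMap :=
  denseRange_toLpCLM (E := ConfSpace d) (F := ℂ) (p := 2) (μ := volume) ENNReal.ofNat_ne_top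

/-- The bounded operator on `L²` extending `op^A(φ)`. It is meaningful when `op^A(φ)`
is bounded for the `L²` norm; otherwise `LinearMap.extendOfNorm` takes a junk value. -/
def magWeylL2 {φ : PhaseSpace d → ℂ} (hφ : IsHormander φ) : L2Space d →L[ℂ] L2Space d :=
  ((toLpCLM ℂ ℂ 2 (volume : Measure (ConfSpace d))).toLinearMap ∘ₗ
    magWeylLinear B hφ).extendOfNorm (toLpCLM ℂ ℂ 2 (volume : Measure (ConfSpace d))).toLinearMap

include hχ hbdd hlim in
theorem magWeylL2_toLp (n : ℕ) (f : 𝓢(ConfSpace d, ℂ)) :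
    magWeylL2 B (hφ n) (f.toLp 2) = (magWeyl B (hφ n) f).toLp 2 := by
  have h : ∀ g : 𝓢(ConfSpace d, ℂ), ‖(magWeyl B (hφ n) g).toLp 2 (volume : Measure (ConfSpace d))‖
      ≤ 1 * ‖g.toLp 2 (volume : Measure (ConfSpace d))‖ := by
    intro g
    rw [one_mul]
    refine le_of_sq_le_sq ?_ (norm_nonneg _)
    exact le_hasSum (hasSum_norm_sq_magWeyl B hφ hχ hbdd hlim g) n (fun _ _ => by positivity)
  exact LinearMap.extendOfNorm_eq (f := (toLpCLM ℂ ℂ 2 (volume : Measure (ConfSpace d))).toLinearMap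
    ∘ₗ magWeylLinear B (hφ n)) (e := (toLpCLM ℂ ℂ 2 (volume : Measure (ConfSpace d))).toLinearMap)
    denseRange_toLp ⟨1, h⟩ f

include hχ hbdd hlim in
theorem hasSum_norm_sq_magWeylL2 (f : L2Space d) :
    HasSum (fun n => ‖magWeylL2 B (hφ n) f‖ ^ 2) (‖f‖ ^ 2) := by
  have h : ∀ g ∈ Set.range (toLpCLM ℂ ℂ 2 (volume : Measure (ConfSpace d))).toLinearMap,
      HasSum (fun n => ‖magWeylL2 B (hφ n) g‖ ^ 2) (‖g‖ ^ 2) := by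
    rintro _ ⟨g, rfl⟩
    have h1 := hasSum_norm_sq_magWeyl B hφ hχ hbdd hlim g
    simp only [← magWeylL2_toLp B hφ hχ hbdd hlim] at h1
    exact h1
  exact hasSum_norm_sq_of_dense (A := fun n => magWeylL2 B (hφ n)) denseRange_toLp h f

end KrausExtension

/-! ### The super Weyl transform -/

section SuperWeyl

open SchwartzMap

variable {d : ℕ} (B : MagneticField d)

theorem MagneticField.phase_mul_phase_swap (p : ConfSpace d × ConfSpace d) :
    B.phase p * B.phase p.swap = 1 := by
  rw [← B.conj_phase, Complex.mul_conj', B.norm_phase]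
  simp

/-- The change of variables `((z_L, z_R), (v_L, v_R)) ↦ (z + v/2, z - v/2)` in the left and in the
right variables. The fibre over `(z_L, z_R)` carries the Euclidean norm. -/
def superMidpointEquiv (d : ℕ) :
    ((ConfSpace d × ConfSpace d) × WithLp 2 (ConfSpace d × ConfSpace d)) ≃L[ℝ]
      (ConfSpace d × ConfSpace d) × (ConfSpace d × ConfSpace d) :=
  ((ContinuousLinearEquiv.refl ℝ (ConfSpace d × ConfSpace d)).prodCongr
    (WithLp.prodContinuousLinearEquiv 2 ℝ (ConfSpace d) (ConfSpace d))).trans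
    ((ContinuousLinearEquiv.prodProdProdComm ℝ _ _ _ _).trans
      (((midpointEquiv d).prodCongr (midpointEquiv d)).trans
        (ContinuousLinearEquiv.prodProdProdComm ℝ _ _ _ _)))

/-- The scaling `((z_L, ζ_L), (z_R, ζ_R)) ↦ ((z_L, z_R), (ζ_L / 2π, -ζ_R / 2π))`. -/
def superMomentumEquiv (d : ℕ) : (PhaseSpace d × PhaseSpace d) ≃L[ℝ]
    (ConfSpace d × ConfSpace d) × WithLp 2 (ConfSpace d × ConfSpace d) :=
  (ContinuousLinearEquiv.prodProdProdComm ℝ _ _ _ _).trans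
    ((ContinuousLinearEquiv.refl ℝ (ConfSpace d × ConfSpace d)).prodCongr
      (((ContinuousLinearEquiv.smulLeft (Units.mk0 (2 * Real.pi)⁻¹ (by positivity))).prodCongr
        (ContinuousLinearEquiv.smulLeft (-Units.mk0 (2 * Real.pi)⁻¹ (by positivity)))).trans
        (WithLp.prodContinuousLinearEquiv 2 ℝ (ConfSpace d) (ConfSpace d)).symm))

/-- The amplitude of the super Weyl transform, as a function of the kernel variables. -/
def superAmplitude (q : (ConfSpace d × ConfSpace d) × (ConfSpace d × ConfSpace d)) : ℂ :=
  (((2 * Real.pi) ^ (2 * d) : ℝ) : ℂ)⁻¹ * (B.phase (q.1.1, q.2.1) * B.phase (q.2.2, q.1.2))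

/-- The inverse of `superAmplitude`. -/
def superAmplitudeInv (q : (ConfSpace d × ConfSpace d) × (ConfSpace d × ConfSpace d)) : ℂ :=
  (((2 * Real.pi) ^ (2 * d) : ℝ) : ℂ) * (B.phase (q.2.1, q.1.1) * B.phase (q.1.2, q.2.2))

theorem superAmplitude_mul_inv (q : (ConfSpace d × ConfSpace d) × (ConfSpace d × ConfSpace d)) :
    superAmplitude B q * superAmplitudeInv B q = 1 := by
  have h0 : (((2 * Real.pi) ^ (2 * d) : ℝ) : ℂ) ≠ 0 := by
    exact_mod_cast (by positivity : ((2 * Real.pi) ^ (2 * d) : ℝ) ≠ 0)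
  have h1 := B.phase_mul_phase_swap (q.1.1, q.2.1)
  have h2 := B.phase_mul_phase_swap (q.2.2, q.1.2)
  simp only [Prod.swap_prod_mk] at h1 h2
  rw [superAmplitude, superAmplitudeInv]
  calc _ = ((((2 * Real.pi) ^ (2 * d) : ℝ) : ℂ)⁻¹ * (((2 * Real.pi) ^ (2 * d) : ℝ) : ℂ)) *
        (B.phase (q.1.1, q.2.1) * B.phase (q.2.1, q.1.1)) *
        (B.phase (q.2.2, q.1.2) * B.phase (q.1.2, q.2.2)) := by ring
    _ = 1 := by rw [h1, h2, inv_mul_cancel₀ h0]; ring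

theorem hasTemperateGrowth_superAmplitude : (superAmplitude B).HasTemperateGrowth := by
  have h1 := ((ContinuousLinearMap.fst ℝ (ConfSpace d) (ConfSpace d) ∘L
    ContinuousLinearMap.fst ℝ (ConfSpace d × ConfSpace d) (ConfSpace d × ConfSpace d)).prod
    (ContinuousLinearMap.fst ℝ (ConfSpace d) (ConfSpace d) ∘L
    ContinuousLinearMap.snd ℝ (ConfSpace d × ConfSpace d)
      (ConfSpace d × ConfSpace d))).hasTemperateGrowth
  have h2 := ((ContinuousLinearMap.snd ℝ (ConfSpace d) (ConfSpace d) ∘L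
    ContinuousLinearMap.snd ℝ (ConfSpace d × ConfSpace d) (ConfSpace d × ConfSpace d)).prod
    (ContinuousLinearMap.snd ℝ (ConfSpace d) (ConfSpace d) ∘L
    ContinuousLinearMap.fst ℝ (ConfSpace d × ConfSpace d)
      (ConfSpace d × ConfSpace d))).hasTemperateGrowth
  exact (Function.HasTemperateGrowth.const _).fun_mul
    ((B.hasTemperateGrowth_phase.comp h1).fun_mul (B.hasTemperateGrowth_phase.comp h2))

theorem hasTemperateGrowth_superAmplitudeInv : (superAmplitudeInv B).HasTemperateGrowth := by
  have h1 := ((ContinuousLinearMap.fst ℝ (ConfSpace d) (ConfSpace d) ∘L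
    ContinuousLinearMap.snd ℝ (ConfSpace d × ConfSpace d) (ConfSpace d × ConfSpace d)).prod
    (ContinuousLinearMap.fst ℝ (ConfSpace d) (ConfSpace d) ∘L
    ContinuousLinearMap.fst ℝ (ConfSpace d × ConfSpace d)
      (ConfSpace d × ConfSpace d))).hasTemperateGrowth
  have h2 := ((ContinuousLinearMap.snd ℝ (ConfSpace d) (ConfSpace d) ∘L
    ContinuousLinearMap.fst ℝ (ConfSpace d × ConfSpace d) (ConfSpace d × ConfSpace d)).prod
    (ContinuousLinearMap.snd ℝ (ConfSpace d) (ConfSpace d) ∘L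
    ContinuousLinearMap.snd ℝ (ConfSpace d × ConfSpace d)
      (ConfSpace d × ConfSpace d))).hasTemperateGrowth
  exact (Function.HasTemperateGrowth.const _).fun_mul
    ((B.hasTemperateGrowth_phase.comp h1).fun_mul (B.hasTemperateGrowth_phase.comp h2))

/-- The transpose of the super Weyl transform on Schwartz functions. -/
def superWigner : 𝓢((ConfSpace d × ConfSpace d) × (ConfSpace d × ConfSpace d), ℂ) →L[ℂ]
    𝓢(PhaseSpace d × PhaseSpace d, ℂ) :=
  oscTransform (superMidpointEquiv d) (superMomentumEquiv d)
    (superAmplitude B ∘ superMidpointEquiv d)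

/-- A right inverse of `superWigner`. -/
def superWignerInv : 𝓢(PhaseSpace d × PhaseSpace d, ℂ) →L[ℂ]
    𝓢((ConfSpace d × ConfSpace d) × (ConfSpace d × ConfSpace d), ℂ) :=
  oscTransformInv (superMidpointEquiv d) (superMomentumEquiv d)
    (superAmplitudeInv B ∘ superMidpointEquiv d)

theorem hasTemperateGrowth_superAmplitude_comp :
    (superAmplitude B ∘ superMidpointEquiv d).HasTemperateGrowth :=
  (hasTemperateGrowth_superAmplitude B).comp (superMidpointEquiv d).hasTemperateGrowth

theorem superWigner_superWignerInv (G : 𝓢(PhaseSpace d × PhaseSpace d, ℂ)) :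
    superWigner B (superWignerInv B G) = G :=
  oscTransform_oscTransformInv _ _ (hasTemperateGrowth_superAmplitude_comp B)
    ((hasTemperateGrowth_superAmplitudeInv B).comp (superMidpointEquiv d).hasTemperateGrowth)
    (fun _ => superAmplitude_mul_inv B _) G

theorem coe_superWigner
    (H : 𝓢((ConfSpace d × ConfSpace d) × (ConfSpace d × ConfSpace d), ℂ)) :
    ⇑(superWigner B H) = superWeylTranspose B H := by
  funext Z
  obtain ⟨⟨zL, ζL⟩, ⟨zR, ζR⟩⟩ := Z
  rw [superWigner, oscTransform_apply _ _ (hasTemperateGrowth_superAmplitude_comp B),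
    superWeylTranspose, ← integral_const_mul]
  have hme : MeasurableEmbedding (WithLp.toLp 2 : ConfSpace d × ConfSpace d → _) :=
    (WithLp.prodContinuousLinearEquiv 2 ℝ (ConfSpace d)
      (ConfSpace d)).symm.toHomeomorph.measurableEmbedding
  rw [← (WithLp.volume_preserving_toLp (ConfSpace d) (ConfSpace d)).integral_comp hme]
  refine integral_congr_ae (ae_of_all _ fun v => ?_)
  have e1 : ∀ w : WithLp 2 (ConfSpace d × ConfSpace d),
      2 * Real.pi * ⟪w, (superMomentumEquiv d ((zL, ζL), (zR, ζR))).2⟫_ℝ =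
        ⟪ζL, w.ofLp.1⟫_ℝ - ⟪ζR, w.ofLp.2⟫_ℝ := by
    intro w
    rw [WithLp.prod_inner_apply]
    change 2 * Real.pi * (⟪w.ofLp.1, (2 * Real.pi)⁻¹ • ζL⟫_ℝ +
      ⟪w.ofLp.2, (-(2 * Real.pi)⁻¹ : ℝ) • ζR⟫_ℝ) = _
    rw [inner_smul_right, inner_smul_right, real_inner_comm, real_inner_comm ζR]
    field_simp
    ring
  have e2 : superMidpointEquiv d ((zL, zR), WithLp.toLp 2 v) =
      ((zL + (1 / 2 : ℝ) • v.1, zR + (1 / 2 : ℝ) • v.2),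
        (zL - (1 / 2 : ℝ) • v.1, zR - (1 / 2 : ℝ) • v.2)) := rfl
  have e3 : (superMomentumEquiv d ((zL, ζL), (zR, ζR))).1 = (zL, zR) := rfl
  simp only [e1, e3, Function.comp_apply, e2, superAmplitude, MagneticField.phase]
  rw [B.circulation_antisymm (zR + (1 / 2 : ℝ) • v.2)]
  have h : Complex.exp (Complex.I * ((⟪ζL, v.1⟫_ℝ - ⟪ζR, v.2⟫_ℝ
          + B.circulation (zL + (1 / 2 : ℝ) • v.1) (zL - (1 / 2 : ℝ) • v.1)
          - B.circulation (zR + (1 / 2 : ℝ) • v.2) (zR - (1 / 2 : ℝ) • v.2) : ℝ) : ℂ)) =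
      Complex.exp (Complex.I * (⟪ζL, v.1⟫_ℝ - ⟪ζR, v.2⟫_ℝ : ℝ)) *
      Complex.exp (Complex.I * (B.circulation (zL + (1 / 2 : ℝ) • v.1) (zL - (1 / 2 : ℝ) • v.1) : ℝ))
      * Complex.exp (Complex.I *
        (-B.circulation (zR + (1 / 2 : ℝ) • v.2) (zR - (1 / 2 : ℝ) • v.2) : ℝ)) := by
    simp only [← Complex.exp_add]
    push_cast
    ring_nf
  rw [h]
  ring

/-- On tensor products the super Weyl transform factorizes into a left and a right part. -/
theorem superWigner_tensor (g₁ g₂ g₃ g₄ : 𝓢(ConfSpace d, ℂ)) (Z : PhaseSpace d × PhaseSpace d) :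
    superWigner B (schwartzTensor (schwartzTensor g₁ g₂) (schwartzTensor g₃ g₄)) Z =
      wignerTransform B (schwartzTensor g₁ g₃) Z.1 *
        conj (wignerTransform B (schwartzTensor g₂.conj g₄.conj) Z.2) := by
  obtain ⟨⟨zL, ζL⟩, ⟨zR, ζR⟩⟩ := Z
  rw [coe_superWigner, superWeylTranspose, wignerTransform_apply, wignerTransform_apply, map_mul,
    ← integral_conj, mul_mul_mul_comm, ← integral_prod_mul, map_inv₀, Complex.conj_ofReal]
  congr 1
  · rw [← mul_inv, ← Complex.ofReal_mul, ← pow_add, two_mul d]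
  refine integral_congr_ae (ae_of_all _ fun v => ?_)
  simp only [schwartzTensor_apply, map_mul, SchwartzMap.conj_apply, Complex.conj_conj,
    midpointEquiv_apply, MagneticField.phase, ← Complex.exp_conj, Complex.conj_I,
    Complex.conj_ofReal]
  have h : Complex.exp (Complex.I * ((⟪ζL, v.1⟫_ℝ - ⟪ζR, v.2⟫_ℝ
          + B.circulation (zL + (1 / 2 : ℝ) • v.1) (zL - (1 / 2 : ℝ) • v.1)
          - B.circulation (zR + (1 / 2 : ℝ) • v.2) (zR - (1 / 2 : ℝ) • v.2) : ℝ) : ℂ)) =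
      Complex.exp (Complex.I * (⟪ζL, v.1⟫_ℝ : ℝ)) * Complex.exp (-Complex.I * (⟪ζR, v.2⟫_ℝ : ℝ)) *
      Complex.exp (Complex.I * (B.circulation (zL + (1 / 2 : ℝ) • v.1) (zL - (1 / 2 : ℝ) • v.1) : ℝ))
      * Complex.exp (-Complex.I *
        (B.circulation (zR + (1 / 2 : ℝ) • v.2) (zR - (1 / 2 : ℝ) • v.2) : ℝ)) := by
    simp only [← Complex.exp_add]
    push_cast
    ring_nf
  rw [h]
  ring

instance instIsAddHaarMeasureVolumePhaseSpaceProd :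
    (volume : Measure (PhaseSpace d × PhaseSpace d)).IsAddHaarMeasure :=
  Measure.prod.instIsAddHaarMeasure (volume : Measure (PhaseSpace d)) volume

theorem IsHormander.exists_tensor_bound {φ : PhaseSpace d → ℂ} (hφ : IsHormander φ) :
    ∃ C, ∀ Z : PhaseSpace d × PhaseSpace d, ‖φ Z.1 * conj (φ Z.2)‖ ≤ C := by
  obtain ⟨C, hC⟩ := hφ.2 0
  simp only [norm_iteratedFDeriv_zero] at hC
  refine ⟨C * C, fun Z => ?_⟩
  rw [norm_mul, RCLike.norm_conj]
  exact mul_le_mul (hC _) (hC _) (norm_nonneg _) ((norm_nonneg _).trans (hC 0))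

theorem IsHormander.continuous_tensor {φ : PhaseSpace d → ℂ} (hφ : IsHormander φ) :
    Continuous fun Z : PhaseSpace d × PhaseSpace d => φ Z.1 * conj (φ Z.2) :=
  (hφ.1.continuous.comp continuous_fst).mul
    (Complex.continuous_conj.comp (hφ.1.continuous.comp continuous_snd))

theorem IsHormander.integrable_tensor_mul {φ : PhaseSpace d → ℂ} (hφ : IsHormander φ)
    (G : 𝓢(PhaseSpace d × PhaseSpace d, ℂ)) :
    Integrable fun Z : PhaseSpace d × PhaseSpace d => φ Z.1 * conj (φ Z.2) * G Z := by
  obtain ⟨C, hC⟩ := hφ.exists_tensor_bound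
  exact (G.integrable (μ := (volume : Measure (PhaseSpace d × PhaseSpace d)))).bdd_mul (c := C)
    hφ.continuous_tensor.aestronglyMeasurable (ae_of_all _ hC)

/-- The pairing of `φ ⊗ conj φ` with the transposed super Weyl transform of a test function. -/
def superPairing {φ : PhaseSpace d → ℂ} (hφ : IsHormander φ) :
    𝓢((ConfSpace d × ConfSpace d) × (ConfSpace d × ConfSpace d), ℂ) →ₗ[ℂ] ℂ where
  toFun H := ∫ Z : PhaseSpace d × PhaseSpace d, φ Z.1 * conj (φ Z.2) * superWigner B H Z
  map_add' H H' := by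
    simp only [map_add, add_apply, mul_add]
    exact integral_add (hφ.integrable_tensor_mul _) (hφ.integrable_tensor_mul _)
  map_smul' c H := by
    simp only [map_smul, smul_apply, smul_eq_mul, RingHom.id_apply]
    rw [← integral_const_mul]
    congr 1
    funext Z
    ring

theorem superPairing_apply {φ : PhaseSpace d → ℂ} (hφ : IsHormander φ)
    (H : 𝓢((ConfSpace d × ConfSpace d) × (ConfSpace d × ConfSpace d), ℂ)) :
    superPairing B hφ H =
      ∫ Z : PhaseSpace d × PhaseSpace d, φ Z.1 * conj (φ Z.2) * superWigner B H Z := rfl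

/-- On tensor products the pairing is a product of matrix elements of `op^A(φ)`. -/
theorem superPairing_tensor {φ : PhaseSpace d → ℂ} (hφ : IsHormander φ)
    (g₁ g₂ g₃ g₄ : 𝓢(ConfSpace d, ℂ)) :
    superPairing B hφ (schwartzTensor (schwartzTensor g₁ g₂) (schwartzTensor g₃ g₄)) =
      (∫ x, g₁ x * magWeyl B hφ g₃ x) * conj (∫ x, g₂.conj x * magWeyl B hφ g₄.conj x) := by
  rw [integral_mul_magWeyl, integral_mul_magWeyl, ← integral_conj, ← integral_prod_mul,
    superPairing_apply]
  refine integral_congr_ae (ae_of_all _ fun Z => ?_)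
  simp only [superWigner_tensor, map_mul]
  ring

theorem commutesWithSuperposition_superPairing {φ : PhaseSpace d → ℂ} (hφ : IsHormander φ)
    (V : Type) [NormedAddCommGroup V] [InnerProductSpace ℝ V] [MeasurableSpace V] [BorelSpace V]
    [FiniteDimensional ℝ V] : CommutesWithSuperposition V (superPairing B hφ) := by
  intro 𝓗 H hH
  obtain ⟨C, hC⟩ := hφ.exists_tensor_bound
  exact integral_mul_oscTransform_superposition (superMidpointEquiv d) (superMomentumEquiv d)
    (hasTemperateGrowth_superAmplitude_comp B) (volume : Measure (V × V))
    (volume : Measure (PhaseSpace d × PhaseSpace d)) hφ.continuous_tensor hC 𝓗 H hH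

end SuperWeyl

/-! ### Windows on product spaces -/

section Windows

open SchwartzMap

/-- There is a window whose square has integral one. -/
theorem exists_schwartz_integral_mul_self_eq_one (V : Type) [NormedAddCommGroup V]
    [InnerProductSpace ℝ V] [MeasurableSpace V] [BorelSpace V] [FiniteDimensional ℝ V] :
    ∃ g : 𝓢(V, ℂ), ∫ x, g x * g x = 1 := by
  set f : ContDiffBump (0 : V) := default
  have hc : HasCompactSupport fun x => (f x : ℂ) := f.hasCompactSupport.comp_left Complex.ofReal_zero
  have hs : ContDiff ℝ ∞ fun x => (f x : ℂ) := Complex.ofRealCLM.contDiff.comp f.contDiff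
  set g : 𝓢(V, ℂ) := hc.toSchwartzMap hs
  have hg : ∀ x, g x = (f x : ℂ) := fun x => rfl
  have hpos : 0 < ∫ x, f x * f x := by
    refine Continuous.integral_pos_of_hasCompactSupport_nonneg_nonzero (x := 0)
      (f.continuous.mul f.continuous) f.hasCompactSupport.mul_right
      (fun x => mul_self_nonneg _) ?_
    rw [f.one_of_mem_closedBall (by simp [f.rIn_pos.le])]
    norm_num
  refine ⟨(((∫ x, f x * f x) ^ (-(1 / 2) : ℝ) : ℝ) : ℂ) • g, ?_⟩
  have h1 : ∀ x, ((((∫ x, f x * f x) ^ (-(1 / 2) : ℝ) : ℝ) : ℂ) • g) x *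
      ((((∫ x, f x * f x) ^ (-(1 / 2) : ℝ) : ℝ) : ℂ) • g) x =
      (((∫ x, f x * f x)⁻¹ * (f x * f x) : ℝ) : ℂ) := by
    intro x
    have h2 : (∫ x, f x * f x)⁻¹ =
        (∫ x, f x * f x) ^ (-(1 / 2) : ℝ) * (∫ x, f x * f x) ^ (-(1 / 2) : ℝ) := by
      rw [← Real.rpow_add hpos, ← Real.rpow_neg_one]
      norm_num
    rw [h2, smul_apply, hg, smul_eq_mul]
    push_cast
    ring
  simp only [h1]
  rw [integral_complex_ofReal, integral_const_mul, inv_mul_cancel₀ hpos.ne', Complex.ofReal_one]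

variable {V W : Type} [NormedAddCommGroup V] [InnerProductSpace ℝ V] [NormedAddCommGroup W]
  [InnerProductSpace ℝ W]

/-- The tensor product of two Schwartz functions, on the Hilbert space sum of their domains. -/
def euclideanTensor (g : 𝓢(V, ℂ)) (h : 𝓢(W, ℂ)) : 𝓢(WithLp 2 (V × W), ℂ) :=
  compCLMOfContinuousLinearEquiv ℂ (WithLp.prodContinuousLinearEquiv 2 ℝ V W) (schwartzTensor g h)

theorem euclideanTensor_apply (g : 𝓢(V, ℂ)) (h : 𝓢(W, ℂ)) (x : WithLp 2 (V × W)) :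
    euclideanTensor g h x = g x.ofLp.1 * h x.ofLp.2 := rfl

theorem timeFrequencyShift_euclideanTensor (g : 𝓢(V, ℂ)) (h : 𝓢(W, ℂ))
    (s : WithLp 2 (V × W) × WithLp 2 (V × W)) :
    timeFrequencyShift (euclideanTensor g h) s =
      euclideanTensor (timeFrequencyShift g (s.1.ofLp.1, s.2.ofLp.1))
        (timeFrequencyShift h (s.1.ofLp.2, s.2.ofLp.2)) := by
  ext x
  rw [timeFrequencyShift_apply, euclideanTensor_apply, euclideanTensor_apply,
    timeFrequencyShift_apply, timeFrequencyShift_apply, WithLp.prod_inner_apply]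
  simp only [WithLp.ofLp_sub, Prod.fst_sub, Prod.snd_sub]
  rw [mul_add, Complex.ofReal_add, mul_add, Complex.exp_add]
  ring

variable [MeasurableSpace V] [BorelSpace V] [FiniteDimensional ℝ V] [MeasurableSpace W]
  [BorelSpace W] [FiniteDimensional ℝ W]

theorem integral_euclideanTensor_mul (g g' : 𝓢(V, ℂ)) (h h' : 𝓢(W, ℂ)) :
    ∫ x, euclideanTensor g h x * euclideanTensor g' h' x =
      (∫ x, g x * g' x) * ∫ x, h x * h' x := by
  have hme : MeasurableEmbedding (WithLp.ofLp : WithLp 2 (V × W) → V × W) :=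
    (WithLp.prodContinuousLinearEquiv 2 ℝ V W).toHomeomorph.measurableEmbedding
  rw [← integral_prod_mul]
  refine Eq.trans ?_ ((WithLp.volume_preserving_ofLp V W).integral_comp hme
    fun p : V × W => (g p.1 * g' p.1) * (h p.2 * h' p.2))
  refine integral_congr_ae (ae_of_all _ fun x => ?_)
  simp only [euclideanTensor_apply]
  ring

theorem norm_toLp_timeFrequencyShift {d : ℕ} (g : 𝓢(ConfSpace d, ℂ))
    (s : ConfSpace d × ConfSpace d) :
    ‖(timeFrequencyShift g s).toLp 2 (volume : Measure (ConfSpace d))‖ =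
      ‖g.toLp 2 (volume : Measure (ConfSpace d))‖ := by
  rw [← sq_eq_sq₀ (norm_nonneg _) (norm_nonneg _), ← Complex.ofReal_inj, norm_toLp_sq_eq,
    norm_toLp_sq_eq, ← integral_sub_right_eq_self (fun x => conj (g x) * g x) s.1]
  refine integral_congr_ae (ae_of_all _ fun x => ?_)
  simp only [timeFrequencyShift_apply, map_mul]
  rw [mul_mul_mul_comm, mul_comm (conj _), Complex.mul_conj', mul_comm Complex.I,
    Complex.norm_exp_ofReal_mul_I]
  simp

theorem norm_toLp_conj {d : ℕ} (g : 𝓢(ConfSpace d, ℂ)) :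
    ‖g.conj.toLp 2 (volume : Measure (ConfSpace d))‖ =
      ‖g.toLp 2 (volume : Measure (ConfSpace d))‖ := by
  rw [← sq_eq_sq₀ (norm_nonneg _) (norm_nonneg _), ← Complex.ofReal_inj, norm_toLp_sq_eq,
    norm_toLp_sq_eq]
  refine integral_congr_ae (ae_of_all _ fun x => ?_)
  simp [mul_comm]

theorem inner_toLp_conj {d : ℕ} (g f : 𝓢(ConfSpace d, ℂ)) :
    ⟪g.conj.toLp 2 (volume : Measure (ConfSpace d)), f.toLp 2 (volume : Measure (ConfSpace d))⟫_ℂ =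
      ∫ x, g x * f x := by
  refine (inner_toL2_toL2_eq g.conj f).trans (integral_congr_ae (ae_of_all _ fun x => ?_))
  refine (RCLike.inner_apply _ _).trans ?_
  simp [mul_comm]

theorem norm_integral_mul_le {d : ℕ} (g f : 𝓢(ConfSpace d, ℂ)) :
    ‖∫ x, g x * f x‖ ≤ ‖g.toLp 2 (volume : Measure (ConfSpace d))‖ *
      ‖f.toLp 2 (volume : Measure (ConfSpace d))‖ := by
  rw [← inner_toLp_conj, ← norm_toLp_conj g]
  exact norm_inner_le_norm _ _

variable {D : Type} [NormedAddCommGroup D] [NormedSpace ℝ D]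

/-- A series of functionals that commute with superpositions, converging absolutely on the
time-frequency shifts of a window, with a uniform bound, converges to a tempered distribution. -/
theorem exists_hasSum_of_commutesWithSuperposition {g : 𝓢(V, ℂ)} (h : ∫ x, g x * g x = 1)
    (e : D ≃L[ℝ] V) (Λ : ℕ → 𝓢(D, ℂ) →ₗ[ℂ] ℂ) (hΛ : ∀ i, CommutesWithSuperposition V (Λ i)) {A : ℝ}
    (hA : ∀ (F : Finset ℕ) s,
      ∑ i ∈ F, ‖Λ i (compCLMOfContinuousLinearEquiv ℂ e (timeFrequencyShift g s))‖ ≤ A) :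
    ∃ Ψ : 𝓢(D, ℂ) →L[ℂ] ℂ, ∀ H, HasSum (fun n => Λ n H) (Ψ H) := by
  have hA0 : 0 ≤ A := (by simpa using hA ∅ 0)
  have hle := fun F H => sum_norm_le_integral_stft F h e Λ hΛ (hA F) H
  have hsum : ∀ H, Summable fun n => Λ n H := fun H =>
    Summable.of_norm (summable_of_sum_le (fun _ => norm_nonneg _) fun F => hle F H)
  have hnorm : ∀ H, ‖∑' n, Λ n H‖ ≤
      A * ∫ s, ‖stft g (compCLMOfContinuousLinearEquiv ℂ e.symm H) s‖ := fun H =>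
    le_of_tendsto (hsum H).hasSum.norm (Eventually.of_forall fun F =>
      (norm_sum_le _ _).trans (hle F H))
  obtain ⟨s, C, hC, hs⟩ := exists_integral_norm_stft_le g
  obtain ⟨s', C', hC', hs'⟩ := SchwartzMap.exists_sup_seminorm_le
    (compCLMOfContinuousLinearEquiv ℂ (F := ℂ) e.symm) s
  refine ⟨mkCLMtoNormedSpace (𝕜 := ℂ) (σ := RingHom.id ℂ) (fun H => ∑' n, Λ n H)
    (fun H H' => ?_) (fun c H => ?_) ⟨s', A * (C * C'), by positivity, fun H => ?_⟩,
    fun H => (hsum H).hasSum⟩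
  · simp only [map_add]
    exact (hsum H).tsum_add (hsum H')
  · simp only [map_smul, smul_eq_mul, RingHom.id_apply]
    exact tsum_mul_left
  · refine (hnorm H).trans ?_
    rw [mul_assoc, mul_assoc]
    refine mul_le_mul_of_nonneg_left ((hs _).trans ?_) hA0
    exact mul_le_mul_of_nonneg_left (hs' H) hC

end Windows

/-! ### Convergence of `∑ φ_n ⊗ conj φ_n` -/

section Convergence

open SchwartzMap

variable {d : ℕ} (B : MagneticField d) {φ : ℕ → PhaseSpace d → ℂ} (hφ : ∀ n, IsHormander (φ n))

/-- The identification of the space of kernel variables with a Euclidean space. -/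
def kernelSpaceEquiv (d : ℕ) : ((ConfSpace d × ConfSpace d) × (ConfSpace d × ConfSpace d)) ≃L[ℝ]
    WithLp 2 (WithLp 2 (ConfSpace d × ConfSpace d) × WithLp 2 (ConfSpace d × ConfSpace d)) :=
  ((WithLp.prodContinuousLinearEquiv 2 ℝ (ConfSpace d) (ConfSpace d)).symm.prodCongr
    (WithLp.prodContinuousLinearEquiv 2 ℝ (ConfSpace d) (ConfSpace d)).symm).trans
    (WithLp.prodContinuousLinearEquiv 2 ℝ _ _).symm

variable (hA : ∀ f : 𝓢(ConfSpace d, ℂ),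
    HasSum (fun n => ‖(magWeyl B (hφ n) f).toLp 2 (volume : Measure (ConfSpace d))‖ ^ 2)
      (‖f.toLp 2 (volume : Measure (ConfSpace d))‖ ^ 2))

include hA in
/-- On tensor products the series `∑ φ_n ⊗ conj φ_n` converges absolutely, by the Cauchy–Schwarz
inequality. -/
theorem sum_norm_superPairing_tensor_le (F : Finset ℕ) (g₁ g₂ g₃ g₄ : 𝓢(ConfSpace d, ℂ)) :
    ∑ n ∈ F, ‖superPairing B (hφ n) (schwartzTensor (schwartzTensor g₁ g₂)
      (schwartzTensor g₃ g₄))‖ ≤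
      ‖g₁.toLp 2 (volume : Measure (ConfSpace d))‖ * ‖g₂.toLp 2 (volume : Measure (ConfSpace d))‖ *
      (‖g₃.toLp 2 (volume : Measure (ConfSpace d))‖ *
        ‖g₄.toLp 2 (volume : Measure (ConfSpace d))‖) := by
  have hle : ∀ f : 𝓢(ConfSpace d, ℂ),
      ∑ n ∈ F, ‖(magWeyl B (hφ n) f).toLp 2 (volume : Measure (ConfSpace d))‖ ^ 2 ≤
      ‖f.toLp 2 (volume : Measure (ConfSpace d))‖ ^ 2 := fun f =>
    sum_le_hasSum F (fun n _ => by positivity) (hA f)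
  have h1 := sum_mul_le_of_sum_sq_le F _ _ (norm_nonneg _) (norm_nonneg _) (hle g₃) (hle g₄.conj)
  rw [norm_toLp_conj] at h1
  refine le_trans ?_ (mul_le_mul_of_nonneg_left h1 (by positivity))
  rw [Finset.mul_sum]
  refine Finset.sum_le_sum fun n _ => ?_
  rw [superPairing_tensor, norm_mul, RCLike.norm_conj]
  refine (mul_le_mul (norm_integral_mul_le _ _) (norm_integral_mul_le _ _) (norm_nonneg _)
    (by positivity)).trans (le_of_eq ?_)
  rw [norm_toLp_conj]
  ring

include hA in
/-- The series `∑ φ_n ⊗ conj φ_n`, paired with test functions through the super Weyl transform,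
converges absolutely to a tempered distribution: the test function is a superposition of
time-frequency shifts of a tensor product. -/
theorem exists_hasSum_superPairing :
    ∃ Ψ : 𝓢((ConfSpace d × ConfSpace d) × (ConfSpace d × ConfSpace d), ℂ) →L[ℂ] ℂ,
      ∀ H, HasSum (fun n => superPairing B (hφ n) H) (Ψ H) := by
  obtain ⟨γ, hγ⟩ := exists_schwartz_integral_mul_self_eq_one (ConfSpace d)
  set γ₂ := euclideanTensor γ γ with hγ₂
  set γ₄ := euclideanTensor γ₂ γ₂ with hγ₄
  have h4 : ∫ x, γ₄ x * γ₄ x = 1 := by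
    rw [hγ₄, integral_euclideanTensor_mul, hγ₂, integral_euclideanTensor_mul, hγ]
    norm_num
  set e := kernelSpaceEquiv d with he
  set A := ‖γ.toLp 2 (volume : Measure (ConfSpace d))‖ * ‖γ.toLp 2 (volume : Measure (ConfSpace d))‖ *
      (‖γ.toLp 2 (volume : Measure (ConfSpace d))‖ * ‖γ.toLp 2 (volume : Measure (ConfSpace d))‖)
  have hbound : ∀ (F : Finset ℕ) s, ∑ n ∈ F, ‖superPairing B (hφ n)
      (compCLMOfContinuousLinearEquiv ℂ e (timeFrequencyShift γ₄ s))‖ ≤ A := by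
    intro F s
    rw [hγ₄, timeFrequencyShift_euclideanTensor, hγ₂, timeFrequencyShift_euclideanTensor,
      timeFrequencyShift_euclideanTensor]
    refine (sum_norm_superPairing_tensor_le B hφ hA F _ _ _ _).trans (le_of_eq ?_)
    simp only [norm_toLp_timeFrequencyShift]
    rfl
  exact exists_hasSum_of_commutesWithSuperposition h4 e _
    (fun n => commutesWithSuperposition_superPairing B (hφ n) _) hbound

end Convergence

/-! ### Schwartz kernels define trace-class operators -/

section SchwartzKernels

open SchwartzMap FourierTransform

variable {d : ℕ}

/-- The sections of a square integrable kernel form a square integrable family. -/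
theorem isSquareIntegrableFamily_of_continuous {k : ConfSpace d × ConfSpace d → ℂ}
    (hk : Continuous k) (hi : Integrable (fun p => ‖k p‖ ^ 2) (volume.prod volume))
    (hs : ∀ x, MemLp (fun y => k (x, y)) 2 (volume : Measure (ConfSpace d))) :
    IsSquareIntegrableFamily (volume : Measure (ConfSpace d)) (fun x => (hs x).toLp)
      (fun x => ‖(hs x).toLp‖) where
  meas f := by
    have h1 : ∀ x, ⟪(hs x).toLp, f⟫_ℂ = ∫ y, conj (k (x, y)) * f y := by
      intro x
      rw [L2.inner_def]
      refine integral_congr_ae ?_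
      filter_upwards [(hs x).coeFn_toLp] with y hy
      rw [hy, RCLike.inner_apply, mul_comm]
    simp only [h1]
    have hf : StronglyMeasurable fun p : ConfSpace d × ConfSpace d => f p.2 :=
      (Lp.stronglyMeasurable f).comp_measurable measurable_snd
    exact (((Complex.continuous_conj.comp hk).stronglyMeasurable.mul
      hf).integral_prod_right').aestronglyMeasurable
  memLp := by
    have h1 : ∀ x, ‖(hs x).toLp‖ ^ 2 = ∫ y, ‖k (x, y)‖ ^ 2 := by
      intro x
      rw [L2_norm_sq_eq_integral]
      refine integral_congr_ae ?_
      filter_upwards [(hs x).coeFn_toLp] with y hy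
      rw [hy]
    have h2 : (fun x => ‖(hs x).toLp‖) = fun x => √(∫ y, ‖k (x, y)‖ ^ 2) := by
      funext x
      rw [← h1, Real.sqrt_sq (norm_nonneg _)]
    refine (memLp_two_iff_integrable_sq ?_).2 ?_
    · rw [h2]
      exact (Real.continuous_sqrt.comp_stronglyMeasurable
        (hk.norm.pow 2).stronglyMeasurable.integral_prod_right').aestronglyMeasurable
    · simp only [h1]
      exact hi.integral_prod_left
  norm_le x := le_rfl

/-- Every Schwartz function is the kernel of a trace-class operator: with the weight
`w(x) = (1 + ‖x‖²)^(-r/2)`, it is the composition of the square integrable kernels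
`e^{2πi⟨x, η⟩} w(x) w(η)` and `w(η)⁻¹ 𝓕[w⁻¹ t(·, y)](η)`. -/
theorem exists_isSmoothingWithKernel (t : 𝓢(ConfSpace d × ConfSpace d, ℂ)) :
    ∃ T : traceClass (L2Space d), IsSmoothingWithKernel (T : L2Space d →L[ℂ] L2Space d) t := by
  set r : ℝ := d + 1
  set w : ConfSpace d → ℝ := fun x => (1 + ‖x‖ ^ 2) ^ (-r / 2) with hw
  set w' : ConfSpace d → ℝ := fun x => (1 + ‖x‖ ^ 2) ^ (r / 2) with hw'
  have hww' : ∀ x, w x * w' x = 1 := by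
    intro x
    rw [hw, hw']
    simp only
    rw [← Real.rpow_add (by positivity)]
    simp [neg_div]
  have hwpos : ∀ x, 0 ≤ w x := fun x => by positivity
  have hwle : ∀ x, w x ≤ 1 := fun x =>
    Real.rpow_le_one_of_one_le_of_nonpos (by nlinarith [sq_nonneg ‖x‖])
      (by simp only [r]; linarith [(Nat.cast_nonneg d : (0 : ℝ) ≤ d)])
  have hwc : Continuous w := (Function.hasTemperateGrowth_one_add_norm_sq_rpow _ _).1.continuous
  have hw't : w'.HasTemperateGrowth := Function.hasTemperateGrowth_one_add_norm_sq_rpow _ _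
  have hwi : Integrable w := integrable_rpow_neg_one_add_norm_sq (by
    rw [finrank_euclideanSpace_fin]
    simp [r])
  have hw2 : Integrable fun x => w x ^ 2 := by
    refine hwi.mono' (hwc.pow 2).aestronglyMeasurable (ae_of_all _ fun x => ?_)
    rw [Real.norm_of_nonneg (by positivity), sq]
    exact mul_le_of_le_one_left (hwpos x) (hwle x)
  -- the kernel of the left factor
  set k : ConfSpace d × ConfSpace d → ℂ := fun p =>
    Complex.exp (((-(2 * Real.pi * ⟪p.2, p.1⟫_ℝ) : ℝ) : ℂ) * Complex.I) *
      ((w p.1 * w p.2 : ℝ) : ℂ) with hk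
  have hkn : ∀ p, ‖k p‖ ^ 2 = w p.1 ^ 2 * w p.2 ^ 2 := by
    intro p
    rw [hk, norm_mul, Complex.norm_exp_ofReal_mul_I, one_mul, Complex.norm_real,
      Real.norm_of_nonneg (mul_nonneg (hwpos _) (hwpos _)), mul_pow]
  have hkc : Continuous k := by
    have := hwc.comp (continuous_fst (X := ConfSpace d) (Y := ConfSpace d))
    have := hwc.comp (continuous_snd (X := ConfSpace d) (Y := ConfSpace d))
    fun_prop
  have hks : ∀ x, MemLp (fun y => k (x, y)) 2 (volume : Measure (ConfSpace d)) := by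
    intro x
    refine (memLp_two_iff_integrable_sq_norm
      (hkc.comp (Continuous.prodMk_right x)).aestronglyMeasurable).2 ?_
    exact (hw2.const_mul (w x ^ 2)).congr (ae_of_all _ fun y => (hkn (x, y)).symm)
  have hkF := isSquareIntegrableFamily_of_continuous hkc
    (by simp only [hkn]; exact hw2.mul_prod hw2) hks
  -- the kernel of the right factor
  have hm1 : (fun p : ConfSpace d × ConfSpace d => ((w' p.2 : ℝ) : ℂ)).HasTemperateGrowth :=
    Complex.ofRealCLM.hasTemperateGrowth.comp
      (hw't.comp (ContinuousLinearMap.snd ℝ (ConfSpace d) (ConfSpace d)).hasTemperateGrowth)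
  set t₁ := smulLeftCLM ℂ (fun p : ConfSpace d × ConfSpace d => ((w' p.2 : ℝ) : ℂ))
    (compCLMOfContinuousLinearEquiv ℂ
      (ContinuousLinearEquiv.prodComm ℝ (ConfSpace d) (ConfSpace d)) t) with ht₁
  have ht₁_apply : ∀ y x, t₁ (y, x) = ((w' x : ℝ) : ℂ) * t (x, y) := fun y x =>
    smulLeftCLM_apply_apply hm1 _ _
  set k' := smulLeftCLM ℂ (fun p : ConfSpace d × ConfSpace d => ((w' p.2 : ℝ) : ℂ))
    (partialFourier t₁) with hk'
  have hk'_apply : ∀ y η, k' (y, η) = ((w' η : ℝ) : ℂ) * 𝓕 (t₁.slice y) η := fun y η =>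
    smulLeftCLM_apply_apply hm1 _ _
  have hk'2 : Integrable (fun p => ‖k' p‖ ^ 2) (volume.prod volume) :=
    (memLp_two_iff_integrable_sq_norm k'.continuous.aestronglyMeasurable).1
      (k'.memLp 2 (volume : Measure (ConfSpace d × ConfSpace d)))
  have hk's : ∀ y, MemLp (fun η => k' (y, η)) 2 (volume : Measure (ConfSpace d)) := fun y =>
    (k'.slice y).memLp 2 volume
  have hkF' := isSquareIntegrableFamily_of_continuous k'.continuous hk'2 hk's
  obtain ⟨T, hT⟩ := hkF.exists_nuclear hkF'
  refine ⟨T, fun f => (hT f).trans (ae_of_all _ fun x => ?_)⟩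
  refine integral_congr_ae (ae_of_all _ fun y => ?_)
  have key : ⟪(hks x).toLp, (hk's y).toLp⟫_ℂ = t (x, y) := by
    rw [L2.inner_def]
    calc _ = ∫ η, (w x : ℂ) * (Complex.exp (((2 * Real.pi * ⟪η, x⟫_ℝ : ℝ) : ℂ) * Complex.I) •
          𝓕 (t₁.slice y) η) := by
          refine integral_congr_ae ?_
          filter_upwards [(hks x).coeFn_toLp, (hk's y).coeFn_toLp] with η h1 h2
          rw [h1, h2, hk'_apply, hk, RCLike.inner_apply]
          have h3 : (w η : ℂ) * (w' η : ℂ) = 1 := by exact_mod_cast hww' η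
          simp only [map_mul, ← Complex.exp_conj, Complex.conj_I, Complex.conj_ofReal]
          push_cast
          rw [neg_mul_neg, smul_eq_mul]
          linear_combination (w x : ℂ) * Complex.exp (2 * Real.pi * (⟪η, x⟫_ℝ : ℂ) * Complex.I) *
            𝓕 (t₁.slice y) η * h3
      _ = (w x : ℂ) * t₁ (y, x) := by
          rw [integral_const_mul]
          congr 1
          have h4 : 𝓕⁻ (𝓕 (t₁.slice y)) x = t₁.slice y x := by
            rw [FourierTransform.fourierInv_fourier_eq]
          rw [SchwartzMap.fourierInv_coe, Real.fourierInv_eq'] at h4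
          exact h4
      _ = _ := by
          have h3 : (w x : ℂ) * (w' x : ℂ) = 1 := by exact_mod_cast hww' x
          rw [ht₁_apply, ← mul_assoc, h3, one_mul]
  change ⟪(hks x).toLp, (hk's y).toLp⟫_ℂ * f y = _
  rw [key]

end SchwartzKernels

/-! ### The kernel of `∑ A_n T A_n†` -/

section KernelIdentity

open SchwartzMap

section Superposition

variable {V D : Type} [NormedAddCommGroup V] [InnerProductSpace ℝ V] [NormedAddCommGroup D]
  [NormedSpace ℝ D] [MeasurableSpace V] [BorelSpace V] [FiniteDimensional ℝ V]

theorem CommutesWithSuperposition.sub {Λ Λ' : 𝓢(D, ℂ) →ₗ[ℂ] ℂ}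
    (h : CommutesWithSuperposition V Λ) (h' : CommutesWithSuperposition V Λ') :
    CommutesWithSuperposition V (Λ - Λ') := by
  intro 𝓗 H hH
  obtain ⟨h1, h2⟩ := h 𝓗 H hH
  obtain ⟨h1', h2'⟩ := h' 𝓗 H hH
  refine ⟨h1.sub h1', ?_⟩
  simp only [LinearMap.sub_apply]
  rw [h2, h2', ← integral_sub h1 h1']

/-- Functionals which commute with superpositions and agree on the time-frequency shifts of a
window are equal. -/
theorem CommutesWithSuperposition.ext {Λ Λ' : 𝓢(D, ℂ) →ₗ[ℂ] ℂ}
    (h : CommutesWithSuperposition V Λ) (h' : CommutesWithSuperposition V Λ') {g : 𝓢(V, ℂ)}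
    (hg : ∫ x, g x * g x = 1) (e : D ≃L[ℝ] V)
    (heq : ∀ s, Λ (compCLMOfContinuousLinearEquiv ℂ e (timeFrequencyShift g s)) =
      Λ' (compCLMOfContinuousLinearEquiv ℂ e (timeFrequencyShift g s))) (H : 𝓢(D, ℂ)) :
    Λ H = Λ' H := by
  have h1 := sum_norm_le_integral_stft ({()} : Finset Unit) hg e (fun _ => Λ - Λ')
    (fun _ => h.sub h') (A := 0) (fun s => by simp [heq s]) H
  rw [Finset.sum_singleton, zero_mul, LinearMap.sub_apply] at h1
  exact sub_eq_zero.1 (norm_le_zero_iff.1 h1)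

theorem CommutesWithSuperposition.comp_schwartzTensor {E : Type} [NormedAddCommGroup E]
    [NormedSpace ℝ E] {Λ : 𝓢(E × D, ℂ) →ₗ[ℂ] ℂ} (h : CommutesWithSuperposition V Λ)
    (g : 𝓢(E, ℂ)) : CommutesWithSuperposition V (Λ ∘ₗ (schwartzTensorCLM g).toLinearMap) := by
  intro 𝓗 H hH
  set e : ((V × V) × (E × D)) ≃L[ℝ] E × ((V × V) × D) :=
    (ContinuousLinearEquiv.prodAssoc ℝ (V × V) E D).symm.trans
      (((ContinuousLinearEquiv.prodComm ℝ (V × V) E).prodCongr (ContinuousLinearEquiv.refl ℝ D)).trans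
        (ContinuousLinearEquiv.prodAssoc ℝ E (V × V) D))
  refine h (compCLMOfContinuousLinearEquiv ℂ e (schwartzTensor g 𝓗)) (schwartzTensor g H) fun p => ?_
  change g p.1 * H p.2 = ∫ s, g p.1 * 𝓗 (s, p.2)
  rw [integral_const_mul, hH]

variable [MeasurableSpace D] [BorelSpace D] {ν : Measure D}

theorem SchwartzMap.integrable_mul_of_integrable_weight {v : D → ℂ} {N : ℕ}
    (hv : AEStronglyMeasurable v ν) (hi : Integrable (fun x => ‖v x‖ * (1 + ‖x‖) ^ (-(N : ℝ))) ν)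
    (t : 𝓢(D, ℂ)) : Integrable (fun x => v x * t x) ν := by
  refine (hi.mul_const (2 ^ N * (Finset.Iic (N, 0)).sup (schwartzSeminormFamily ℂ D ℂ) t)).mono'
    (hv.mul t.continuous.aestronglyMeasurable) (ae_of_all _ fun x => ?_)
  have h := t.one_add_norm_pow_mul_le N 0 x
  rw [norm_iteratedFDeriv_zero] at h
  rw [norm_mul, mul_assoc]
  refine mul_le_mul_of_nonneg_left ?_ (norm_nonneg _)
  rw [mul_comm ((1 + ‖x‖) ^ (-(N : ℝ)))]
  exact norm_le_one_add_rpow_of_pow_mul_le (norm_nonneg x) h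

/-- The integration of Schwartz functions against a function `v` of moderate growth. -/
def weightPairing {v : D → ℂ} {N : ℕ} (hv : AEStronglyMeasurable v ν)
    (hi : Integrable (fun x => ‖v x‖ * (1 + ‖x‖) ^ (-(N : ℝ))) ν) : 𝓢(D, ℂ) →ₗ[ℂ] ℂ where
  toFun t := ∫ x, v x * t x ∂ν
  map_add' t t' := by
    simp only [add_apply, mul_add]
    exact integral_add (integrable_mul_of_integrable_weight hv hi t)
      (integrable_mul_of_integrable_weight hv hi t')
  map_smul' c t := by
    simp only [smul_apply, smul_eq_mul, RingHom.id_apply]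
    rw [← integral_const_mul]
    congr 1
    funext x
    ring

theorem commutesWithSuperposition_weightPairing [SecondCountableTopology D] [SFinite ν] {v : D → ℂ} {N : ℕ}
    (hv : AEStronglyMeasurable v ν)
    (hi : Integrable (fun x => ‖v x‖ * (1 + ‖x‖) ^ (-(N : ℝ))) ν) :
    CommutesWithSuperposition V (weightPairing hv hi) := by
  intro 𝓗 H hH
  set m := (volume : Measure (V × V)).integrablePower
  set C := 2 ^ (m + N) * (Finset.Iic (m + N, 0)).sup (schwartzSeminormFamily ℂ ((V × V) × D) ℂ) 𝓗
  have hm : Integrable fun s : V × V => (1 + ‖s‖) ^ (-(m : ℝ)) :=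
    Measure.integrable_pow_neg_integrablePower (volume : Measure (V × V))
  have hint : Integrable (fun q : (V × V) × D => v q.2 * 𝓗 q) (volume.prod ν) := by
    refine ((hm.mul_prod hi).mul_const C).mono'
      (hv.comp_snd.mul 𝓗.continuous.aestronglyMeasurable) (ae_of_all _ fun q => ?_)
    have h := 𝓗.one_add_norm_pow_mul_le (m + N) 0 q
    rw [norm_iteratedFDeriv_zero, pow_add] at h
    have h1 : (1 + ‖q.1‖) ^ m * ((1 + ‖q.2‖) ^ N * ‖𝓗 q‖) ≤ C := by
      refine le_trans ?_ h
      rw [← mul_assoc]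
      gcongr
      · exact norm_fst_le q
      · exact norm_snd_le q
    have h2 := norm_le_one_add_rpow_of_pow_mul_le (norm_nonneg q.2)
      ((le_div_iff₀' (by positivity)).2 h1)
    rw [norm_mul]
    refine (mul_le_mul_of_nonneg_left h2 (norm_nonneg _)).trans (le_of_eq ?_)
    rw [Real.rpow_neg (by positivity), Real.rpow_neg (by positivity), Real.rpow_natCast,
      Real.rpow_natCast]
    field_simp
  refine ⟨hint.integral_prod_left, ?_⟩
  change ∫ x, v x * H x ∂ν = ∫ s, ∫ x, v x * 𝓗 (s, x) ∂ν
  rw [integral_integral_swap hint]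
  refine integral_congr_ae (ae_of_all _ fun x => ?_)
  simp only [hH]
  rw [integral_const_mul]

end Superposition

end KernelIdentity

section KrausKernel

open SchwartzMap

variable {d : ℕ}

theorem integrable_norm_L2_mul_weight (u : L2Space d) :
    Integrable fun x => ‖u x‖ *
      (1 + ‖x‖) ^ (-((volume : Measure (ConfSpace d)).integrablePower : ℝ)) := by
  set r := (volume : Measure (ConfSpace d)).integrablePower
  have hi := Measure.integrable_pow_neg_integrablePower (volume : Measure (ConfSpace d))
  have hc : Continuous fun x : ConfSpace d => (1 + ‖x‖) ^ (-(r : ℝ)) :=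
    Continuous.rpow_const (by fun_prop) fun x => Or.inl (by positivity)
  have h2 : MemLp (fun x : ConfSpace d => (1 + ‖x‖) ^ (-(r : ℝ))) 2 volume := by
    refine (memLp_two_iff_integrable_sq hc.aestronglyMeasurable).2
      (hi.mono' (hc.pow 2).aestronglyMeasurable (ae_of_all _ fun x => ?_))
    rw [Real.norm_of_nonneg (by positivity), sq]
    refine mul_le_of_le_one_left (by positivity)
      (Real.rpow_le_one_of_one_le_of_nonpos (by linarith [norm_nonneg x]) (by simp))
  exact (Lp.memLp u).norm.integrable_mul h2

theorem aestronglyMeasurable_L2_tensor (u w : L2Space d) :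
    AEStronglyMeasurable (fun p : ConfSpace d × ConfSpace d => conj (u p.1) * w p.2)
      (volume.prod volume) := by
  have hu : StronglyMeasurable fun p : ConfSpace d × ConfSpace d => u p.1 :=
    (Lp.stronglyMeasurable u).comp_measurable measurable_fst
  have hw : StronglyMeasurable fun p : ConfSpace d × ConfSpace d => w p.2 :=
    (Lp.stronglyMeasurable w).comp_measurable measurable_snd
  exact ((Complex.continuous_conj.comp_stronglyMeasurable hu).mul hw).aestronglyMeasurable

theorem integrable_norm_L2_tensor_mul_weight (u w : L2Space d) :
    Integrable (fun p : ConfSpace d × ConfSpace d => ‖conj (u p.1) * w p.2‖ * (1 + ‖p‖) ^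
      (-(((volume : Measure (ConfSpace d)).integrablePower +
        (volume : Measure (ConfSpace d)).integrablePower : ℕ) : ℝ))) (volume.prod volume) := by
  set r := (volume : Measure (ConfSpace d)).integrablePower
  have hc : Continuous fun p : ConfSpace d × ConfSpace d => (1 + ‖p‖) ^ (-((r + r : ℕ) : ℝ)) :=
    Continuous.rpow_const (by fun_prop) fun x => Or.inl (by positivity)
  refine ((integrable_norm_L2_mul_weight u).mul_prod (integrable_norm_L2_mul_weight w)).mono'
    ((aestronglyMeasurable_L2_tensor u w).norm.mul hc.aestronglyMeasurable)
    (ae_of_all _ fun p => ?_)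
  rw [Real.norm_of_nonneg (by positivity), norm_mul, RCLike.norm_conj, mul_mul_mul_comm]
  refine mul_le_mul_of_nonneg_left ?_ (by positivity)
  rw [Nat.cast_add, neg_add, Real.rpow_add (by positivity)]
  refine mul_le_mul ?_ ?_ (by positivity) (by positivity)
  · exact Real.rpow_le_rpow_of_nonpos (by positivity) (by gcongr; exact norm_fst_le p) (by simp)
  · exact Real.rpow_le_rpow_of_nonpos (by positivity) (by gcongr; exact norm_snd_le p) (by simp)

/-- The functional `t ↦ ⟨u, T w⟩ = ∫∫ conj u(x) t(x, y) w(y)`, for the operator `T` with kernel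
`t`. -/
def kernelPairing (u w : L2Space d) : 𝓢(ConfSpace d × ConfSpace d, ℂ) →ₗ[ℂ] ℂ :=
  weightPairing (aestronglyMeasurable_L2_tensor u w) (integrable_norm_L2_tensor_mul_weight u w)

theorem commutesWithSuperposition_kernelPairing (V : Type) [NormedAddCommGroup V]
    [InnerProductSpace ℝ V] [MeasurableSpace V] [BorelSpace V] [FiniteDimensional ℝ V]
    (u w : L2Space d) : CommutesWithSuperposition V (kernelPairing u w) :=
  commutesWithSuperposition_weightPairing _ _

theorem IsSmoothingWithKernel.inner_eq {T : L2Space d →L[ℂ] L2Space d}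
    {t : 𝓢(ConfSpace d × ConfSpace d, ℂ)} (h : IsSmoothingWithKernel T t) (u w : L2Space d) :
    ⟪u, T w⟫_ℂ = kernelPairing u w t := by
  have hi : Integrable (fun p : ConfSpace d × ConfSpace d => conj (u p.1) * w p.2 * t p)
      (volume.prod volume) :=
    integrable_mul_of_integrable_weight (aestronglyMeasurable_L2_tensor u w)
      (integrable_norm_L2_tensor_mul_weight u w) t
  refine Eq.trans ?_ (integral_prod _ hi).symm
  rw [L2.inner_def]
  refine integral_congr_ae ?_
  filter_upwards [h w] with x hx
  rw [hx, RCLike.inner_apply, mul_comm, ← integral_const_mul]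
  refine integral_congr_ae (ae_of_all _ fun y => ?_)
  ring

theorem kernelPairing_tensor (u w : L2Space d) (α β : 𝓢(ConfSpace d, ℂ)) :
    kernelPairing u w (schwartzTensor α β) =
      ⟪u, α.toLp 2 volume⟫_ℂ * ⟪β.conj.toLp 2 volume, w⟫_ℂ := by
  rw [L2.inner_def, L2.inner_def, ← integral_congr_ae
    (g := fun x => ⟪u x, (α.toLp 2 volume : L2Space d) x⟫_ℂ) (ae_of_all _ fun x => rfl)]
  have h1 : ∫ x, ⟪u x, (α.toLp 2 volume : L2Space d) x⟫_ℂ = ∫ x, conj (u x) * α x := by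
    refine integral_congr_ae ?_
    filter_upwards [α.coeFn_toLp 2 volume] with x hx
    rw [hx, RCLike.inner_apply, mul_comm]
  have h2 : ∫ x, ⟪(β.conj.toLp 2 volume : L2Space d) x, w x⟫_ℂ = ∫ x, w x * β x := by
    refine integral_congr_ae ?_
    filter_upwards [β.conj.coeFn_toLp 2 volume] with x hx
    rw [hx, RCLike.inner_apply]
    simp
  rw [h1, h2, ← integral_prod_mul]
  refine integral_congr_ae (ae_of_all _ fun p => ?_)
  change conj (u p.1) * w p.2 * (α p.1 * β p.2) = _
  ring

theorem kernelPairing_adjoint_tensor (B : MagneticField d) {φ : PhaseSpace d → ℂ}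
    (hφ : IsHormander φ) {A : L2Space d →L[ℂ] L2Space d}
    (hA : ∀ f : 𝓢(ConfSpace d, ℂ), A (f.toLp 2 volume) = (magWeyl B hφ f).toLp 2 volume)
    (g f α β : 𝓢(ConfSpace d, ℂ)) :
    kernelPairing (ContinuousLinearMap.adjoint A (g.conj.toLp 2 volume))
        (ContinuousLinearMap.adjoint A (f.toLp 2 volume)) (schwartzTensor α β) =
      superPairing B hφ (schwartzTensor (schwartzTensor g f) (schwartzTensor α β)) := by
  have h1 : ⟪β.conj.toLp 2 volume, ContinuousLinearMap.adjoint A (f.toLp 2 volume)⟫_ℂ =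
      conj (∫ x, f.conj x * magWeyl B hφ β.conj x) := by
    rw [ContinuousLinearMap.adjoint_inner_right, hA, ← inner_conj_symm, ← inner_toLp_conj,
      SchwartzMap.conj_conj]
  have h2 : ⟪ContinuousLinearMap.adjoint A (g.conj.toLp 2 volume), α.toLp 2 volume⟫_ℂ =
      ∫ x, g x * magWeyl B hφ α x := by
    rw [ContinuousLinearMap.adjoint_inner_left, hA, inner_toLp_conj]
  rw [kernelPairing_tensor, superPairing_tensor, h1, h2]

/-- Kernel pairings and super pairings that agree on tensor products agree everywhere. -/
theorem kernelPairing_eq_superPairing (B : MagneticField d) {φ : PhaseSpace d → ℂ}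
    (hφ : IsHormander φ) (u w : L2Space d) (k : 𝓢(ConfSpace d × ConfSpace d, ℂ))
    (h : ∀ α β : 𝓢(ConfSpace d, ℂ), kernelPairing u w (schwartzTensor α β) =
      superPairing B hφ (schwartzTensor k (schwartzTensor α β)))
    (t : 𝓢(ConfSpace d × ConfSpace d, ℂ)) :
    kernelPairing u w t = superPairing B hφ (schwartzTensor k t) := by
  obtain ⟨γ, hγ⟩ := exists_schwartz_integral_mul_self_eq_one (ConfSpace d)
  have h2 : ∫ x, euclideanTensor γ γ x * euclideanTensor γ γ x = 1 := by
    rw [integral_euclideanTensor_mul, hγ, one_mul]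
  have key := CommutesWithSuperposition.ext
    (commutesWithSuperposition_kernelPairing (WithLp 2 (ConfSpace d × ConfSpace d)) u w)
    ((commutesWithSuperposition_superPairing B hφ
      (WithLp 2 (ConfSpace d × ConfSpace d))).comp_schwartzTensor k) h2
    (WithLp.prodContinuousLinearEquiv 2 ℝ (ConfSpace d) (ConfSpace d)).symm
  refine key (fun s => ?_) t
  rw [timeFrequencyShift_euclideanTensor]
  exact h _ _

/-- The operator `A T A†` with `A = op^A(φ)` has the kernel given by the super symbol
`φ ⊗ conj φ`. -/
theorem IsSmoothingWithKernel.inner_kraus {T : L2Space d →L[ℂ] L2Space d}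
    {t : 𝓢(ConfSpace d × ConfSpace d, ℂ)} (hT : IsSmoothingWithKernel T t) (B : MagneticField d)
    {φ : PhaseSpace d → ℂ} (hφ : IsHormander φ) {A : L2Space d →L[ℂ] L2Space d}
    (hA : ∀ f : 𝓢(ConfSpace d, ℂ), A (f.toLp 2 volume) = (magWeyl B hφ f).toLp 2 volume)
    (g f : 𝓢(ConfSpace d, ℂ)) :
    ⟪g.conj.toLp 2 volume, A (T (ContinuousLinearMap.adjoint A (f.toLp 2 volume)))⟫_ℂ =
      superPairing B hφ (schwartzTensor (schwartzTensor g f) t) := by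
  have h0 := hT.inner_eq (ContinuousLinearMap.adjoint A (g.conj.toLp 2 volume))
    (ContinuousLinearMap.adjoint A (f.toLp 2 volume))
  rw [ContinuousLinearMap.adjoint_inner_left] at h0
  exact h0.trans (kernelPairing_eq_superPairing B hφ _ _ _
    (kernelPairing_adjoint_tensor B hφ hA g f) t)

end KrausKernel

/-! ### Trace preserving completely positive maps from super symbols -/

section SuperOperator

open SchwartzMap

variable {d : ℕ} (B : MagneticField d) {φ : ℕ → PhaseSpace d → ℂ} (hφ : ∀ n, IsHormander (φ n))

theorem inner_conj_toLp_eq_integral (g : 𝓢(ConfSpace d, ℂ)) (h : L2Space d) :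
    ⟪g.conj.toLp 2 volume, h⟫_ℂ = ∫ x, g x * h x := by
  rw [L2.inner_def]
  refine integral_congr_ae ?_
  filter_upwards [g.conj.coeFn_toLp 2 volume] with x hx
  rw [hx, RCLike.inner_apply, mul_comm]
  simp

theorem superPairing_superWignerInv_superWigner (n : ℕ)
    (H : 𝓢((ConfSpace d × ConfSpace d) × (ConfSpace d × ConfSpace d), ℂ)) :
    superPairing B (hφ n) (superWignerInv B (superWigner B H)) = superPairing B (hφ n) H := by
  rw [superPairing_apply, superPairing_apply, superWigner_superWignerInv]

/-- Convergence of `∑ φ_n ⊗ conj φ_n` may be tested through the super Weyl transform, since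
`superWigner` is surjective. -/
theorem hasWeakStarTensorSum_of_hasSum {Φ : 𝓢'(PhaseSpace d × PhaseSpace d, ℂ)}
    (h : ∀ G, HasSum (fun n => superPairing B (hφ n) (superWignerInv B G)) (Φ G)) :
    HasWeakStarTensorSum φ Φ := by
  intro G
  refine (h G).tendsto_sum_nat.congr fun N => ?_
  simp only [superPairing_apply, superWigner_superWignerInv, Finset.sum_mul]
  exact (integral_finsetSum _ fun n _ => (hφ n).integrable_tensor_mul G).symm

end SuperOperator

end

theorem theorem7p1 (d : ℕ) (B : MagneticField d)
    (φ : ℕ → PhaseSpace d → ℂ) (hφ : ∀ n, IsHormander (φ n))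
    (χ : ℕ → PhaseSpace d → ℂ)
    (hχ : ∀ n, IsMoyalProduct B (fun X => conj (φ n X)) (φ n) (χ n))
    (hbdd : IsBoundedInHormander (fun N X => ∑ n ∈ Finset.range N, χ n X))
    (hlim : ∀ X, Tendsto (fun N => ∑ n ∈ Finset.range N, χ n X) atTop (𝓝 1)) :
    ∃ Φ : 𝓢'(PhaseSpace d × PhaseSpace d, ℂ),
      HasWeakStarTensorSum φ Φ ∧
      ∃ S : traceClass (L2Space d) →ₗ[ℂ] traceClass (L2Space d),
        IsMagSuperOp B Φ S ∧ IsTraceNormBounded S ∧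
        IsCompletelyPositive S ∧ IsTracePreserving S := by
  have hA := hasSum_norm_sq_magWeylL2 B hφ hχ hbdd hlim
  obtain ⟨Ψ, hΨ⟩ := exists_hasSum_superPairing B hφ (hasSum_norm_sq_magWeyl B hφ hχ hbdd hlim)
  refine ⟨ContinuousLinearMap.toPointwiseConvergenceCLM ℂ (RingHom.id ℂ) _ ℂ
      (Ψ ∘L superWignerInv B),
    hasWeakStarTensorSum_of_hasSum B hφ fun G => hΨ _, krausMap (fun n => magWeylL2 B (hφ n)) hA,
    ⟨ContinuousLinearMap.toPointwiseConvergenceCLM ℂ (RingHom.id ℂ) _ ℂ Ψ, fun H => ?_,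
      fun t => ?_⟩,
    isTraceNormBounded_krausMap hA, isCompletelyPositive_krausMap hA, isTracePreserving_krausMap hA⟩
  · refine ⟨superWigner B H, coe_superWigner B H, ?_⟩
    -- the pairings depend on `H` only through `superWigner B H`
    have h := hΨ (superWignerInv B (superWigner B H))
    simp only [superPairing_superWignerInv_superWigner] at h
    exact (hΨ H).unique h
  · obtain ⟨T, hT⟩ := exists_isSmoothingWithKernel t
    refine ⟨T, hT, fun g f => ?_⟩
    rw [← inner_conj_toLp_eq_integral]
    have h1 := (hasSum_krausMap_apply hA T (f.toLp 2 volume)).mapL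
      (innerSL ℂ (g.conj.toLp 2 (volume : Measure (ConfSpace d))))
    simp only [innerSL_apply_apply] at h1
    have h2 : ∀ n, _ = _ := fun n => hT.inner_kraus B (hφ n)
      (magWeylL2_toLp B hφ hχ hbdd hlim n) g f
    simp only [h2] at h1
    exact h1.unique (hΨ _)
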